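/- Let $\mathcal D$ be a unitary multifusion category: a $\mathbb C$-linear rigid monoidal category with finite direct sums and finite-dimensional Hom spaces, with finitely many isomorphism classes of simple objects ($\operatorname{End}(X)=\mathbb C\,\mathrm{id}_X\neq 0$), in which every object is a finite direct sum of simple ones, and with an antilinear involutive contravariant identity-on-objects functor $\dagger$ such that $(f\otimes g)^\dagger=f^\dagger\otimes g^\dagger$, the associator and the unitors are unitary, and $f^\dagger f=0$ implies $f=0$. The unit object need not be simple. Let $\operatorname{Irr}(\mathcal D)$ be a set of representatives of the simple objects. For $x\in\operatorname{Irr}(\mathcal D)$ with dual $\bar x$, the duality maps $\mathrm{ev}_x:\bar x\otimes x\to\mathbf 1$, $\mathrm{coev}_x:\mathbf 1\to x\otimes\bar x$ have loop values $\ell_x,r_x$ defined by $\mathrm{id}_x\otimes(\mathrm{ev}_x\mathrm{ev}_x^\dagger)=\ell_x\,\mathrm{id}_x$ and $(\mathrm{coev}_x^\dagger\mathrm{coev}_x)\otimes\mathrm{id}_x=r_x\,\mathrm{id}_x$; the quantum dimension is $d_x=\sqrt{\ell_xr_x}$, and $\widetilde{\mathrm{coev}}_x=\tfrac{d_x}{\ell_x}\mathrm{ev}_x^\dagger:\mathbf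 1\to\bar x\otimes x$, $\widetilde{\mathrm{ev}}_x=\tfrac{d_x}{r_x}\mathrm{coev}_x^\dagger:x\otimes\bar x\to\mathbf 1$ are the duality maps on the other side (so that all $x$-loops have the value $d_x$). Associators and unitors are suppressed below. Let $$\mathbf{Tube}=\bigoplus_{a,b,c,e,f,h\in\operatorname{Irr}(\mathcal D)}\operatorname{Hom}(c,a\otimes e\otimes b)\otimes\operatorname{Hom}(a\otimes f\otimes b,h),$$ and write $[p,q]$ for $p\otimes q$ in the summand $(a,b,c,e,f,h)$: the double-arc diagram with left arc $a$, right arc $b$, lower half $p$ and upper half $q$. For arbitrary objects $A,B$ and $p:c\to A\otimes e\otimes B$, $q:A\otimes f\otimes B\to h$ put $[p,q]=\sum_{r,s}[(\pi_r\otimes\mathrm{id}\otimes\pi'_s)p,\;q(\iota_r\otimes\mathrm{id}\otimes\iota'_s)]$, where $\mathrm{id}_A=\sum_r\iota_r\pi_r$, $\mathrm{id}_B=\sum_s\iota'_s\pi'_s$ are decompositions into simple objects of $\operatorname{Irr}(\mathcal D)$. Define linear maps as follows. * Multiplication (stacking, the second diagram inside the first): $[p,q]\cdot[p',q']=\delta_{f,h'}\delta_{e,c'}\,[(\mathrm{id}_a\otimes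 p'\otimes\mathrm{id}_b)p,\;q(\mathrm{id}_a\otimes q'\otimes\mathrm{id}_b)]$, with arcs $a\otimes a'$ and $b'\otimes b$. * Unit: $1=\sum_{x,y}E^x_y$, where $E^x_y=[\mathrm{id}_y,\mathrm{id}_x]$ has both arcs equal to $\mathbf 1$, with $c=e=y$ and $f=h=x$. * Counit: $\varepsilon([p,q])=\delta_{e,f}\delta_{c,h}\lambda$, where $qp=\lambda\,\mathrm{id}_c$ (the closed diagram divided by $d_h$). * Comultiplication: $\Delta([p,q])=\sum_{i\in\operatorname{Irr}(\mathcal D)}\sum_r[\iota_r,q]\otimes[p,\pi_r]$, where $\mathrm{id}_{a\otimes i\otimes b}=\sum_r\iota_r\pi_r$ is a decomposition into simple objects $k_r\in\operatorname{Irr}(\mathcal D)$. * Antipode (the reflected diagram): $S([p,q])=\frac{d_f}{d_h}\,[\hat q,\hat p]$ with arcs $\bar a,\bar b$, where $\hat q=(\mathrm{id}_{\bar a}\otimes q\otimes\mathrm{id}_{\bar b})(\widetilde{\mathrm{coev}}_a\otimes\mathrm{id}_f\otimes\mathrm{coev}_b):f\to\bar a\otimes h\otimes\bar b$ and $\hat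 p=(\mathrm{ev}_a\otimes\mathrm{id}_e\otimes\widetilde{\mathrm{ev}}_b)(\mathrm{id}_{\bar a}\otimes p\otimes\mathrm{id}_{\bar b}):\bar a\otimes c\otimes\bar b\to e$. Then the following hold. 1. $\mathbf{Tube}$ is finite-dimensional, and with these maps it is a weak Hopf algebra: an associative unital algebra and a coassociative counital coalgebra with $\Delta(xy)=\Delta(x)\Delta(y)$; $(\Delta\otimes\mathrm{id})\Delta(1)=(\Delta(1)\otimes1)(1\otimes\Delta(1))=(1\otimes\Delta(1))(\Delta(1)\otimes1)$; $\varepsilon(xyz)=\varepsilon(xy^{(1)})\varepsilon(y^{(2)}z)=\varepsilon(xy^{(2)})\varepsilon(y^{(1)}z)$; $x^{(1)}S(x^{(2)})=\varepsilon(1^{(1)}x)1^{(2)}$; $S(x^{(1)})x^{(2)}=1^{(1)}\varepsilon(x1^{(2)})$; $S(x^{(1)})x^{(2)}S(x^{(3)})=S(x)$. 2. $\xi=\sum_{x,y}\frac{d_y}{d_x}E^x_y$ is grouplike, i.e. it is invertible with inverse $\xi^{-1}=\sum_{x,y}\frac{d_x}{d_y}E^x_y$ and $\Delta(\xi)=(\xi\otimes\xi)\Delta(1)=\Delta(1)(\xi\otimes\xi)$;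 and $S^2(X)=\xi X\xi^{-1}$ for all $X$. On the summand $(a,b,c,e,f,h)$ the map $S^2$ is multiplication by $\frac{d_fd_c}{d_hd_e}$. 3. All $d_x$ are positive, and $\sum_zN_{xy}^zd_z=d_xd_y$ whenever $x\otimes y\neq0$, where $N_{xy}^z=\dim\operatorname{Hom}(z,x\otimes y)$. 4. Let bases of splitting vertices $\alpha\in\operatorname{Hom}(c,a\otimes b)$ and fusion vertices $\bar\alpha\in\operatorname{Hom}(a\otimes b,c)$, indexed by $1,\dots,N_{ab}^c$, be given with $\bar\beta\alpha=\delta_{c,c'}\delta_{\alpha,\beta}Y_c^{ab}\,\mathrm{id}_c$ and $\mathrm{id}_{a\otimes b}=\sum_{c,\alpha}(Y_c^{ab})^{-1}\alpha\bar\alpha$, $Y_c^{ab}=\sqrt{d_ad_b/d_c}$. Let $[a;b]^{f,g,h;\zeta,\gamma}_{c,d,e;\mu,\nu}=[(\nu\otimes\mathrm{id}_b)\mu,\ \bar\gamma(\bar\zeta\otimes\mathrm{id}_b)]$ for vertices $\mu:c\to d\otimes b$, $\nu:d\to a\otimes e$, $\bar\zeta:a\otimes f\to g$, $\bar\gamma:g\otimes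 b\to h$. These diagrams form a basis of $\mathbf{Tube}$, and $$\varepsilon\big([a;b]^{f,g,h;\zeta,\gamma}_{c,d,e;\mu,\nu}\big)=\delta_{e,f}\delta_{c,h}\delta_{d,g}\delta_{\nu,\zeta}\delta_{\mu,\gamma}\sqrt{\tfrac{d_ad_fd_b}{d_h}},$$ $$\Delta\big([a;b]^{f,g,h;\zeta,\gamma}_{c,d,e;\mu,\nu}\big)=\sum_{i,j,k,\rho,\sigma}\sqrt{\tfrac{d_j}{d_ad_i}}\sqrt{\tfrac{d_k}{d_jd_b}}\;[a;b]^{f,g,h;\zeta,\gamma}_{k,j,i;\rho,\sigma}\otimes[a;b]^{i,j,k;\sigma,\rho}_{c,d,e;\mu,\nu}.$$ Let $F^{ijk}_l$, $(F^{ijk}_l)^{-1}$ (on splitting trees) and $F_{ijk}^l$, $(F_{ijk}^l)^{-1}$ (on fusion trees) be the F-symbols of these bases: $F$ holds the coefficients that expand a tree of type $(ij)k$ in trees of type $i(jk)$, and $F^{-1}$ those of the converse expansion, the vertex indices of each tree being listed with the inner vertex first and the outer vertex second. Then the product of basis diagrams vanishes unless $f=h'$, $e=c'$, and in that case $$[a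;b]^{f,g,h;\zeta,\gamma}_{c,d,e;\mu,\nu}\cdot[a';b']^{f',g',h';\zeta',\gamma'}_{c',d',e';\mu',\nu'}=\sum\,[(F^g_{ag'b'})^{-1}]^{i\rho\sigma}_{f\gamma'\zeta}[(F_d^{ad'b'})^{-1}]^{j\omega\tau}_{e\mu'\nu}[(F^i_{aa'f'})^{-1}]^{k\alpha\beta}_{g'\zeta'\rho}[(F_j^{aa'e'})^{-1}]^{k\alpha\beta'}_{d'\nu'\omega}[F^h_{ib'b}]^{s\kappa\lambda}_{g\sigma\gamma}[F_c^{jb'b}]^{s\kappa\lambda'}_{d\tau\mu}\sqrt{\tfrac{d_ad_{a'}}{d_k}}\sqrt{\tfrac{d_bd_{b'}}{d_s}}\;[k;s]^{f',i,h;\beta,\lambda}_{c,j,e';\lambda',\beta'},$$ summed over all upper indices. -/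

import Mathlib

open CategoryTheory MonoidalCategory Limits
open scoped TensorProduct

universe v u

namespace TubeAlg

noncomputable section

/-! ### Weak Hopf algebras over `ℂ` -/

section WeakHopf

variable {W : Type*} [AddCommMonoid W] [Module ℂ W]

/-- `(x ⊗ y) ⊗ (z ⊗ w) ↦ (x ⊗ m y z) ⊗ w`. -/
def middle (m : W →ₗ[ℂ] W →ₗ[ℂ] W) :
    (W ⊗[ℂ] W) ⊗[ℂ] (W ⊗[ℂ] W) →ₗ[ℂ] (W ⊗[ℂ] W) ⊗[ℂ] W :=
  TensorProduct.map
      (TensorProduct.map LinearMap.id (TensorProduct.lift m) ∘ₗ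
        (TensorProduct.assoc ℂ W W W).toLinearMap) LinearMap.id ∘ₗ
    (TensorProduct.assoc ℂ (W ⊗[ℂ] W) W W).symm.toLinearMap

/-- The componentwise multiplication of `W ⊗ W`: `(x ⊗ y)(z ⊗ w) = xz ⊗ yw`. -/
def tensorMul (m : W →ₗ[ℂ] W →ₗ[ℂ] W) :
    W ⊗[ℂ] W →ₗ[ℂ] W ⊗[ℂ] W →ₗ[ℂ] W ⊗[ℂ] W :=
  TensorProduct.map₂ m m

/-- The functional `y ⊗ z ↦ φ y * ψ z`. -/
def tensorEval (φ ψ : W →ₗ[ℂ] ℂ) : W ⊗[ℂ] W →ₗ[ℂ] ℂ :=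
  LinearMap.mul' ℂ ℂ ∘ₗ TensorProduct.map φ ψ

/-- The left counital map `x ↦ ∑ ε(1₍₁₎ x) 1₍₂₎`. -/
def counitalL (m : W →ₗ[ℂ] W →ₗ[ℂ] W) (one : W) (Δ : W →ₗ[ℂ] W ⊗[ℂ] W) (ε : W →ₗ[ℂ] ℂ)
    (x : W) : W :=
  TensorProduct.lid ℂ W (TensorProduct.map (ε ∘ₗ m.flip x) LinearMap.id (Δ one))

/-- The right counital map `x ↦ ∑ 1₍₁₎ ε(x 1₍₂₎)`. -/
def counitalR (m : W →ₗ[ℂ] W →ₗ[ℂ] W) (one : W) (Δ : W →ₗ[ℂ] W ⊗[ℂ] W) (ε : W →ₗ[ℂ] ℂ)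
    (x : W) : W :=
  TensorProduct.rid ℂ W (TensorProduct.map LinearMap.id (ε ∘ₗ m x) (Δ one))

/-- Weak bialgebra axioms for multiplication `m`, unit `one`, comultiplication `Δ`, counit `ε`. -/
structure IsWeakBialgebra (m : W →ₗ[ℂ] W →ₗ[ℂ] W) (one : W)
    (Δ : W →ₗ[ℂ] W ⊗[ℂ] W) (ε : W →ₗ[ℂ] ℂ) : Prop where
  mul_assoc : ∀ x y z, m (m x y) z = m x (m y z)
  one_mul : ∀ x, m one x = x
  mul_one : ∀ x, m x one = x
  coassoc : (TensorProduct.assoc ℂ W W W).toLinearMap ∘ₗ TensorProduct.map Δ LinearMap.id ∘ₗ Δ =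
    TensorProduct.map LinearMap.id Δ ∘ₗ Δ
  counit_comul : ∀ x, TensorProduct.lid ℂ W (TensorProduct.map ε LinearMap.id (Δ x)) = x
  comul_counit : ∀ x, TensorProduct.rid ℂ W (TensorProduct.map LinearMap.id ε (Δ x)) = x
  comul_mul : ∀ x y, Δ (m x y) = tensorMul m (Δ x) (Δ y)
  comul_one : TensorProduct.map Δ LinearMap.id (Δ one) = middle m (Δ one ⊗ₜ[ℂ] Δ one)
  comul_one_op : TensorProduct.map Δ LinearMap.id (Δ one) = middle m.flip (Δ one ⊗ₜ[ℂ] Δ one)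
  counit_mul : ∀ x y z, ε (m (m x y) z) = tensorEval (ε ∘ₗ m x) (ε ∘ₗ m.flip z) (Δ y)
  counit_mul_op : ∀ x y z, ε (m (m x y) z) =
    tensorEval (ε ∘ₗ m x) (ε ∘ₗ m.flip z) (TensorProduct.comm ℂ W W (Δ y))

/-- Weak Hopf algebra axioms: a weak bialgebra with an antipode `S`. -/
structure IsWeakHopfAlgebra (m : W →ₗ[ℂ] W →ₗ[ℂ] W) (one : W)
    (Δ : W →ₗ[ℂ] W ⊗[ℂ] W) (ε : W →ₗ[ℂ] ℂ) (S : W →ₗ[ℂ] W) : Prop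
    extends IsWeakBialgebra m one Δ ε where
  mul_antipode : ∀ x,
    TensorProduct.lift m (TensorProduct.map LinearMap.id S (Δ x)) = counitalL m one Δ ε x
  antipode_mul : ∀ x,
    TensorProduct.lift m (TensorProduct.map S LinearMap.id (Δ x)) = counitalR m one Δ ε x
  antipode_mul_antipode : ∀ x,
    TensorProduct.lift m (TensorProduct.map (TensorProduct.lift m) LinearMap.id
      (TensorProduct.map (TensorProduct.map S LinearMap.id) S
        (TensorProduct.map Δ LinearMap.id (Δ x)))) = S x

/-- `ξ` is grouplike with inverse `ξ'` (in the sense of weak Hopf algebras). -/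
structure IsGrouplike (m : W →ₗ[ℂ] W →ₗ[ℂ] W) (one : W)
    (Δ : W →ₗ[ℂ] W ⊗[ℂ] W) (ξ ξ' : W) : Prop where
  mul_inv : m ξ ξ' = one
  inv_mul : m ξ' ξ = one
  comul_left : Δ ξ = tensorMul m (ξ ⊗ₜ[ℂ] ξ) (Δ one)
  comul_right : Δ ξ = tensorMul m (Δ one) (ξ ⊗ₜ[ℂ] ξ)

end WeakHopf

/-! ### Unitary multifusion categories -/

/-- `End X = ℂ · id_X`. -/
def IsSimpleObj {D : Type u} [Category.{v} D] [Preadditive D] [Linear ℂ D] (X : D) : Prop :=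
  𝟙 X ≠ 0 ∧ ∀ f : X ⟶ X, ∃ z : ℂ, f = z • 𝟙 X

/-- Isomorphism as an equivalence relation on the simple objects. -/
def simpleSetoid (D : Type u) [Category.{v} D] [Preadditive D] [Linear ℂ D] :
    Setoid {X : D // IsSimpleObj X} :=
  (isIsomorphicSetoid D).comap Subtype.val

/-- The set of isomorphism classes of simple objects. -/
def Irr (D : Type u) [Category.{v} D] [Preadditive D] [Linear ℂ D] : Type u :=
  Quotient (simpleSetoid D)

/-- A unitary multifusion category: a finite semisimple `ℂ`-linear rigid monoidal category with a
compatible dagger such that `f† ∘ f = 0` implies `f = 0`. Rigidity is the separate class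
`RigidCategory D`. -/
class UMFC (D : Type u) [Category.{v} D] [Preadditive D] [Linear ℂ D] [HasFiniteBiproducts D]
    [MonoidalCategory D] [MonoidalPreadditive D] [MonoidalLinear ℂ D] [RigidCategory D] where
  finiteDimensional_hom : ∀ X Y : D, FiniteDimensional ℂ (X ⟶ Y)
  finite_irr : Finite (Irr D)
  semisimple : ∀ X : D, ∃ (n : ℕ) (S : Fin n → D),
    (∀ r, IsSimpleObj (S r)) ∧ Nonempty (X ≅ biproduct S)
  dag : ∀ {X Y : D}, (X ⟶ Y) → (Y ⟶ X)
  dag_dag : ∀ {X Y : D} (f : X ⟶ Y), dag (dag f) = f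
  dag_add : ∀ {X Y : D} (f g : X ⟶ Y), dag (f + g) = dag f + dag g
  dag_smul : ∀ {X Y : D} (z : ℂ) (f : X ⟶ Y), dag (z • f) = (starRingEnd ℂ) z • dag f
  dag_id : ∀ X : D, dag (𝟙 X) = 𝟙 X
  dag_comp : ∀ {X Y Z : D} (f : X ⟶ Y) (g : Y ⟶ Z), dag (f ≫ g) = dag g ≫ dag f
  eq_zero_of_comp_dag : ∀ {X Y : D} (f : X ⟶ Y), f ≫ dag f = 0 → f = 0
  dag_tensor : ∀ {X Y Z T : D} (f : X ⟶ Y) (g : Z ⟶ T), dag (f ⊗ₘ g) = dag f ⊗ₘ dag g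
  dag_associator : ∀ X Y Z : D, dag (α_ X Y Z).hom = (α_ X Y Z).inv
  dag_leftUnitor : ∀ X : D, dag (λ_ X).hom = (λ_ X).inv
  dag_rightUnitor : ∀ X : D, dag (ρ_ X).hom = (ρ_ X).inv

section Category

variable {D : Type u} [Category.{v} D] [Preadditive D] [Linear ℂ D]

/-- The chosen simple object representing a label. -/
def obj (x : Irr D) : D := (Quotient.out x).val

theorem obj_simple (x : Irr D) : IsSimpleObj (obj x) := (Quotient.out x).property

open Classical in
/-- The Kronecker delta as a morphism: the identity if the labels agree, otherwise `0`. -/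
def delta (x y : Irr D) : obj x ⟶ obj y :=
  if h : x = y then eqToHom (congrArg obj h) else 0

/-- The number `z` with `f = z • id`, for an endomorphism `f` of a simple object. -/
def scal (x : Irr D) : (obj x ⟶ obj x) →ₗ[ℂ] ℂ where
  toFun f := Classical.choose ((obj_simple x).2 f)
  map_add' f g := by
    have hf := Classical.choose_spec ((obj_simple x).2 f)
    have hg := Classical.choose_spec ((obj_simple x).2 g)
    have hfg := Classical.choose_spec ((obj_simple x).2 (f + g))
    refine smul_left_injective ℂ (obj_simple x).1 ?_
    simp only [add_smul]
    rw [← hf, ← hg, ← hfg]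
  map_smul' z f := by
    have hf := Classical.choose_spec ((obj_simple x).2 f)
    have hzf := Classical.choose_spec ((obj_simple x).2 (z • f))
    refine smul_left_injective ℂ (obj_simple x).1 ?_
    simp only [smul_eq_mul, RingHom.id_apply, mul_smul]
    rw [← hf, ← hzf]

theorem scal_spec (x : Irr D) (f : obj x ⟶ obj x) : f = scal x f • 𝟙 (obj x) :=
  Classical.choose_spec ((obj_simple x).2 f)

/-- A direct sum decomposition of `X` into the chosen simple objects. -/
structure Decomp (X : D) where
  n : ℕ
  label : Fin n → Irr D
  inj : ∀ r, obj (label r) ⟶ X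
  proj : ∀ r, X ⟶ obj (label r)
  inj_proj_self : ∀ r, inj r ≫ proj r = 𝟙 _
  inj_proj_ne : ∀ r s, r ≠ s → inj r ≫ proj s = 0
  total : ∑ r, proj r ≫ inj r = 𝟙 X

theorem nonempty_decomp [HasFiniteBiproducts D] {X : D} {n : ℕ} {S : Fin n → D}
    (hS : ∀ r, IsSimpleObj (S r)) (e : X ≅ biproduct S) : Nonempty (Decomp X) := by
  have key : ∀ r, Nonempty (obj (Quotient.mk (simpleSetoid D) ⟨S r, hS r⟩) ≅ S r) := fun r =>
    Quotient.mk_out (s := simpleSetoid D) ⟨S r, hS r⟩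
  let i := fun r => (key r).some
  refine ⟨⟨n, fun r => Quotient.mk (simpleSetoid D) ⟨S r, hS r⟩,
    fun r => (i r).hom ≫ biproduct.ι S r ≫ e.inv,
    fun r => e.hom ≫ biproduct.π S r ≫ (i r).inv, ?_, ?_, ?_⟩⟩
  · intro r
    simp
  · intro r s h
    simp [biproduct.ι_π_ne_assoc S h]
  · have h : ∀ r, (e.hom ≫ biproduct.π S r ≫ (i r).inv) ≫ (i r).hom ≫ biproduct.ι S r ≫ e.inv =
        e.hom ≫ (biproduct.π S r ≫ biproduct.ι S r) ≫ e.inv := by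
      intro r
      simp
    simp only [h]
    rw [← Preadditive.comp_sum, ← Preadditive.sum_comp, biproduct.total]
    simp

variable [HasFiniteBiproducts D] [MonoidalCategory D] [MonoidalPreadditive D]
  [MonoidalLinear ℂ D] [RigidCategory D] [UMFC D]

instance : Fintype (Irr D) :=
  haveI : Finite (Irr D) := UMFC.finite_irr
  Fintype.ofFinite _

/-- A fixed decomposition of every object. -/
def decomp (X : D) : Decomp X :=
  Classical.choice <| by
    obtain ⟨n, S, hS, ⟨e⟩⟩ := UMFC.semisimple X
    exact nonempty_decomp hS e

/-! ### Arcs and quantum dimensions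

`ev X : Xᘁ ⊗ X ⟶ 𝟙` and `coev X : 𝟙 ⟶ X ⊗ Xᘁ` are the duality maps. Their daggers, rescaled so
that every closed loop labelled by a simple object takes the same value on both sides, are the
duality maps on the other side. -/

/-- The coevaluation `𝟙 ⟶ X ⊗ Xᘁ`. -/
def coev (X : D) : 𝟙_ D ⟶ X ⊗ Xᘁ := η_ X Xᘁ

/-- The evaluation `Xᘁ ⊗ X ⟶ 𝟙`. -/
def ev (X : D) : Xᘁ ⊗ X ⟶ 𝟙_ D := ε_ X Xᘁ

/-- The value of the loop `ev ∘ ev†`, read off from its action on `x` from the right. -/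
def loopL (x : Irr D) : ℂ :=
  scal x ((ρ_ (obj x)).inv ≫ (obj x ◁ (UMFC.dag (ev (obj x)) ≫ ev (obj x))) ≫ (ρ_ (obj x)).hom)

/-- The value of the loop `coev† ∘ coev`, read off from its action on `x` from the left. -/
def loopR (x : Irr D) : ℂ :=
  scal x ((λ_ (obj x)).inv ≫ ((coev (obj x) ≫ UMFC.dag (coev (obj x))) ▷ obj x) ≫ (λ_ (obj x)).hom)

/-- The quantum dimension: the common value of the two loops after the rescaling of the duality
maps that makes them equal. -/
def qdim (x : Irr D) : ℝ := Real.sqrt (loopL x * loopR x).re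

/-- The cup `𝟙 ⟶ xᘁ ⊗ x`: the multiple of `ev†` for which `ev ∘ cup` is the loop of value `d_x`. -/
def cup (x : Irr D) : 𝟙_ D ⟶ (obj x)ᘁ ⊗ obj x :=
  ((qdim x : ℂ) / loopL x) • UMFC.dag (ev (obj x))

/-- The cap `x ⊗ xᘁ ⟶ 𝟙`: the multiple of `coev†` for which `cap ∘ coev` is the loop of value
`d_x`. -/
def cap (x : Irr D) : obj x ⊗ (obj x)ᘁ ⟶ 𝟙_ D :=
  ((qdim x : ℂ) / loopR x) • UMFC.dag (coev (obj x))

/-! ### The tube algebra -/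

/-- The outer labels of a double-arc diagram: left arc `a`, right arc `b`, lower leg running from
`c` (outside) to `e` (inside), upper leg running from `f` (inside) to `h` (outside). -/
structure TubeLabel (D : Type u) [Category.{v} D] [Preadditive D] [Linear ℂ D] where
  (a b c e f h : Irr D)

/-- Lower half of a diagram with arcs `A`, `B`. -/
abbrev Lower (A B : D) (c e : Irr D) := obj c ⟶ (A ⊗ obj e) ⊗ B

/-- Upper half of a diagram with arcs `A`, `B`. -/
abbrev Upper (A B : D) (f h : Irr D) := (A ⊗ obj f) ⊗ B ⟶ obj h

/-- Diagrams with fixed outer labels. -/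
abbrev TubeComp (L : TubeLabel D) : Type v :=
  Lower (obj L.a) (obj L.b) L.c L.e ⊗[ℂ] Upper (obj L.a) (obj L.b) L.f L.h

/-- The bulk tube algebra as a vector space. -/
abbrev Tube (D : Type u) [Category.{v} D] [Preadditive D] [Linear ℂ D] [HasFiniteBiproducts D]
    [MonoidalCategory D] [MonoidalPreadditive D] [MonoidalLinear ℂ D] [RigidCategory D] [UMFC D] :
    Type (max u v) :=
  DirectSum (TubeLabel D) fun L => TubeComp L

open Classical in
/-- The inclusion of the diagrams with fixed outer labels. -/
def inc (L : TubeLabel D) : TubeComp L →ₗ[ℂ] Tube D :=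
  DirectSum.lof ℂ (TubeLabel D) (fun L => TubeComp L) L

/-- The diagram with simple arcs `a`, `b`, lower half `p` and upper half `q`. -/
def dbl (a b c e f h : Irr D) (p : Lower (obj a) (obj b) c e) (q : Upper (obj a) (obj b) f h) :
    Tube D :=
  inc ⟨a, b, c, e, f, h⟩ (p ⊗ₜ[ℂ] q)

open Classical in
/-- Extension of a family of linear maps to the tube algebra. -/
def extend {N : Type*} [AddCommMonoid N] [Module ℂ N] (φ : ∀ L : TubeLabel D, TubeComp L →ₗ[ℂ] N) :
    Tube D →ₗ[ℂ] N :=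
  DirectSum.toModule ℂ (TubeLabel D) N φ

@[simp]
theorem extend_inc {N : Type*} [AddCommMonoid N] [Module ℂ N]
    (φ : ∀ L : TubeLabel D, TubeComp L →ₗ[ℂ] N) (L : TubeLabel D) (t : TubeComp L) :
    extend φ (inc L t) = φ L t := by
  classical
  simp only [extend, inc]
  convert DirectSum.toModule_lof ℂ L t

/-- A diagram whose arcs are arbitrary objects `A`, `B`, rewritten through diagrams with simple
arcs by inserting the decompositions of `id_A` and `id_B` into the arcs and sliding their halves
into the lower and the upper part. -/
def resolve (A B : D) (c e f h : Irr D) : Lower A B c e →ₗ[ℂ] Upper A B f h →ₗ[ℂ] Tube D :=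
  LinearMap.mk₂ ℂ
    (fun p q => ∑ r, ∑ s,
      dbl ((decomp A).label r) ((decomp B).label s) c e f h
        (p ≫ (((decomp A).proj r ▷ obj e) ⊗ₘ (decomp B).proj s))
        ((((decomp A).inj r ▷ obj f) ⊗ₘ (decomp B).inj s) ≫ q))
    (fun p p' q => by
      simp only [dbl, Preadditive.add_comp, TensorProduct.add_tmul, map_add,
        Finset.sum_add_distrib])
    (fun z p q => by
      simp only [dbl, Linear.smul_comp, ← TensorProduct.smul_tmul', map_smul, Finset.smul_sum])
    (fun p q q' => by
      simp only [dbl, Preadditive.comp_add, TensorProduct.tmul_add, map_add,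
        Finset.sum_add_distrib])
    (fun z p q => by
      simp only [dbl, Linear.comp_smul, TensorProduct.tmul_smul, map_smul, Finset.smul_sum])

/-- The rebracketing of two nested pairs of arcs. -/
def nest (A A' E B' B : D) :
    (A ⊗ ((A' ⊗ E) ⊗ B')) ⊗ B ≅ ((A ⊗ A') ⊗ E) ⊗ (B' ⊗ B) :=
  whiskerRightIso ((α_ A (A' ⊗ E) B').symm ≪≫ whiskerRightIso (α_ A A' E).symm B') B ≪≫
    α_ ((A ⊗ A') ⊗ E) B' B

/-- Stacking of lower halves: the outer half `p`, followed inside by `p'`. -/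
def stackLower (A B A' B' : D) (c e c' e' : Irr D) :
    Lower A B c e →ₗ[ℂ] Lower A' B' c' e' →ₗ[ℂ] Lower (A ⊗ A') (B' ⊗ B) c e' :=
  LinearMap.mk₂ ℂ
    (fun p p' => p ≫ ((A ◁ (delta e c' ≫ p')) ▷ B) ≫ (nest A A' (obj e') B' B).hom)
    (by intros; simp) (by intros; simp) (by intros; simp) (by intros; simp)

/-- Stacking of upper halves: the inner half `q'`, followed outside by `q`. -/
def stackUpper (A B A' B' : D) (f h f' h' : Irr D) :
    Upper A B f h →ₗ[ℂ] Upper A' B' f' h' →ₗ[ℂ] Upper (A ⊗ A') (B' ⊗ B) f' h :=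
  LinearMap.mk₂ ℂ
    (fun q q' => (nest A A' (obj f') B' B).inv ≫ ((A ◁ (q' ≫ delta h' f)) ▷ B) ≫ q)
    (by intros; simp) (by intros; simp) (by intros; simp) (by intros; simp)

/-- Multiplication on components: put the second diagram inside the first one (zero unless the
legs match), then rewrite the pairs of parallel arcs through simple arcs. -/
def mulComp (L L' : TubeLabel D) : TubeComp L →ₗ[ℂ] TubeComp L' →ₗ[ℂ] Tube D :=
  (TensorProduct.map₂
      (stackLower (obj L.a) (obj L.b) (obj L'.a) (obj L'.b) L.c L.e L'.c L'.e)
      (stackUpper (obj L.a) (obj L.b) (obj L'.a) (obj L'.b) L.f L.h L'.f L'.h)).compr₂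
    (TensorProduct.lift
      (resolve (obj L.a ⊗ obj L'.a) (obj L'.b ⊗ obj L.b) L.c L'.e L'.f L.h))

/-- The multiplication of the tube algebra. -/
def mul : Tube D →ₗ[ℂ] Tube D →ₗ[ℂ] Tube D :=
  extend fun L => (extend fun L' => (mulComp L L').flip).flip

theorem mul_dbl (a b c e f h a' b' c' e' f' h' : Irr D)
    (p : Lower (obj a) (obj b) c e) (q : Upper (obj a) (obj b) f h)
    (p' : Lower (obj a') (obj b') c' e') (q' : Upper (obj a') (obj b') f' h') :
    mul (dbl a b c e f h p q) (dbl a' b' c' e' f' h' p' q') =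
      resolve (obj a ⊗ obj a') (obj b' ⊗ obj b) c e' f' h
        (p ≫ ((obj a ◁ (delta e c' ≫ p')) ▷ obj b) ≫
          (nest (obj a) (obj a') (obj e') (obj b') (obj b)).hom)
        ((nest (obj a) (obj a') (obj f') (obj b') (obj b)).inv ≫
          ((obj a ◁ (q' ≫ delta h' f)) ▷ obj b) ≫ q) := by
  simp only [mul, dbl, extend_inc, LinearMap.flip_apply]
  rfl

/-- The diagram consisting of two vertical lines, `x` on top and `y` at the bottom, with trivial
arcs (zero unless `x` and `y` lie in the same component of the category). -/
def lines (x y : Irr D) : Tube D :=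
  resolve (𝟙_ D) (𝟙_ D) y y x x
    ((λ_ (obj y)).inv ≫ (ρ_ (𝟙_ D ⊗ obj y)).inv)
    ((ρ_ (𝟙_ D ⊗ obj x)).hom ≫ (λ_ (obj x)).hom)

/-- The unit of the tube algebra. -/
def one : Tube D := ∑ x, ∑ y, lines x y

/-- The counit on components: join `e` with `f` (zero unless `e = f` and `c = h`) and evaluate the
resulting multiple of `id_c`, which is the closed diagram divided by `d_h`. -/
def counitComp (L : TubeLabel D) : TubeComp L →ₗ[ℂ] ℂ :=
  TensorProduct.lift <| LinearMap.mk₂ ℂ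
    (fun p q => scal L.c
      (p ≫ ((obj L.a ◁ delta L.e L.f) ▷ obj L.b) ≫ q ≫ delta L.h L.c))
    (by intros; simp) (by intros; simp) (by intros; simp) (by intros; simp)

/-- The counit of the tube algebra. -/
def counit : Tube D →ₗ[ℂ] ℂ := extend counitComp

/-- The comultiplication on components: insert a wall `i` between `e` and `f`, and decompose the
identity of `(a ⊗ i) ⊗ b`. -/
def comulComp (L : TubeLabel D) : TubeComp L →ₗ[ℂ] Tube D ⊗[ℂ] Tube D :=
  TensorProduct.lift <| LinearMap.mk₂ ℂ
    (fun p q => ∑ i : Irr D, ∑ r,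
      dbl L.a L.b ((decomp ((obj L.a ⊗ obj i) ⊗ obj L.b)).label r) i L.f L.h
          ((decomp ((obj L.a ⊗ obj i) ⊗ obj L.b)).inj r) q ⊗ₜ[ℂ]
        dbl L.a L.b L.c L.e i ((decomp ((obj L.a ⊗ obj i) ⊗ obj L.b)).label r)
          p ((decomp ((obj L.a ⊗ obj i) ⊗ obj L.b)).proj r))
    (fun p p' q => by
      simp only [dbl, TensorProduct.add_tmul, TensorProduct.tmul_add, map_add,
        Finset.sum_add_distrib])
    (fun z p q => by
      simp only [dbl, ← TensorProduct.smul_tmul', map_smul, TensorProduct.tmul_smul,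
        Finset.smul_sum])
    (fun p q q' => by
      simp only [dbl, TensorProduct.add_tmul, TensorProduct.tmul_add, map_add,
        Finset.sum_add_distrib])
    (fun z p q => by
      simp only [dbl, ← TensorProduct.smul_tmul', map_smul, TensorProduct.tmul_smul,
        Finset.smul_sum])

/-- The comultiplication of the tube algebra. -/
def comul : Tube D →ₗ[ℂ] Tube D ⊗[ℂ] Tube D := extend comulComp

/-- The upper half `q : (a ⊗ f) ⊗ b ⟶ h` bent into a lower half `f ⟶ (aᘁ ⊗ h) ⊗ bᘁ`. -/
def bendUpper (a b f h : Irr D) :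
    Upper (obj a) (obj b) f h →ₗ[ℂ] Lower (obj a)ᘁ (obj b)ᘁ f h where
  toFun q := (λ_ (obj f)).inv ≫ (ρ_ (𝟙_ D ⊗ obj f)).inv ≫
    ((cup a ▷ obj f) ⊗ₘ coev (obj b)) ≫
    (nest (obj a)ᘁ (obj a) (obj f) (obj b) (obj b)ᘁ).inv ≫ (((obj a)ᘁ ◁ q) ▷ (obj b)ᘁ)
  map_add' := by intros; simp
  map_smul' := by intros; simp

/-- The lower half `p : c ⟶ (a ⊗ e) ⊗ b` bent into an upper half `(aᘁ ⊗ c) ⊗ bᘁ ⟶ e`. -/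
def bendLower (a b c e : Irr D) :
    Lower (obj a) (obj b) c e →ₗ[ℂ] Upper (obj a)ᘁ (obj b)ᘁ c e where
  toFun p := (((obj a)ᘁ ◁ p) ▷ (obj b)ᘁ) ≫
    (nest (obj a)ᘁ (obj a) (obj e) (obj b) (obj b)ᘁ).hom ≫
    ((ev (obj a) ▷ obj e) ⊗ₘ cap b) ≫ (ρ_ (𝟙_ D ⊗ obj e)).hom ≫ (λ_ (obj e)).hom
  map_add' := by intros; simp
  map_smul' := by intros; simp

/-- The antipode on components: the reflected diagram with arcs `ā`, `b̄`, times `d_f / d_h`. -/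
def antipodeComp (L : TubeLabel D) : TubeComp L →ₗ[ℂ] Tube D :=
  ((qdim L.f : ℂ) / (qdim L.h : ℂ)) •
    TensorProduct.lift (((resolve (obj L.a)ᘁ (obj L.b)ᘁ L.f L.h L.c L.e).flip.compl₁₂
      (bendLower L.a L.b L.c L.e) (bendUpper L.a L.b L.f L.h)))

/-- The antipode of the tube algebra. -/
def antipode : Tube D →ₗ[ℂ] Tube D := extend antipodeComp

theorem antipode_dbl (a b c e f h : Irr D)
    (p : Lower (obj a) (obj b) c e) (q : Upper (obj a) (obj b) f h) :
    antipode (dbl a b c e f h p q) =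
      ((qdim f : ℂ) / (qdim h : ℂ)) •
        resolve (obj a)ᘁ (obj b)ᘁ f h c e (bendUpper a b f h q) (bendLower a b c e p) := by
  simp only [antipode, dbl, extend_inc]
  rfl

/-- `ξ = ∑ (d_y / d_x) · (x over y)`. -/
def xi : Tube D := ∑ x, ∑ y, ((qdim y : ℂ) / (qdim x : ℂ)) • lines x y

/-- `ξ⁻¹ = ∑ (d_x / d_y) · (x over y)`. -/
def xiInv : Tube D := ∑ x, ∑ y, ((qdim x : ℂ) / (qdim y : ℂ)) • lines x y

/-! ### Bases of vertices, F-symbols, basis diagrams -/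

/-- The fusion multiplicity `N_{ab}^c`. -/
def mult (a b c : Irr D) : ℕ := Module.finrank ℂ (obj c ⟶ obj a ⊗ obj b)

/-- The normalization `Y_c^{ab} = √(d_a d_b / d_c)`. -/
def vnorm (a b c : Irr D) : ℂ := (Real.sqrt (qdim a * qdim b / qdim c) : ℝ)

/-- Bases of splitting and fusion vertices obeying the loop move and the parallel move. -/
structure VertexBasis (D : Type u) [Category.{v} D] [Preadditive D] [Linear ℂ D]
    [HasFiniteBiproducts D] [MonoidalCategory D] [MonoidalPreadditive D] [MonoidalLinear ℂ D]
    [RigidCategory D] [UMFC D] where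
  split : ∀ {a b c : Irr D}, Fin (mult a b c) → (obj c ⟶ obj a ⊗ obj b)
  fuse : ∀ {a b c : Irr D}, Fin (mult a b c) → (obj a ⊗ obj b ⟶ obj c)
  loop : ∀ {a b c c' : Irr D} (μ : Fin (mult a b c)) (ν : Fin (mult a b c')),
    split μ ≫ fuse ν = if μ.val = ν.val then vnorm a b c • delta c c' else 0
  parallel : ∀ a b : Irr D,
    ∑ c, ∑ μ : Fin (mult a b c), (vnorm a b c)⁻¹ • (fuse μ ≫ split μ) = 𝟙 (obj a ⊗ obj b)

/-- The type of F-symbols, with arguments the inner and outer vertex of the left-bracketed tree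
(`i j → m`, `m k → l`) and the inner and outer vertex of the right-bracketed tree
(`j k → n`, `i n → l`). -/
abbrev FArray (D : Type u) [Category.{v} D] [Preadditive D] [Linear ℂ D]
    [HasFiniteBiproducts D] [MonoidalCategory D] [MonoidalPreadditive D] [MonoidalLinear ℂ D]
    [RigidCategory D] [UMFC D] :=
  ∀ (i j k l m n : Irr D), Fin (mult i j m) → Fin (mult m k l) →
    Fin (mult j k n) → Fin (mult i n l) → ℂ

/-- The four arrays of F-symbols of a basis of vertices: the coefficients of the F-moves on
splitting trees (`split`, `splitInv`) and on fusion trees (`fuse`, `fuseInv`). -/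
structure FSymbols (V : VertexBasis D) where
  split : FArray D
  splitInv : FArray D
  fuse : FArray D
  fuseInv : FArray D
  split_move : ∀ (i j k l m : Irr D) (β : Fin (mult i j m)) (α : Fin (mult m k l)),
    V.split α ≫ (V.split β ▷ obj k) ≫ (α_ (obj i) (obj j) (obj k)).hom =
      ∑ n, ∑ ν : Fin (mult j k n), ∑ μ : Fin (mult i n l),
        split i j k l m n β α ν μ • (V.split μ ≫ (obj i ◁ V.split ν))
  splitInv_move : ∀ (i j k l n : Irr D) (ν : Fin (mult j k n)) (μ : Fin (mult i n l)),
    V.split μ ≫ (obj i ◁ V.split ν) ≫ (α_ (obj i) (obj j) (obj k)).inv =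
      ∑ m, ∑ β : Fin (mult i j m), ∑ α : Fin (mult m k l),
        splitInv i j k l m n β α ν μ • (V.split α ≫ (V.split β ▷ obj k))
  fuse_move : ∀ (i j k l m : Irr D) (β : Fin (mult i j m)) (α : Fin (mult m k l)),
    (α_ (obj i) (obj j) (obj k)).inv ≫ (V.fuse β ▷ obj k) ≫ V.fuse α =
      ∑ n, ∑ ν : Fin (mult j k n), ∑ μ : Fin (mult i n l),
        fuse i j k l m n β α ν μ • ((obj i ◁ V.fuse ν) ≫ V.fuse μ)
  fuseInv_move : ∀ (i j k l n : Irr D) (ν : Fin (mult j k n)) (μ : Fin (mult i n l)),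
    (α_ (obj i) (obj j) (obj k)).hom ≫ (obj i ◁ V.fuse ν) ≫ V.fuse μ =
      ∑ m, ∑ β : Fin (mult i j m), ∑ α : Fin (mult m k l),
        fuseInv i j k l m n β α ν μ • ((V.fuse β ▷ obj k) ≫ V.fuse α)

/-- The basis diagram `[a;b]^{f,g,h;ζ,γ}_{c,d,e;μ,ν}`: below, `c` splits into `d`, `b` and `d` into
`a`, `e`; above, `a`, `f` fuse to `g` and `g`, `b` to `h`. -/
def diagram (V : VertexBasis D) {a b c d e f g h : Irr D} (μ : Fin (mult d b c))
    (ν : Fin (mult a e d)) (ζ : Fin (mult a f g)) (γ : Fin (mult g b h)) : Tube D :=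
  dbl a b c e f h (V.split μ ≫ (V.split ν ▷ obj b)) ((V.fuse ζ ▷ obj b) ≫ V.fuse γ)

/-- The indices of the basis diagrams. -/
structure DiagramIndex (D : Type u) [Category.{v} D] [Preadditive D] [Linear ℂ D]
    [HasFiniteBiproducts D] [MonoidalCategory D] [MonoidalPreadditive D] [MonoidalLinear ℂ D]
    [RigidCategory D] [UMFC D] where
  (a b c d e f g h : Irr D)
  μ : Fin (mult d b c)
  ν : Fin (mult a e d)
  ζ : Fin (mult a f g)
  γ : Fin (mult g b h)

end Category

end

end TubeAlg

open TubeAlg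

/-! The guiding principle is to work with diagrams `[p,q]` whose arcs are arbitrary objects. The map
`resolve` sends such a diagram to the tube algebra, and a morphism between arcs may be moved from
the lower half to the upper half (`resolve_slide`). By this coend relation multiplication, counit
and comultiplication have closed formulas on all resolved diagrams (`mul_resolve`, `counit_resolve`,
`comul_resolve`). Associativity and the unit laws then reduce to coherence for nested pairs of arcs.

The comultiplication inserts the canonical element of `⊕ Hom(k, X) ⊗ Hom(X, k)` with `X = a ⊗ i ⊗
b`. By Schur's lemma this element is dinatural in `X` (`casimir_natural`), hence independent of the
decomposition. This gives multiplicativity of the comultiplication, the counit laws and both weak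
multiplicativity laws of the counit.

The antipode requires that a diagram can be closed on the left or on the right with the same result.
The scaling by `d_x` makes the daggers of `ev` and `coev` satisfy the zigzag identities, so every
splitting vertex has two mates: `mateR` from `ev`, `coev`, and `mateL` from `cup`, `cap`. Evaluating
a closed diagram in `End(𝟙)` in two ways gives `mate_exchange`, which shows that `mateR⁻¹ ∘ mateL`
is an involution. An eigenvector for `-1` would equate two nonzero real numbers of opposite sign, so
the involution is the identity (`mateL_eq_mateR`). The axiom on the dagger only makes the forms `f ↦
f† ∘ f` anisotropic; over `ℂ` they are therefore definite, possibly negative, and all sign arguments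
compare two vectors of one Hom space. As the unit need not be simple, an endomorphism of `𝟙` is read
off from the scalars by which it acts on simple objects.

Equality of the mates yields the partial trace formulas `qdim_mul_scal_ptrL` and
`qdim_mul_scal_ptrR`, the fusion rule, and `qdim_mul_scal_bend`: bending rescales the pairing of
lower with upper halves by a ratio of dimensions. That ratio is the factor in the antipode, whence
its axioms. For the square of the antipode, the double dual of `x` is identified with `x` compatibly
with all four duality maps, so that only the scalars remain.

For chosen vertices, splitting and fusion trees are dual bases up to normalization. The product
formula applies F-moves to the stacked trees and then closes the bubbles on the arcs. -/

namespace TubeAlg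

open scoped ComplexConjugate

noncomputable section

/-! ### Double arcs as an action -/

section Arcs

variable {D : Type u} [Category.{v} D] [MonoidalCategory D]

/-- Two arcs around a morphism. -/
def wrap (A B : D) {X Y : D} (f : X ⟶ Y) : (A ⊗ X) ⊗ B ⟶ (A ⊗ Y) ⊗ B := (A ◁ f) ▷ B

/-- Morphisms acting on the two arcs around an object. -/
def arc {A A' B B' : D} (s : A ⟶ A') (t : B ⟶ B') (X : D) : (A ⊗ X) ⊗ B ⟶ (A' ⊗ X) ⊗ B' :=
  (s ▷ X) ⊗ₘ t

/-- Removal of trivial arcs. -/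
def trivialArcs (X : D) : (𝟙_ D ⊗ X) ⊗ 𝟙_ D ≅ X := ρ_ (𝟙_ D ⊗ X) ≪≫ λ_ X

theorem nest_hom (A A' E B' B : D) : (nest A A' E B' B).hom =
    ((α_ A (A' ⊗ E) B').inv ≫ (α_ A A' E).inv ▷ B') ▷ B ≫ (α_ ((A ⊗ A') ⊗ E) B' B).hom :=
  rfl

theorem nest_inv (A A' E B' B : D) : (nest A A' E B' B).inv =
    (α_ ((A ⊗ A') ⊗ E) B' B).inv ≫ ((α_ A A' E).hom ▷ B' ≫ (α_ A (A' ⊗ E) B').hom) ▷ B :=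
  rfl

@[simp]
theorem wrap_id (A B X : D) : wrap A B (𝟙 X) = 𝟙 _ := by simp [wrap]

theorem wrap_comp (A B : D) {X Y Z : D} (f : X ⟶ Y) (g : Y ⟶ Z) :
    wrap A B (f ≫ g) = wrap A B f ≫ wrap A B g := by simp [wrap]

@[simp]
theorem arc_id (A B X : D) : arc (𝟙 A) (𝟙 B) X = 𝟙 _ := by simp [arc]

theorem arc_comp {A A' A'' B B' B'' : D} (s : A ⟶ A') (s' : A' ⟶ A'') (t : B ⟶ B') (t' : B' ⟶ B'')
    (X : D) : arc (s ≫ s') (t ≫ t') X = arc s t X ≫ arc s' t' X := by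
  simp [arc]

theorem arc_comp_assoc {A A' A'' B B' B'' : D} (s : A ⟶ A') (s' : A' ⟶ A'') (t : B ⟶ B')
    (t' : B' ⟶ B'') (X : D) {Z : D} (f : (A'' ⊗ X) ⊗ B'' ⟶ Z) :
    arc (s ≫ s') (t ≫ t') X ≫ f = arc s t X ≫ arc s' t' X ≫ f := by
  rw [arc_comp, Category.assoc]

/-- This is the interchange law: arcs and legs are separate tensor factors. -/
theorem arc_wrap {A A' B B' X Y : D} (s : A ⟶ A') (t : B ⟶ B') (f : X ⟶ Y) :
    arc s t X ≫ wrap A' B' f = wrap A B f ≫ arc s t Y := by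
  simp only [arc, wrap, ← tensorHom_id, ← id_tensorHom, tensorHom_comp_tensorHom,
    Category.comp_id, Category.id_comp]

theorem arc_wrap_assoc {A A' B B' X Y : D} (s : A ⟶ A') (t : B ⟶ B') (f : X ⟶ Y) {Z : D}
    (g : (A' ⊗ Y) ⊗ B' ⟶ Z) : arc s t X ≫ wrap A' B' f ≫ g = wrap A B f ≫ arc s t Y ≫ g := by
  rw [← Category.assoc, arc_wrap, Category.assoc]

theorem trivialArcs_natural {X Y : D} (f : X ⟶ Y) :
    wrap (𝟙_ D) (𝟙_ D) f ≫ (trivialArcs Y).hom = (trivialArcs X).hom ≫ f := by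
  simp [trivialArcs, wrap]

theorem trivialArcs_inv_natural {X Y : D} (f : X ⟶ Y) :
    (trivialArcs X).inv ≫ wrap (𝟙_ D) (𝟙_ D) f = f ≫ (trivialArcs Y).inv := by
  simp [trivialArcs, wrap]

theorem wrap_wrap_nest (A A' B' B : D) {X Y : D} (f : X ⟶ Y) :
    wrap A B (wrap A' B' f) ≫ (nest A A' Y B' B).hom =
      (nest A A' X B' B).hom ≫ wrap (A ⊗ A') (B' ⊗ B) f := by
  simp only [wrap, nest_hom]
  monoidal

theorem nest_inv_wrap_wrap (A A' B' B : D) {X Y : D} (f : X ⟶ Y) :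
    (nest A A' X B' B).inv ≫ wrap A B (wrap A' B' f) =
      wrap (A ⊗ A') (B' ⊗ B) f ≫ (nest A A' Y B' B).inv := by
  rw [Iso.inv_comp_eq, ← Category.assoc, Iso.eq_comp_inv, wrap_wrap_nest]

theorem wrap_arc_nest (A B : D) {A₁ A₂ B₁ B₂ : D} (s : A₁ ⟶ A₂) (t : B₁ ⟶ B₂) (X : D) :
    wrap A B (arc s t X) ≫ (nest A A₂ X B₂ B).hom =
      (nest A A₁ X B₁ B).hom ≫ arc (A ◁ s) (t ▷ B) X := by
  simp only [wrap, arc, nest_hom]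
  monoidal

theorem nest_inv_wrap_arc (A B : D) {A₁ A₂ B₁ B₂ : D} (s : A₁ ⟶ A₂) (t : B₁ ⟶ B₂) (X : D) :
    (nest A A₁ X B₁ B).inv ≫ wrap A B (arc s t X) =
      arc (A ◁ s) (t ▷ B) X ≫ (nest A A₂ X B₂ B).inv := by
  rw [Iso.inv_comp_eq, ← Category.assoc, Iso.eq_comp_inv, wrap_arc_nest]

theorem arc_nest {A A₁ B B₁ : D} (s : A ⟶ A₁) (t : B ⟶ B₁) (A' B' X : D) :
    arc s t ((A' ⊗ X) ⊗ B') ≫ (nest A₁ A' X B' B₁).hom =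
      (nest A A' X B' B).hom ≫ arc (s ▷ A') (B' ◁ t) X := by
  simp only [arc, nest_hom]
  rw [MonoidalCategory.tensorHom_def', MonoidalCategory.tensorHom_def']
  monoidal

theorem nest_inv_arc {A A₁ B B₁ : D} (s : A ⟶ A₁) (t : B ⟶ B₁) (A' B' X : D) :
    (nest A A' X B' B).inv ≫ arc s t ((A' ⊗ X) ⊗ B') =
      arc (s ▷ A') (B' ◁ t) X ≫ (nest A₁ A' X B' B₁).inv := by
  rw [Iso.inv_comp_eq, ← Category.assoc, Iso.eq_comp_inv, arc_nest]

/-- Coherence for three nested pairs of arcs: the two ways of merging them differ only by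
associators on the arcs. This is the geometric content of associativity. -/
theorem wrap_nest_nest (A A' A'' X B'' B' B : D) :
    wrap A B (nest A' A'' X B'' B').hom ≫ (nest A (A' ⊗ A'') X (B'' ⊗ B') B).hom =
      (nest A A' ((A'' ⊗ X) ⊗ B'') B' B).hom ≫ (nest (A ⊗ A') A'' X B'' (B' ⊗ B)).hom ≫
        arc (α_ A A' A'').hom (α_ B'' B' B).inv X := by
  simp only [wrap, arc, nest_hom]
  monoidal

theorem nest_inv_wrap_nest (A A' A'' X B'' B' B : D) :
    (nest A A' ((A'' ⊗ X) ⊗ B'') B' B).inv ≫ wrap A B (nest A' A'' X B'' B').hom =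
      (nest (A ⊗ A') A'' X B'' (B' ⊗ B)).hom ≫ arc (α_ A A' A'').hom (α_ B'' B' B).inv X ≫
        (nest A (A' ⊗ A'') X (B'' ⊗ B') B).inv := by
  rw [Iso.inv_comp_eq]
  simp only [← Category.assoc]
  rw [Iso.eq_comp_inv]
  simp only [Category.assoc]
  exact wrap_nest_nest ..

theorem nest_inv_wrap_nest_inv (A A' A'' X B'' B' B : D) :
    (nest A (A' ⊗ A'') X (B'' ⊗ B') B).inv ≫ wrap A B (nest A' A'' X B'' B').inv =
      arc (α_ A A' A'').inv (α_ B'' B' B).hom X ≫ (nest (A ⊗ A') A'' X B'' (B' ⊗ B)).inv ≫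
        (nest A A' ((A'' ⊗ X) ⊗ B'') B' B).inv := by
  simp only [wrap, arc, nest_inv]
  monoidal

theorem trivialArcs_inv_nest (A X B : D) :
    (trivialArcs ((A ⊗ X) ⊗ B)).inv ≫ (nest (𝟙_ D) A X B (𝟙_ D)).hom =
      arc (λ_ A).inv (ρ_ B).inv X := by
  simp only [arc, nest_hom, trivialArcs, Iso.trans_inv]
  monoidal

theorem nest_inv_trivialArcs (A X B : D) :
    (nest (𝟙_ D) A X B (𝟙_ D)).inv ≫ (trivialArcs ((A ⊗ X) ⊗ B)).hom =
      arc (λ_ A).hom (ρ_ B).hom X := by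
  simp only [arc, nest_inv, trivialArcs, Iso.trans_hom]
  monoidal

theorem wrap_trivialArcs (A X B : D) :
    (nest A (𝟙_ D) X (𝟙_ D) B).hom ≫ arc (ρ_ A).hom (λ_ B).hom X =
      wrap A B (trivialArcs X).hom := by
  simp only [arc, nest_hom, trivialArcs, wrap, Iso.trans_hom]
  monoidal

theorem nest_inv_wrap_trivialArcs (A X B : D) :
    (nest A (𝟙_ D) X (𝟙_ D) B).inv ≫ wrap A B (trivialArcs X).hom =
      arc (ρ_ A).hom (λ_ B).hom X := by
  rw [← wrap_trivialArcs, Iso.inv_hom_id_assoc]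

theorem wrap_trivialArcs_inv_nest (A X B : D) :
    wrap A B (trivialArcs X).inv ≫ (nest A (𝟙_ D) X (𝟙_ D) B).hom =
      arc (ρ_ A).inv (λ_ B).inv X := by
  simp only [arc, nest_hom, trivialArcs, wrap, Iso.trans_inv]
  monoidal

/-- Creation of a pair of arcs around a pair of arcs. -/
def arcUnit {A A' B B' : D} (s : 𝟙_ D ⟶ A' ⊗ A) (t : 𝟙_ D ⟶ B ⊗ B') (X : D) :
    X ⟶ (A' ⊗ ((A ⊗ X) ⊗ B)) ⊗ B' :=
  (trivialArcs X).inv ≫ arc s t X ≫ (nest A' A X B B').inv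

theorem arcUnit_natural {A A' B B' : D} (s : 𝟙_ D ⟶ A' ⊗ A) (t : 𝟙_ D ⟶ B ⊗ B') {X Y : D}
    (f : X ⟶ Y) : arcUnit s t X ≫ wrap A' B' (wrap A B f) = f ≫ arcUnit s t Y := by
  simp only [arcUnit, Category.assoc, nest_inv_wrap_wrap, arc_wrap_assoc,
    reassoc_of% @trivialArcs_inv_natural]

/-- Annihilation of a pair of arcs with a pair of arcs. -/
def arcCounit {A A' B B' : D} (s : A' ⊗ A ⟶ 𝟙_ D) (t : B ⊗ B' ⟶ 𝟙_ D) (X : D) :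
    (A' ⊗ ((A ⊗ X) ⊗ B)) ⊗ B' ⟶ X :=
  (nest A' A X B B').hom ≫ arc s t X ≫ (trivialArcs X).hom

theorem arcCounit_natural {A A' B B' : D} (s : A' ⊗ A ⟶ 𝟙_ D) (t : B ⊗ B' ⟶ 𝟙_ D) {X Y : D}
    (f : X ⟶ Y) : wrap A' B' (wrap A B f) ≫ arcCounit s t Y = arcCounit s t X ≫ f := by
  simp only [arcCounit, Category.assoc, reassoc_of% @wrap_wrap_nest, ← arc_wrap_assoc,
    trivialArcs_natural]

/-- The functors putting the arcs `A`, `B` and the dual arcs around an object are adjoint; the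
zigzag identities on each side combine to one triangle identity, and `wrap_arcUnit_arcCounit` is the
other. -/
theorem arcUnit_wrap_arcCounit {A A' B B' : D} (s : 𝟙_ D ⟶ A ⊗ A') (t : 𝟙_ D ⟶ B' ⊗ B)
    (s' : A' ⊗ A ⟶ 𝟙_ D) (t' : B ⊗ B' ⟶ 𝟙_ D)
    (hs : s ▷ A ≫ (α_ _ _ _).hom ≫ A ◁ s' = (λ_ A).hom ≫ (ρ_ A).inv)
    (ht : B ◁ t ≫ (α_ _ _ _).inv ≫ t' ▷ B = (ρ_ B).hom ≫ (λ_ B).inv) (X : D) :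
    arcUnit s t ((A ⊗ X) ⊗ B) ≫ wrap A B (arcCounit s' t' X) = 𝟙 _ := by
  simp only [arcUnit, arcCounit, wrap_comp, Category.assoc]
  rw [reassoc_of% @nest_inv_wrap_nest, reassoc_of% @nest_inv_wrap_arc,
    nest_inv_wrap_trivialArcs, reassoc_of% @arc_nest,
    reassoc_of% @trivialArcs_inv_nest]
  simp only [← arc_comp]
  rw [reassoc_of% hs, reassoc_of% ht]
  simp

theorem wrap_arcUnit_arcCounit {A A' B B' : D} (s : 𝟙_ D ⟶ A ⊗ A') (t : 𝟙_ D ⟶ B' ⊗ B)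
    (s' : A' ⊗ A ⟶ 𝟙_ D) (t' : B ⊗ B' ⟶ 𝟙_ D)
    (hs : A' ◁ s ≫ (α_ _ _ _).inv ≫ s' ▷ A' = (ρ_ A').hom ≫ (λ_ A').inv)
    (ht : t ▷ B' ≫ (α_ _ _ _).hom ≫ B' ◁ t' = (λ_ B').hom ≫ (ρ_ B').inv) (X : D) :
    wrap A' B' (arcUnit s t X) ≫ arcCounit s' t' ((A' ⊗ X) ⊗ B') = 𝟙 _ := by
  have key : wrap A' B' (nest A A' X B' B).inv ≫ (nest A' A ((A' ⊗ X) ⊗ B') B B').hom =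
      (nest A' (A ⊗ A') X (B' ⊗ B) B').hom ≫ arc (α_ A' A A').inv (α_ B' B B').hom X ≫
        (nest (A' ⊗ A) A' X B' (B ⊗ B')).inv := by
    simp only [wrap, arc, nest_hom, nest_inv]
    monoidal
  simp only [arcUnit, arcCounit, wrap_comp, Category.assoc]
  rw [reassoc_of% key, reassoc_of% @wrap_arc_nest, reassoc_of% @wrap_trivialArcs_inv_nest,
    reassoc_of% @nest_inv_arc, nest_inv_trivialArcs]
  simp only [← arc_comp]
  rw [reassoc_of% hs, reassoc_of% ht]
  simp

end Arcs

/-! ### Schur's lemma and the canonical element of a decomposition -/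

section Linear

variable {D : Type u} [Category.{v} D] [Preadditive D] [MonoidalCategory D] [MonoidalPreadditive D]

theorem wrap_sum (A B : D) {X Y : D} {ι : Type*} (s : Finset ι) (f : ι → (X ⟶ Y)) :
    wrap A B (∑ i ∈ s, f i) = ∑ i ∈ s, wrap A B (f i) := by
  simp only [wrap, whiskerLeft_sum, sum_whiskerRight]

@[simp]
theorem wrap_zero (A B : D) {X Y : D} : wrap A B (0 : X ⟶ Y) = 0 := by simp [wrap]

theorem wrap_add (A B : D) {X Y : D} (f g : X ⟶ Y) :
    wrap A B (f + g) = wrap A B f + wrap A B g := by simp [wrap]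

theorem arc_sum_left {A A' B B' : D} {ι : Type*} (S : Finset ι) (s : ι → (A ⟶ A')) (t : B ⟶ B')
    (X : D) : arc (∑ i ∈ S, s i) t X = ∑ i ∈ S, arc (s i) t X := by
  simp only [arc, sum_whiskerRight, sum_tensor]

theorem arc_sum_right {A A' B B' : D} {ι : Type*} (S : Finset ι) (s : A ⟶ A') (t : ι → (B ⟶ B'))
    (X : D) : arc s (∑ i ∈ S, t i) X = ∑ i ∈ S, arc s (t i) X := by
  simp only [arc, tensor_sum]

@[simp]
theorem arc_zero_left {A A' B B' : D} (t : B ⟶ B') (X : D) : arc (0 : A ⟶ A') t X = 0 := by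
  simp [arc]

@[simp]
theorem arc_zero_right {A A' B B' : D} (s : A ⟶ A') (X : D) : arc s (0 : B ⟶ B') X = 0 := by
  simp [arc]

variable [Linear ℂ D] [MonoidalLinear ℂ D]

theorem wrap_smul (A B : D) {X Y : D} (z : ℂ) (f : X ⟶ Y) :
    wrap A B (z • f) = z • wrap A B f := by simp [wrap]

theorem arc_smul_left {A A' B B' : D} (z : ℂ) (s : A ⟶ A') (t : B ⟶ B')
    (X : D) : arc (z • s) t X = z • arc s t X := by
  simp [arc, MonoidalCategory.tensorHom_def]

theorem arc_smul_right {A A' B B' : D} (z : ℂ) (s : A ⟶ A') (t : B ⟶ B')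
    (X : D) : arc s (z • t) X = z • arc s t X := by
  simp [arc, MonoidalCategory.tensorHom_def]

end Linear

section Schur

variable {D : Type u} [Category.{v} D] [Preadditive D] [Linear ℂ D]

theorem eq_of_iso {x y : Irr D} (i : obj x ≅ obj y) : x = y := by
  rw [← Quotient.out_eq x, ← Quotient.out_eq y]
  exact Quotient.sound (s := simpleSetoid D) ⟨i⟩

@[simp]
theorem delta_self (x : Irr D) : delta x x = 𝟙 (obj x) := by simp [delta]

theorem delta_ne {x y : Irr D} (h : x ≠ y) : delta x y = 0 := by simp [delta, h]

@[simp]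
theorem scal_id (x : Irr D) : scal x (𝟙 (obj x)) = 1 := by
  have h := scal_spec x (𝟙 (obj x))
  have h' : (1 : ℂ) • 𝟙 (obj x) = scal x (𝟙 (obj x)) • 𝟙 (obj x) := by rw [one_smul]; exact h
  exact (smul_left_injective ℂ (obj_simple x).1 h').symm

theorem scal_smul_id (x : Irr D) (z : ℂ) : scal x (z • 𝟙 (obj x)) = z := by
  rw [map_smul, scal_id, smul_eq_mul, mul_one]

theorem scal_comp {X : D} (x : Irr D) (f : obj x ⟶ obj x) (g : obj x ⟶ X) :
    f ≫ g = scal x f • g := by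
  conv_lhs => rw [scal_spec x f]
  rw [Linear.smul_comp, Category.id_comp]

theorem comp_scal {X : D} (x : Irr D) (f : obj x ⟶ obj x) (g : X ⟶ obj x) :
    g ≫ f = scal x f • g := by
  conv_lhs => rw [scal_spec x f]
  rw [Linear.comp_smul, Category.comp_id]

theorem scal_mul (x : Irr D) (f g : obj x ⟶ obj x) : scal x (f ≫ g) = scal x f * scal x g := by
  rw [scal_comp, map_smul, smul_eq_mul]

theorem Decomp.sum_comp {X Y : D} (d : Decomp X) (f : X ⟶ Y) :
    ∑ r, d.proj r ≫ d.inj r ≫ f = f := by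
  simp only [← Category.assoc]
  rw [← Preadditive.sum_comp, d.total, Category.id_comp]

theorem Decomp.comp_sum {X Y : D} (d : Decomp X) (f : Y ⟶ X) :
    ∑ r, (f ≫ d.proj r) ≫ d.inj r = f := by
  simp only [Category.assoc]
  rw [← Preadditive.comp_sum, d.total, Category.comp_id]

variable [HasFiniteBiproducts D] [MonoidalCategory D] [MonoidalPreadditive D]
  [MonoidalLinear ℂ D] [RigidCategory D] [UMFC D]

/-- Schur's lemma from the dagger: for `f ≠ 0` the scalar `f† ∘ f` is nonzero, and by associativity
`f ∘ f†` is the same scalar, so a multiple of `f†` inverts `f`. -/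
theorem hom_eq_zero {x y : Irr D} (h : x ≠ y) (f : obj x ⟶ obj y) : f = 0 := by
  by_contra hf
  have h1 := scal_spec x (f ≫ UMFC.dag f)
  have h2 := scal_spec y (UMFC.dag f ≫ f)
  have hs : scal x (f ≫ UMFC.dag f) ≠ 0 := fun h0 =>
    hf (UMFC.eq_zero_of_comp_dag f (by rw [h1, h0, zero_smul]))
  have h3 : scal x (f ≫ UMFC.dag f) • f = scal y (UMFC.dag f ≫ f) • f := by
    rw [← scal_comp, ← comp_scal, Category.assoc]
  have h4 := smul_left_injective ℂ hf h3
  refine h (eq_of_iso ⟨f, (scal x (f ≫ UMFC.dag f))⁻¹ • UMFC.dag f, ?_, ?_⟩)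
  · rw [Linear.comp_smul]
    conv_lhs => rw [h1]
    rw [map_smul, scal_id, smul_smul, smul_eq_mul, mul_one, inv_mul_cancel₀ hs, one_smul]
  · rw [Linear.smul_comp, h4]
    conv_lhs => rw [h2]
    rw [map_smul, scal_id, smul_smul, smul_eq_mul, mul_one, inv_mul_cancel₀ (h4 ▸ hs), one_smul]

variable {M : Type*} [AddCommMonoid M] [Module ℂ M]

/-- By Schur's lemma `θ` is either a scalar or zero, so it passes from one argument to the other. -/
theorem bilin_slide {X Y : D} (G : ∀ k : Irr D, (obj k ⟶ X) →ₗ[ℂ] (Y ⟶ obj k) →ₗ[ℂ] M)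
    {k k' : Irr D} (θ : obj k ⟶ obj k') (f : obj k' ⟶ X) (g : Y ⟶ obj k) :
    G k (θ ≫ f) g = G k' f (g ≫ θ) := by
  by_cases h : k = k'
  · subst h
    rw [scal_comp, comp_scal]
    simp
  · simp [hom_eq_zero h θ]

/-- The canonical elements of `⊕ Hom(k, X) ⊗ Hom(X, k)` are dinatural in `X`. -/
theorem casimir_natural {X Y : D} (d : Decomp X) (d' : Decomp Y)
    (G : ∀ k : Irr D, (obj k ⟶ Y) →ₗ[ℂ] (X ⟶ obj k) →ₗ[ℂ] M) (w : X ⟶ Y) :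
    ∑ r, G (d.label r) (d.inj r ≫ w) (d.proj r) =
      ∑ s, G (d'.label s) (d'.inj s) (w ≫ d'.proj s) := by
  -- Insert the decomposition of `Y` after `w` and slide the matrix entry `inj r ≫ w ≫ proj s` into
  -- the second argument.
  have h1 : ∀ r, G (d.label r) (d.inj r ≫ w) (d.proj r) =
      ∑ s, G (d'.label s) (d'.inj s) (d.proj r ≫ d.inj r ≫ w ≫ d'.proj s) := by
    intro r
    conv_lhs => rw [← d'.comp_sum (d.inj r ≫ w)]
    rw [map_sum, LinearMap.sum_apply]
    refine Finset.sum_congr rfl fun s _ => ?_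
    rw [bilin_slide]
    simp only [Category.assoc]
  simp only [h1]
  rw [Finset.sum_comm]
  refine Finset.sum_congr rfl fun s _ => ?_
  rw [← map_sum, d.sum_comp]

/-- The tautological decomposition of a simple object. -/
def Decomp.single (k : Irr D) : Decomp (obj k) where
  n := 1
  label _ := k
  inj _ := 𝟙 _
  proj _ := 𝟙 _
  inj_proj_self _ := Category.id_comp _
  inj_proj_ne r s h := absurd (Subsingleton.elim r s) h
  total := by simp

/-- Dinaturality against the tautological decomposition of a simple object: contracting the
canonical element with a morphism out of `k` leaves a single term. -/
theorem casimir_from {Y : D} (d : Decomp Y) {k : Irr D}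
    (G : ∀ i : Irr D, (obj i ⟶ Y) →ₗ[ℂ] (obj k ⟶ obj i) →ₗ[ℂ] M) (w : obj k ⟶ Y) :
    ∑ s, G (d.label s) (d.inj s) (w ≫ d.proj s) = G k w (𝟙 _) := by
  rw [← casimir_natural (Decomp.single k) d G w]
  change ∑ _ : Fin 1, G k (𝟙 _ ≫ w) (𝟙 _) = _
  simp

theorem casimir_to {X : D} (d : Decomp X) {k : Irr D}
    (G : ∀ i : Irr D, (obj i ⟶ obj k) →ₗ[ℂ] (X ⟶ obj i) →ₗ[ℂ] M) (w : X ⟶ obj k) :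
    ∑ r, G (d.label r) (d.inj r ≫ w) (d.proj r) = G k (𝟙 _) w := by
  rw [casimir_natural d (Decomp.single k) G w]
  change ∑ _ : Fin 1, G k (𝟙 _) (w ≫ 𝟙 _) = _
  simp

theorem casimir_through {X Y : D} (d : Decomp Y) {k : Irr D}
    (G : ∀ i : Irr D, (obj i ⟶ Y) →ₗ[ℂ] (X ⟶ obj i) →ₗ[ℂ] M) (w : obj k ⟶ Y) (g : X ⟶ obj k) :
    ∑ s, G (d.label s) (d.inj s) (g ≫ w ≫ d.proj s) = G k w g := by
  have := casimir_from d (fun i => (G i).compl₂ (Linear.leftComp ℂ (obj i) g)) w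
  simpa using this

end Schur

/-! ### Decompositions of the identity on the arcs -/

section DecompArcs

variable {D : Type u} [Category.{v} D] [Preadditive D] [Linear ℂ D] [MonoidalCategory D]
  [MonoidalPreadditive D]

theorem sum_arc_comp {A B X : D} (f : D) (q : (A ⊗ f) ⊗ B ⟶ X) (d : Decomp A) (d' : Decomp B) :
    ∑ r, ∑ s, arc (d.proj r) (d'.proj s) f ≫ arc (d.inj r) (d'.inj s) f ≫ q = q := by
  simp only [← arc_comp_assoc, ← Preadditive.sum_comp, ← arc_sum_right, ← arc_sum_left, d.total,
    d'.total, arc_id, Category.id_comp]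

theorem sum_tensor_arcs {A A' B B' X : D} (f : D) (q : ((A ⊗ A') ⊗ f) ⊗ (B ⊗ B') ⟶ X)
    (d : Decomp A) (d₁ : Decomp A') (d' : Decomp B) (d₁' : Decomp B') :
    ∑ r, ∑ s, ∑ r₁, ∑ s₁, arc (d.proj r ⊗ₘ d₁.proj r₁) (d'.proj s₁ ⊗ₘ d₁'.proj s) f ≫
      arc (d.inj r ⊗ₘ d₁.inj r₁) (d'.inj s₁ ⊗ₘ d₁'.inj s) f ≫ q = q := by
  have : ∀ r s, ∑ r₁, ∑ s₁, arc (d.proj r ⊗ₘ d₁.proj r₁) (d'.proj s₁ ⊗ₘ d₁'.proj s) f ≫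
      arc (d.inj r ⊗ₘ d₁.inj r₁) (d'.inj s₁ ⊗ₘ d₁'.inj s) f ≫ q =
      arc ((d.proj r ≫ d.inj r) ▷ A') (B ◁ (d₁'.proj s ≫ d₁'.inj s)) f ≫ q := by
    intro r s
    simp only [← arc_comp_assoc, tensorHom_comp_tensorHom, ← Preadditive.sum_comp, ← arc_sum_right,
      ← arc_sum_left, ← sum_tensor, ← tensor_sum, d₁.total, d'.total, tensorHom_id, id_tensorHom]
  simp only [this, ← Preadditive.sum_comp, ← arc_sum_right, ← arc_sum_left, ← whiskerLeft_sum,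
    ← sum_whiskerRight, d.total, d₁'.total]
  simp

end DecompArcs

/-! ### Diagrams with arbitrary arcs and the structure maps on them -/

section Resolve

variable {D : Type u} [Category.{v} D] [Preadditive D] [Linear ℂ D]
variable [HasFiniteBiproducts D] [MonoidalCategory D] [MonoidalPreadditive D]
  [MonoidalLinear ℂ D] [RigidCategory D] [UMFC D]

theorem resolve_apply (A B : D) (c e f h : Irr D) (p : Lower A B c e) (q : Upper A B f h) :
    resolve A B c e f h p q = ∑ r, ∑ s,
      dbl ((decomp A).label r) ((decomp B).label s) c e f h
        (p ≫ arc ((decomp A).proj r) ((decomp B).proj s) _)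
        (arc ((decomp A).inj r) ((decomp B).inj s) _ ≫ q) :=
  rfl

/-- Morphisms between simple arcs are scalars or zero, and scalars pass through the tensor product
over `ℂ`. -/
theorem dbl_slide {a a' b b' : Irr D} (c e f h : Irr D) (s : obj a ⟶ obj a') (t : obj b ⟶ obj b')
    (p : Lower (obj a) (obj b) c e) (q : Upper (obj a') (obj b') f h) :
    dbl a' b' c e f h (p ≫ arc s t _) q = dbl a b c e f h p (arc s t _ ≫ q) := by
  by_cases ha : a = a'
  · by_cases hb : b = b'
    · subst ha hb
      rw [scal_spec a s, scal_spec b t]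
      simp only [arc_smul_left, arc_smul_right, arc_id, dbl, Linear.comp_smul, Linear.smul_comp,
        Category.comp_id, Category.id_comp, TensorProduct.smul_tmul, smul_comm (scal b t)]
    · simp [hom_eq_zero hb t, dbl]
  · simp [hom_eq_zero ha s, dbl]

/-- `dbl` as a bilinear map. -/
def dblBilin (a b c e f h : Irr D) :
    Lower (obj a) (obj b) c e →ₗ[ℂ] Upper (obj a) (obj b) f h →ₗ[ℂ] Tube D :=
  (TensorProduct.mk ℂ _ _).compr₂ (inc ⟨a, b, c, e, f, h⟩)

theorem dblBilin_apply (a b c e f h : Irr D) (p : Lower (obj a) (obj b) c e)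
    (q : Upper (obj a) (obj b) f h) : dblBilin a b c e f h p q = dbl a b c e f h p q :=
  rfl

theorem dbl_sum_left {ι : Type*} (S : Finset ι) (a b c e f h : Irr D)
    (p : ι → Lower (obj a) (obj b) c e) (q : Upper (obj a) (obj b) f h) :
    dbl a b c e f h (∑ i ∈ S, p i) q = ∑ i ∈ S, dbl a b c e f h (p i) q := by
  simp only [← dblBilin_apply, map_sum, LinearMap.sum_apply]

theorem dbl_sum_right {ι : Type*} (S : Finset ι) (a b c e f h : Irr D)
    (p : Lower (obj a) (obj b) c e) (q : ι → Upper (obj a) (obj b) f h) :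
    dbl a b c e f h p (∑ i ∈ S, q i) = ∑ i ∈ S, dbl a b c e f h p (q i) := by
  simp only [← dblBilin_apply, map_sum]

/-- The decomposition chosen for a simple object need not be the tautological one; moving the
projections into the upper half lets both sums close to the identity. -/
theorem resolve_obj (a b c e f h : Irr D) (p : Lower (obj a) (obj b) c e)
    (q : Upper (obj a) (obj b) f h) :
    resolve (obj a) (obj b) c e f h p q = dbl a b c e f h p q := by
  rw [resolve_apply]
  simp only [dbl_slide, ← dbl_sum_right]
  rw [sum_arc_comp]

/-- The coend relation on the arcs. Inserting decompositions on both sides of `s` and `t` leaves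
matrix entries between simple objects, for which `dbl_slide` applies. -/
theorem resolve_slide {A A' B B' : D} (c e f h : Irr D) (s : A ⟶ A') (t : B ⟶ B')
    (p : Lower A B c e) (q : Upper A' B' f h) :
    resolve A' B' c e f h (p ≫ arc s t _) q = resolve A B c e f h p (arc s t _ ≫ q) := by
  rw [resolve_apply, resolve_apply]
  have h1 : ∀ r' s', (p ≫ arc s t (obj e)) ≫ arc ((decomp A').proj r') ((decomp B').proj s') _ =
      ∑ r, ∑ s₁, (p ≫ arc ((decomp A).proj r) ((decomp B).proj s₁) _) ≫
        arc ((decomp A).inj r ≫ s ≫ (decomp A').proj r')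
          ((decomp B).inj s₁ ≫ t ≫ (decomp B').proj s') _ := by
    intro r' s'
    simp only [Category.assoc, ← Preadditive.comp_sum, ← arc_comp]
    rw [← Finset.sum_congr rfl fun r _ => arc_sum_right .., ← arc_sum_left, (decomp A).sum_comp,
      (decomp B).sum_comp]
  have h2 : ∀ r s₁, arc ((decomp A).inj r) ((decomp B).inj s₁) _ ≫ arc s t _ ≫ q =
      ∑ r', ∑ s', arc ((decomp A).inj r ≫ s ≫ (decomp A').proj r')
          ((decomp B).inj s₁ ≫ t ≫ (decomp B').proj s') _ ≫
          arc ((decomp A').inj r') ((decomp B').inj s') _ ≫ q := by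
    intro r s₁
    simp only [← arc_comp_assoc, ← Preadditive.sum_comp, ← arc_sum_right, ← arc_sum_left]
    simp only [← Category.assoc ((decomp A).inj r), ← Category.assoc ((decomp B).inj s₁),
      (decomp A').comp_sum, (decomp B').comp_sum]
  simp only [h1, h2, dbl_sum_left, dbl_sum_right, dbl_slide]
  rw [Finset.sum_congr rfl fun r' _ => Finset.sum_comm, Finset.sum_comm]
  refine Finset.sum_congr rfl fun r _ => ?_
  rw [Finset.sum_congr rfl fun r' _ => Finset.sum_comm, Finset.sum_comm]

/-- The definition decomposes the arcs first and merges them afterwards. By naturality of `nest` the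
decompositions become one decomposition of the tensor product arcs, which is slid to one side and
summed to the identity. -/
theorem mul_resolve (A B A' B' : D) (c e f h c' e' f' h' : Irr D)
    (p : Lower A B c e) (q : Upper A B f h) (p' : Lower A' B' c' e') (q' : Upper A' B' f' h') :
    mul (resolve A B c e f h p q) (resolve A' B' c' e' f' h' p' q') =
      resolve (A ⊗ A') (B' ⊗ B) c e' f' h
        (p ≫ wrap A B (delta e c' ≫ p') ≫ (nest A A' (obj e') B' B).hom)
        ((nest A A' (obj f') B' B).inv ≫ wrap A B (q' ≫ delta h' f) ≫ q) := by
  rw [resolve_apply, resolve_apply]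
  simp only [map_sum, LinearMap.sum_apply, mul_dbl]
  have h1 : ∀ r s r₁ s₁, (p ≫ arc ((decomp A).proj r) ((decomp B).proj s) (obj e)) ≫
      wrap (obj ((decomp A).label r)) (obj ((decomp B).label s)) (delta e c' ≫ p' ≫
        arc ((decomp A').proj r₁) ((decomp B').proj s₁) (obj e')) ≫ (nest _ _ (obj e') _ _).hom =
      (p ≫ wrap A B (delta e c' ≫ p') ≫ (nest A A' (obj e') B' B).hom) ≫
        arc ((decomp A).proj r ⊗ₘ (decomp A').proj r₁)
          ((decomp B').proj s₁ ⊗ₘ (decomp B).proj s) _ := by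
    intro r s r₁ s₁
    rw [MonoidalCategory.tensorHom_def ((decomp A).proj r),
      MonoidalCategory.tensorHom_def' ((decomp B').proj s₁), arc_comp]
    simp only [Category.assoc, ← reassoc_of% @arc_nest, ← wrap_arc_nest]
    simp only [wrap_comp, Category.assoc, arc_wrap_assoc]
  have h2 : ∀ r s r₁ s₁, (nest _ _ (obj f') _ _).inv ≫
      wrap (obj ((decomp A).label r)) (obj ((decomp B).label s))
        ((arc ((decomp A').inj r₁) ((decomp B').inj s₁) (obj f') ≫ q') ≫ delta h' f) ≫
        arc ((decomp A).inj r) ((decomp B).inj s) _ ≫ q =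
      arc ((decomp A).inj r ⊗ₘ (decomp A').inj r₁)
          ((decomp B').inj s₁ ⊗ₘ (decomp B).inj s) _ ≫
      ((nest A A' (obj f') B' B).inv ≫ wrap A B (q' ≫ delta h' f) ≫ q) := by
    intro r s r₁ s₁
    rw [MonoidalCategory.tensorHom_def' ((decomp A).inj r),
      MonoidalCategory.tensorHom_def ((decomp B').inj s₁), arc_comp]
    simp only [Category.assoc, ← reassoc_of% @nest_inv_arc, ← reassoc_of% @nest_inv_wrap_arc]
    simp only [wrap_comp, Category.assoc, arc_wrap_assoc]
  refine Eq.trans (b := ∑ r, ∑ s, ∑ r₁, ∑ s₁, resolve _ _ c e' f' h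
      (p ≫ wrap A B (delta e c' ≫ p') ≫ (nest A A' (obj e') B' B).hom)
      (arc ((decomp A).proj r ⊗ₘ (decomp A').proj r₁) ((decomp B').proj s₁ ⊗ₘ (decomp B).proj s) _ ≫
        arc ((decomp A).inj r ⊗ₘ (decomp A').inj r₁) ((decomp B').inj s₁ ⊗ₘ (decomp B).inj s) _ ≫
        (nest A A' (obj f') B' B).inv ≫ wrap A B (q' ≫ delta h' f) ≫ q)) ?_ ?_
  · rw [Finset.sum_congr rfl fun r _ => Finset.sum_comm, Finset.sum_comm]
    refine Finset.sum_congr rfl fun r _ => ?_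
    rw [Finset.sum_congr rfl fun r _ => Finset.sum_comm, Finset.sum_comm]
    refine Finset.sum_congr rfl fun s _ => Finset.sum_congr rfl fun r₁ _ =>
      Finset.sum_congr rfl fun s₁ _ => ?_
    refine Eq.trans ?_ (resolve_slide ..)
    rw [← h1, ← h2]
    rfl
  · simp only [← map_sum]
    rw [sum_tensor_arcs]

theorem counit_dbl (a b c e f h : Irr D) (p : Lower (obj a) (obj b) c e)
    (q : Upper (obj a) (obj b) f h) : counit (dbl a b c e f h p q) =
      scal c (p ≫ wrap (obj a) (obj b) (delta e f) ≫ q ≫ delta h c) := by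
  simp only [counit, dbl, extend_inc]
  rfl

theorem counit_resolve (A B : D) (c e f h : Irr D) (p : Lower A B c e) (q : Upper A B f h) :
    counit (resolve A B c e f h p q) = scal c (p ≫ wrap A B (delta e f) ≫ q ≫ delta h c) := by
  rw [resolve_apply]
  simp only [map_sum, counit_dbl, Category.assoc]
  have h1 : ∀ r s, (arc ((decomp A).proj r) ((decomp B).proj s) (obj e) ≫
      wrap _ _ (delta e f) ≫ arc ((decomp A).inj r) ((decomp B).inj s) (obj f) ≫ q ≫ delta h c) =
      wrap A B (delta e f) ≫ arc ((decomp A).proj r) ((decomp B).proj s) _ ≫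
        arc ((decomp A).inj r) ((decomp B).inj s) _ ≫ q ≫ delta h c := by
    intro r s
    rw [arc_wrap_assoc]
  simp only [h1, ← map_sum, ← Preadditive.comp_sum]
  rw [sum_arc_comp]

/-- One summand of the comultiplication of a diagram, as a bilinear function of the two halves of
the new wall. -/
def comulTerm (A B : D) (c e f h : Irr D) (p : Lower A B c e) (q : Upper A B f h) (i k : Irr D) :
    Lower A B k i →ₗ[ℂ] Upper A B i k →ₗ[ℂ] Tube D ⊗[ℂ] Tube D :=
  (TensorProduct.mk ℂ (Tube D) (Tube D)).compl₁₂ ((resolve A B k i f h).flip q)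
    (resolve A B c e i k p)

theorem comulTerm_apply (A B : D) (c e f h : Irr D) (p : Lower A B c e) (q : Upper A B f h)
    (i k : Irr D) (x : Lower A B k i) (y : Upper A B i k) :
    comulTerm A B c e f h p q i k x y =
      resolve A B k i f h x q ⊗ₜ[ℂ] resolve A B c e i k p y :=
  rfl

theorem comul_dbl (a b c e f h : Irr D) (p : Lower (obj a) (obj b) c e)
    (q : Upper (obj a) (obj b) f h) : comul (dbl a b c e f h p q) =
      ∑ i : Irr D, ∑ r, comulTerm (obj a) (obj b) c e f h p q i _
        ((decomp ((obj a ⊗ obj i) ⊗ obj b)).inj r) ((decomp ((obj a ⊗ obj i) ⊗ obj b)).proj r) := by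
  simp only [comulTerm_apply, resolve_obj]
  simp only [comul, dbl, extend_inc]
  rfl

theorem comulTerm_arc {A A' B B' : D} (c e f h : Irr D) (s : A ⟶ A') (t : B ⟶ B') (s' : A' ⟶ A)
    (t' : B' ⟶ B) (p : Lower A B c e) (q : Upper A B f h) (i k : Irr D) (x : Lower A' B' k i)
    (y : Upper A' B' i k) :
    comulTerm A' B' c e f h (p ≫ arc s t _) (arc s' t' _ ≫ q) i k x y =
      comulTerm A B c e f h p q i k (x ≫ arc s' t' _) (arc s t _ ≫ y) := by
  rw [comulTerm_apply, comulTerm_apply, resolve_slide, resolve_slide]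

/-- The halves of the arc decompositions are moved onto the new wall; dinaturality of the canonical
element replaces the walls with simple arcs by `(A ⊗ i) ⊗ B`, and the arc sums collapse. The freedom
in `d` allows a decomposition adapted to the diagram. -/
theorem comul_resolve (A B : D) (c e f h : Irr D) (p : Lower A B c e) (q : Upper A B f h)
    (d : ∀ i : Irr D, Decomp ((A ⊗ obj i) ⊗ B)) :
    comul (resolve A B c e f h p q) =
      ∑ i : Irr D, ∑ r, comulTerm A B c e f h p q i _ ((d i).inj r) ((d i).proj r) := by
  rw [resolve_apply]
  simp only [map_sum, comul_dbl, comulTerm_arc]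
  have h1 : ∀ r s i, ∑ t, comulTerm A B c e f h p q i _
      ((decomp ((obj ((decomp A).label r) ⊗ obj i) ⊗ obj ((decomp B).label s))).inj t ≫
        arc ((decomp A).inj r) ((decomp B).inj s) _)
      (arc ((decomp A).proj r) ((decomp B).proj s) _ ≫
        (decomp ((obj ((decomp A).label r) ⊗ obj i) ⊗ obj ((decomp B).label s))).proj t) =
      ∑ t, comulTerm A B c e f h p q i _ ((d i).inj t)
        (arc ((decomp A).proj r) ((decomp B).proj s) _ ≫
          arc ((decomp A).inj r) ((decomp B).inj s) _ ≫ (d i).proj t) := by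
    intro r s i
    exact casimir_natural (decomp ((obj ((decomp A).label r) ⊗ obj i) ⊗ obj ((decomp B).label s)))
      (d i) (fun k => (comulTerm A B c e f h p q i k).compl₂
        (Linear.leftComp ℂ _ (arc ((decomp A).proj r) ((decomp B).proj s) _))) _
  simp only [h1]
  rw [Finset.sum_congr rfl fun r _ => Finset.sum_comm, Finset.sum_comm]
  refine Finset.sum_congr rfl fun i _ => ?_
  rw [Finset.sum_congr rfl fun r _ => Finset.sum_comm, Finset.sum_comm]
  refine Finset.sum_congr rfl fun t _ => ?_
  simp only [← map_sum]
  rw [sum_arc_comp]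

end Resolve

section Sandwich

variable {D : Type u} [Category.{v} D] [Preadditive D] [Linear ℂ D] [MonoidalCategory D]
  [MonoidalPreadditive D] [MonoidalLinear ℂ D]

/-- Insertion of a morphism between two arcs. -/
def sandwich {A B X Y Y' Z : D} (p : X ⟶ (A ⊗ Y) ⊗ B) (q : (A ⊗ Y') ⊗ B ⟶ Z) :
    (Y ⟶ Y') →ₗ[ℂ] (X ⟶ Z) where
  toFun f := p ≫ wrap A B f ≫ q
  map_add' f g := by simp [wrap_add]
  map_smul' z f := by simp [wrap_smul]

@[simp]
theorem sandwich_apply {A B X Y Y' Z : D} (p : X ⟶ (A ⊗ Y) ⊗ B) (q : (A ⊗ Y') ⊗ B ⟶ Z)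
    (f : Y ⟶ Y') : sandwich p q f = p ≫ wrap A B f ≫ q :=
  rfl

end Sandwich

/-! ### The weak bialgebra -/

section Bialgebra

variable {D : Type u} [Category.{v} D] [Preadditive D] [Linear ℂ D]
variable [HasFiniteBiproducts D] [MonoidalCategory D] [MonoidalPreadditive D]
  [MonoidalLinear ℂ D] [RigidCategory D] [UMFC D]

/-- Allowing arbitrary arcs keeps the induction closed under products, whose arcs are tensor
products. -/
theorem tube_induction {P : Tube D → Prop} (zero : P 0) (add : ∀ x y, P x → P y → P (x + y))
    (h : ∀ (A B : D) (c e f h : Irr D) (p : Lower A B c e) (q : Upper A B f h),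
      P (resolve A B c e f h p q)) (x : Tube D) : P x := by
  classical
  induction x using DirectSum.induction_on with
  | zero => exact zero
  | add x y hx hy => exact add x y hx hy
  | of L t =>
    induction t using TensorProduct.induction_on with
    | zero => rw [map_zero]; exact zero
    | add s t hs ht => rw [map_add]; exact add _ _ hs ht
    | tmul p q =>
      have := h (obj L.a) (obj L.b) L.c L.e L.f L.h p q
      rw [resolve_obj] at this
      convert this
      simp only [dbl, inc, DirectSum.lof_eq_of]

theorem lines_eq (x y : Irr D) : lines x y = resolve (𝟙_ D) (𝟙_ D) y y x x
    (trivialArcs (obj y)).inv (trivialArcs (obj x)).hom :=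
  rfl

theorem lines_mul_ne (x y : Irr D) (A B : D) (c e f h : Irr D) (p : Lower A B c e)
    (q : Upper A B f h) (hne : ¬ (x = h ∧ y = c)) :
    mul (lines x y) (resolve A B c e f h p q) = 0 := by
  rw [lines_eq, mul_resolve]
  by_cases hy : y = c
  · have hx : h ≠ x := fun hx => hne ⟨hx.symm, hy⟩
    simp [delta_ne hx]
  · simp [delta_ne hy]

theorem lines_mul (A B : D) (c e f h : Irr D) (p : Lower A B c e) (q : Upper A B f h) :
    mul (lines h c) (resolve A B c e f h p q) = resolve A B c e f h p q := by
  rw [lines_eq, mul_resolve]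
  simp only [delta_self, Category.id_comp, Category.comp_id, reassoc_of% @trivialArcs_inv_natural,
    trivialArcs_natural, trivialArcs_inv_nest, reassoc_of% @nest_inv_trivialArcs]
  rw [resolve_slide, ← arc_comp_assoc]
  simp

theorem mul_lines_ne (x y : Irr D) (A B : D) (c e f h : Irr D) (p : Lower A B c e)
    (q : Upper A B f h) (hne : ¬ (x = f ∧ y = e)) :
    mul (resolve A B c e f h p q) (lines x y) = 0 := by
  rw [lines_eq, mul_resolve]
  by_cases hy : e = y
  · have hx : x ≠ f := fun hx => hne ⟨hx, hy.symm⟩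
    simp [delta_ne hx]
  · simp [delta_ne hy]

theorem mul_lines (A B : D) (c e f h : Irr D) (p : Lower A B c e) (q : Upper A B f h) :
    mul (resolve A B c e f h p q) (lines f e) = resolve A B c e f h p q := by
  rw [lines_eq, mul_resolve]
  simp only [delta_self, Category.id_comp, Category.comp_id, wrap_trivialArcs_inv_nest,
    reassoc_of% @nest_inv_wrap_trivialArcs]
  rw [resolve_slide, ← arc_comp_assoc]
  simp

/-- Each `lines x y` acts on a diagram as the identity or as zero, according to its outer labels.
One weighted statement serves both the unit and `ξ`. -/
theorem sum_smul_lines_mul (w : Irr D → Irr D → ℂ) (A B : D) (c e f h : Irr D) (p : Lower A B c e)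
    (q : Upper A B f h) :
    mul (∑ x, ∑ y, w x y • lines x y) (resolve A B c e f h p q) =
      w h c • resolve A B c e f h p q := by
  simp only [map_sum, LinearMap.sum_apply, map_smul, LinearMap.smul_apply]
  rw [Finset.sum_eq_single h, Finset.sum_eq_single c, lines_mul]
  · intro y _ hy
    rw [lines_mul_ne _ _ _ _ _ _ _ _ _ _ (fun h => hy h.2), smul_zero]
  · simp
  · intro x _ hx
    refine Finset.sum_eq_zero fun y _ => ?_
    rw [lines_mul_ne _ _ _ _ _ _ _ _ _ _ (fun h => hx h.1), smul_zero]
  · simp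

theorem mul_sum_smul_lines (w : Irr D → Irr D → ℂ) (A B : D) (c e f h : Irr D) (p : Lower A B c e)
    (q : Upper A B f h) :
    mul (resolve A B c e f h p q) (∑ x, ∑ y, w x y • lines x y) =
      w f e • resolve A B c e f h p q := by
  simp only [map_sum, map_smul]
  rw [Finset.sum_eq_single f, Finset.sum_eq_single e, mul_lines]
  · intro y _ hy
    rw [mul_lines_ne _ _ _ _ _ _ _ _ _ _ (fun h => hy h.2), smul_zero]
  · simp
  · intro x _ hx
    refine Finset.sum_eq_zero fun y _ => ?_
    rw [mul_lines_ne _ _ _ _ _ _ _ _ _ _ (fun h => hx h.1), smul_zero]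
  · simp

theorem one_eq : (one : Tube D) = ∑ x, ∑ y, (1 : ℂ) • lines x y := by
  simp only [one, one_smul]

theorem one_mul' (x : Tube D) : mul one x = x := by
  induction x using tube_induction with
  | zero => simp
  | add x y hx hy => rw [map_add, hx, hy]
  | h A B c e f h p q => rw [one_eq, sum_smul_lines_mul, one_smul]

theorem mul_one' (x : Tube D) : mul x one = x := by
  induction x using tube_induction with
  | zero => simp
  | add x y hx hy => rw [map_add, LinearMap.add_apply, hx, hy]
  | h A B c e f h p q => rw [one_eq, mul_sum_smul_lines, one_smul]

/-- Both products are the same threefold nested diagram up to the associators of the two arcs, which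
cancel after sliding. -/
theorem mul_assoc' (x y z : Tube D) : mul (mul x y) z = mul x (mul y z) := by
  induction x using tube_induction with
  | zero => simp
  | add x y hx hy => simp only [map_add, LinearMap.add_apply, hx, hy]
  | h A B c e f h p q =>
  induction y using tube_induction with
  | zero => simp
  | add x y hx hy => simp only [map_add, LinearMap.add_apply, hx, hy]
  | h A' B' c' e' f' h' p' q' =>
  induction z using tube_induction with
  | zero => simp
  | add x y hx hy => simp only [map_add, hx, hy]
  | h A'' B'' c'' e'' f'' h'' p'' q'' =>
    rw [mul_resolve, mul_resolve, mul_resolve, mul_resolve]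
    have h1 : p ≫ wrap A B (delta e c' ≫ p' ≫ wrap A' B' (delta e' c'' ≫ p'') ≫
          (nest A' A'' (obj e'') B'' B').hom) ≫ (nest A (A' ⊗ A'') (obj e'') (B'' ⊗ B') B).hom =
        ((p ≫ wrap A B (delta e c' ≫ p') ≫ (nest A A' (obj e') B' B).hom) ≫
          wrap (A ⊗ A') (B' ⊗ B) (delta e' c'' ≫ p'') ≫
          (nest (A ⊗ A') A'' (obj e'') B'' (B' ⊗ B)).hom) ≫
          arc (α_ A A' A'').hom (α_ B'' B' B).inv _ := by
      simp only [Category.assoc, wrap_comp, wrap_nest_nest, reassoc_of% @wrap_wrap_nest]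
    have h2 : (nest A (A' ⊗ A'') (obj f'') (B'' ⊗ B') B).inv ≫
        wrap A B (((nest A' A'' (obj f'') B'' B').inv ≫
          wrap A' B' (q'' ≫ delta h'' f') ≫ q') ≫ delta h' f) ≫ q =
        arc (α_ A A' A'').inv (α_ B'' B' B).hom _ ≫
          (nest (A ⊗ A') A'' (obj f'') B'' (B' ⊗ B)).inv ≫
          wrap (A ⊗ A') (B' ⊗ B) (q'' ≫ delta h'' f') ≫
          (nest A A' (obj f') B' B).inv ≫ wrap A B (q' ≫ delta h' f) ≫ q := by
      simp only [Category.assoc, wrap_comp, reassoc_of% @nest_inv_wrap_nest_inv,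
        reassoc_of% @nest_inv_wrap_wrap]
    rw [h1, h2, resolve_slide, ← arc_comp_assoc]
    simp

/-- A decomposition of an object isomorphic to a simple object. -/
def Decomp.ofIso {X : D} {k : Irr D} (i : obj k ≅ X) : Decomp X where
  n := 1
  label _ := k
  inj _ := i.hom
  proj _ := i.inv
  inj_proj_self _ := i.hom_inv_id
  inj_proj_ne r s h := absurd (Subsingleton.elim r s) h
  total := by simp

/-- With trivial arcs the wall `(𝟙 ⊗ i) ⊗ 𝟙` is already simple, so each `i` contributes one term. -/
theorem comul_lines (x y : Irr D) :
    comul (lines x y) = ∑ i : Irr D, lines x i ⊗ₜ[ℂ] lines i y := by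
  rw [lines_eq, comul_resolve _ _ _ _ _ _ _ _ fun i => Decomp.ofIso (trivialArcs (obj i)).symm]
  refine Finset.sum_congr rfl fun i _ => ?_
  exact (Fin.sum_univ_one _)

/-- The walls inserted depend only on the arcs and not on `p` and `q`, so inserting two of them in
either order gives the same double sum. -/
theorem comul_assoc' : (TensorProduct.assoc ℂ (Tube D) (Tube D) (Tube D)).toLinearMap ∘ₗ
    TensorProduct.map comul LinearMap.id ∘ₗ comul =
      TensorProduct.map LinearMap.id comul ∘ₗ comul := by
  ext1 x
  induction x using tube_induction with
  | zero => simp only [map_zero]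
  | add x y hx hy => simp only [map_add, hx, hy]
  | h A B c e f h p q =>
    simp only [LinearMap.comp_apply]
    rw [comul_resolve A B c e f h p q fun i => decomp _]
    simp only [map_sum, comulTerm_apply, TensorProduct.map_tmul, LinearMap.id_apply]
    simp only [fun c e p f h q => comul_resolve A B c e f h p q fun i => decomp _, comulTerm_apply,
      TensorProduct.sum_tmul, TensorProduct.tmul_sum, map_sum, LinearEquiv.coe_coe,
      TensorProduct.assoc_tmul]
    rw [Finset.sum_congr rfl fun i _ => Finset.sum_comm, Finset.sum_comm]
    refine Finset.sum_congr rfl fun i _ => ?_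
    rw [Finset.sum_congr rfl fun i _ => Finset.sum_comm, Finset.sum_comm]

/-- The counit turns the lower half of the wall into a scalar, and contracting the canonical element
puts `q` in place of its upper half; only `i = f` survives. -/
theorem counit_comul' (x : Tube D) :
    TensorProduct.lid ℂ _ (TensorProduct.map counit LinearMap.id (comul x)) = x := by
  induction x using tube_induction with
  | zero => simp only [map_zero]
  | add x y hx hy => simp only [map_add, hx, hy]
  | h A B c e f h p q =>
    rw [comul_resolve A B c e f h p q fun i => decomp _]
    simp only [map_sum, comulTerm_apply, TensorProduct.map_tmul, LinearMap.id_apply,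
      TensorProduct.lid_tmul, counit_resolve]
    have h1 : ∀ i, ∑ r, scal _ ((decomp ((A ⊗ obj i) ⊗ B)).inj r ≫ wrap A B (delta i f) ≫ q ≫
          delta h ((decomp ((A ⊗ obj i) ⊗ B)).label r)) •
        resolve A B c e i _ p ((decomp ((A ⊗ obj i) ⊗ B)).proj r) =
        resolve A B c e i h p (wrap A B (delta i f) ≫ q) := by
      intro i
      have := casimir_to (decomp ((A ⊗ obj i) ⊗ B)) (fun k =>
        (LinearMap.lsmul ℂ (Tube D)).compl₁₂
          (scal k ∘ₗ Linear.rightComp ℂ (obj k) (delta h k)) (resolve A B c e i k p))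
        (wrap A B (delta i f) ≫ q)
      simpa using this
    simp only [h1]
    rw [Finset.sum_eq_single f]
    · simp
    · intro i _ hi
      simp [delta_ne hi]
    · simp

theorem comul_counit' (x : Tube D) :
    TensorProduct.rid ℂ _ (TensorProduct.map LinearMap.id counit (comul x)) = x := by
  induction x using tube_induction with
  | zero => simp only [map_zero]
  | add x y hx hy => simp only [map_add, hx, hy]
  | h A B c e f h p q =>
    rw [comul_resolve A B c e f h p q fun i => decomp _]
    simp only [map_sum, comulTerm_apply, TensorProduct.map_tmul, LinearMap.id_apply,
      TensorProduct.rid_tmul, counit_resolve]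
    have h1 : ∀ i, ∑ r, scal c (p ≫ wrap A B (delta e i) ≫ (decomp ((A ⊗ obj i) ⊗ B)).proj r ≫
          delta ((decomp ((A ⊗ obj i) ⊗ B)).label r) c) •
        resolve A B _ i f h ((decomp ((A ⊗ obj i) ⊗ B)).inj r) q =
        resolve A B c i f h (p ≫ wrap A B (delta e i)) q := by
      intro i
      have := casimir_from (decomp ((A ⊗ obj i) ⊗ B)) (fun k =>
        (LinearMap.lsmul ℂ (Tube D)).flip.compl₁₂ ((resolve A B k i f h).flip q)
          (scal c ∘ₗ Linear.rightComp ℂ (obj c) (delta k c)))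
        (p ≫ wrap A B (delta e i))
      simpa using this
    simp only [h1]
    rw [Finset.sum_eq_single e]
    · simp
    · intro i _ hi
      simp [delta_ne hi.symm]
    · simp

/-- Two nested walls form one wall for the merged arcs: the inner wall between `A'` and `B'` is
absorbed by dinaturality of the outer canonical element, and summing over it gives an identity. -/
theorem comul_mul' (x y : Tube D) : comul (mul x y) = tensorMul mul (comul x) (comul y) := by
  induction x using tube_induction with
  | zero => simp
  | add x y hx hy => simp only [map_add, LinearMap.add_apply, hx, hy]
  | h A B c e f h p q =>
  induction y using tube_induction with
  | zero => simp
  | add x y hx hy => simp only [map_add, hx, hy]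
  | h A' B' c' e' f' h' p' q' =>
    rw [mul_resolve, comul_resolve _ _ _ _ _ _ _ _ fun i => decomp _,
      comul_resolve A B c e f h p q fun i => decomp _,
      comul_resolve A' B' c' e' f' h' p' q' fun i => decomp _]
    set P := p ≫ wrap A B (delta e c' ≫ p') ≫ (nest A A' (obj e') B' B).hom with hP
    set Q := (nest A A' (obj f') B' B).inv ≫ wrap A B (q' ≫ delta h' f) ≫ q with hQ
    simp only [map_sum, LinearMap.sum_apply]
    refine Finset.sum_congr rfl fun j _ => ?_
    have h1 : ∀ s i r, tensorMul mul
        (comulTerm A B c e f h p q i _ ((decomp ((A ⊗ obj i) ⊗ B)).inj r)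
          ((decomp ((A ⊗ obj i) ⊗ B)).proj r))
        (comulTerm A' B' c' e' f' h' p' q' j _ ((decomp ((A' ⊗ obj j) ⊗ B')).inj s)
          ((decomp ((A' ⊗ obj j) ⊗ B')).proj s)) =
        comulTerm (A ⊗ A') (B' ⊗ B) c e' f' h P Q j _
          ((decomp ((A ⊗ obj i) ⊗ B)).inj r ≫ wrap A B (delta i _ ≫
            (decomp ((A' ⊗ obj j) ⊗ B')).inj s) ≫ (nest A A' (obj j) B' B).hom)
          ((nest A A' (obj j) B' B).inv ≫ wrap A B ((decomp ((A' ⊗ obj j) ⊗ B')).proj s ≫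
            delta _ i) ≫ (decomp ((A ⊗ obj i) ⊗ B)).proj r) := by
      intro s i r
      simp only [comulTerm_apply, tensorMul, TensorProduct.map₂_apply_tmul,
        TensorProduct.map_tmul, mul_resolve, hP, hQ]
    simp only [h1]
    have h2 : ∀ s, ∑ i, ∑ r, comulTerm (A ⊗ A') (B' ⊗ B) c e' f' h P Q j _
          ((decomp ((A ⊗ obj i) ⊗ B)).inj r ≫ wrap A B (delta i _ ≫
            (decomp ((A' ⊗ obj j) ⊗ B')).inj s) ≫ (nest A A' (obj j) B' B).hom)
          ((nest A A' (obj j) B' B).inv ≫ wrap A B ((decomp ((A' ⊗ obj j) ⊗ B')).proj s ≫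
            delta _ i) ≫ (decomp ((A ⊗ obj i) ⊗ B)).proj r) =
        ∑ t, comulTerm (A ⊗ A') (B' ⊗ B) c e' f' h P Q j _
          ((decomp (((A ⊗ A') ⊗ obj j) ⊗ (B' ⊗ B))).inj t)
          ((nest A A' (obj j) B' B).inv ≫ wrap A B ((decomp ((A' ⊗ obj j) ⊗ B')).proj s ≫
            (decomp ((A' ⊗ obj j) ⊗ B')).inj s) ≫ (nest A A' (obj j) B' B).hom ≫
            (decomp (((A ⊗ A') ⊗ obj j) ⊗ (B' ⊗ B))).proj t) := by
      intro s
      -- The label of the outer wall must agree with the simple object through which the inner wall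
      -- runs.
      rw [Finset.sum_eq_single ((decomp ((A' ⊗ obj j) ⊗ B')).label s)]
      · have := casimir_natural
          (decomp ((A ⊗ obj ((decomp ((A' ⊗ obj j) ⊗ B')).label s)) ⊗ B))
          (decomp (((A ⊗ A') ⊗ obj j) ⊗ (B' ⊗ B)))
          (fun k => (comulTerm (A ⊗ A') (B' ⊗ B) c e' f' h P Q j k).compl₂
            (Linear.leftComp ℂ (obj k) ((nest A A' (obj j) B' B).inv ≫
              wrap A B ((decomp ((A' ⊗ obj j) ⊗ B')).proj s))))
          (wrap A B ((decomp ((A' ⊗ obj j) ⊗ B')).inj s) ≫ (nest A A' (obj j) B' B).hom)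
        simpa [wrap_comp] using this
      · intro i _ hi
        simp [delta_ne hi]
      · simp
    simp only [h2]
    rw [Finset.sum_comm]
    refine Finset.sum_congr rfl fun t _ => ?_
    simp only [← map_sum, ← Preadditive.comp_sum, ← Preadditive.sum_comp, ← wrap_sum,
      Decomp.total, wrap_id]
    simp

theorem middle_tmul {W : Type*} [AddCommMonoid W] [Module ℂ W] (m : W →ₗ[ℂ] W →ₗ[ℂ] W)
    (x y z w : W) : middle m ((x ⊗ₜ[ℂ] y) ⊗ₜ[ℂ] (z ⊗ₜ[ℂ] w)) = (x ⊗ₜ[ℂ] m y z) ⊗ₜ[ℂ] w :=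
  rfl

theorem comul_one_eq : comul (one : Tube D) = ∑ x, ∑ y, ∑ i, lines x i ⊗ₜ[ℂ] lines i y := by
  simp only [one, map_sum, comul_lines]

theorem lines_mul_lines_ne (x y x' y' : Irr D) (h : ¬ (x = x' ∧ y = y')) :
    mul (lines x y) (lines x' y') = 0 := by
  rw [lines_eq x']
  exact lines_mul_ne _ _ _ _ _ _ _ _ _ _ h

theorem lines_mul_lines (x y : Irr D) : mul (lines x y) (lines x y) = lines x y :=
  lines_mul ..

theorem comul_comul_one : TensorProduct.map comul LinearMap.id (comul (one : Tube D)) =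
    ∑ x, ∑ i, ∑ j, ∑ y, (lines x i ⊗ₜ[ℂ] lines i j) ⊗ₜ[ℂ] lines j y := by
  simp only [comul_one_eq, map_sum, TensorProduct.map_tmul, comul_lines, LinearMap.id_apply,
    TensorProduct.sum_tmul]
  refine Finset.sum_congr rfl fun x _ => ?_
  rw [Finset.sum_congr rfl fun y _ => Finset.sum_comm, Finset.sum_comm]
  refine Finset.sum_congr rfl fun i _ => ?_
  rw [Finset.sum_comm]

/-- The elements `lines x y` are orthogonal idempotents, so the order of multiplication is
irrelevant; the statement for a general `m` covers `mul` and its flip together. -/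
theorem middle_comul_one (m : Tube D →ₗ[ℂ] Tube D →ₗ[ℂ] Tube D)
    (h1 : ∀ x y, m (lines x y) (lines x y) = lines x y)
    (h2 : ∀ x y x' y', ¬ (x = x' ∧ y = y') → m (lines x y) (lines x' y') = 0) :
    middle m (comul (one : Tube D) ⊗ₜ[ℂ] comul one) =
      ∑ x, ∑ i, ∑ j, ∑ y, (lines x i ⊗ₜ[ℂ] lines i j) ⊗ₜ[ℂ] lines j y := by
  have key : ∀ x y i : Irr D, middle m ((lines x i ⊗ₜ[ℂ] lines i y) ⊗ₜ[ℂ]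
      ∑ x', ∑ y', ∑ i', lines x' i' ⊗ₜ[ℂ] lines i' y') =
        ∑ y', (lines x i ⊗ₜ[ℂ] lines i y) ⊗ₜ[ℂ] lines y y' := by
    intro x y i
    simp only [TensorProduct.tmul_sum, map_sum, middle_tmul]
    rw [Finset.sum_eq_single i]
    · refine Finset.sum_congr rfl fun y' _ => ?_
      rw [Finset.sum_eq_single y, h1]
      · intro i' _ hi'
        rw [h2 _ _ _ _ fun h => hi' h.2.symm]
        simp
      · simp
    · intro x' _ hx'
      refine Finset.sum_eq_zero fun y' _ => Finset.sum_eq_zero fun i' _ => ?_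
      rw [h2 _ _ _ _ fun h => hx' h.1.symm]
      simp
    · simp
  simp only [comul_one_eq, TensorProduct.sum_tmul, map_sum, key]
  exact Finset.sum_congr rfl fun x _ => Finset.sum_comm

theorem counit_mul_resolve (A B A' B' : D) (c e f h c' e' f' h' : Irr D)
    (p : Lower A B c e) (q : Upper A B f h) (p' : Lower A' B' c' e') (q' : Upper A' B' f' h') :
    counit (mul (resolve A B c e f h p q) (resolve A' B' c' e' f' h' p' q')) =
      scal c (p ≫ wrap A B (delta e c' ≫ p' ≫ wrap A' B' (delta e' f') ≫ q' ≫ delta h' f) ≫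
        q ≫ delta h c) := by
  rw [mul_resolve, counit_resolve]
  simp only [Category.assoc, wrap_comp, ← reassoc_of% @wrap_wrap_nest, Iso.hom_inv_id_assoc]

theorem counit_mul_mul_resolve (A B A' B' A'' B'' : D) (c e f h c' e' f' h' c'' e'' f'' h'' : Irr D)
    (p : Lower A B c e) (q : Upper A B f h) (p' : Lower A' B' c' e') (q' : Upper A' B' f' h')
    (p'' : Lower A'' B'' c'' e'') (q'' : Upper A'' B'' f'' h'') :
    counit (mul (mul (resolve A B c e f h p q) (resolve A' B' c' e' f' h' p' q'))
      (resolve A'' B'' c'' e'' f'' h'' p'' q'')) =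
      scal c (p ≫ wrap A B (delta e c' ≫ p' ≫ wrap A' B' (delta e' c'' ≫ p'' ≫
        wrap A'' B'' (delta e'' f'') ≫ q'' ≫ delta h'' f') ≫ q' ≫ delta h' f) ≫ q ≫ delta h c) := by
  rw [mul_assoc', mul_resolve A' B', counit_mul_resolve]
  simp only [Category.assoc, wrap_comp, ← reassoc_of% @wrap_wrap_nest, Iso.hom_inv_id_assoc]

theorem tensorEval_tmul {W : Type*} [AddCommMonoid W] [Module ℂ W] (φ ψ : W →ₗ[ℂ] ℂ) (x y : W) :
    tensorEval φ ψ (x ⊗ₜ[ℂ] y) = φ x * ψ y :=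
  rfl

/-- The counit of a product is a nested closed diagram. The factor involving `z` is an endomorphism
of `c'` cut open by the wall; contracting the canonical element glues it back into the factor
involving `x`. -/
theorem counit_mul' (x y z : Tube D) : counit (mul (mul x y) z) =
    tensorEval (counit ∘ₗ mul x) (counit ∘ₗ mul.flip z) (comul y) := by
  induction x using tube_induction with
  | zero => simp [tensorEval, TensorProduct.map_zero_left]
  | add x y hx hy =>
    simp only [map_add, LinearMap.add_apply, hx, hy, tensorEval, TensorProduct.map_add_left,
      LinearMap.comp_add]
  | h A B c e f h p q =>
  induction z using tube_induction with
  | zero => simp [tensorEval, TensorProduct.map_zero_right]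
  | add x y hx hy =>
    simp only [map_add, LinearMap.add_apply, hx, hy, tensorEval, TensorProduct.map_add_right,
      LinearMap.comp_add]
  | h A'' B'' c'' e'' f'' h'' p'' q'' =>
  induction y using tube_induction with
  | zero => simp
  | add x y hx hy => simp only [map_add, LinearMap.add_apply, hx, hy]
  | h A' B' c' e' f' h' p' q' =>
    rw [counit_mul_mul_resolve, comul_resolve A' B' c' e' f' h' p' q' fun i => decomp _]
    simp only [map_sum, comulTerm_apply, tensorEval_tmul, LinearMap.comp_apply,
      LinearMap.flip_apply, counit_mul_resolve]
    have h1 : ∀ i, ∑ r, scal c (p ≫ wrap A B (delta e ((decomp ((A' ⊗ obj i) ⊗ B')).label r) ≫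
          (decomp ((A' ⊗ obj i) ⊗ B')).inj r ≫ wrap A' B' (delta i f') ≫ q' ≫ delta h' f) ≫
          q ≫ delta h c) * scal c' (p' ≫ wrap A' B' (delta e' c'' ≫ p'' ≫
            wrap A'' B'' (delta e'' f'') ≫ q'' ≫ delta h'' i) ≫
            (decomp ((A' ⊗ obj i) ⊗ B')).proj r ≫
            delta ((decomp ((A' ⊗ obj i) ⊗ B')).label r) c') =
        scal c (p ≫ wrap A B (delta e c' ≫ p' ≫ wrap A' B' (delta e' c'' ≫ p'' ≫
            wrap A'' B'' (delta e'' f'') ≫ q'' ≫ delta h'' i) ≫ wrap A' B' (delta i f') ≫ q' ≫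
            delta h' f) ≫ q ≫ delta h c) := by
      intro i
      have := casimir_from (decomp ((A' ⊗ obj i) ⊗ B')) (fun k =>
        (LinearMap.mul ℂ ℂ).compl₁₂ (scal c ∘ₗ sandwich p (q ≫ delta h c) ∘ₗ
          Linear.leftComp ℂ _ (delta e k) ∘ₗ
            Linear.rightComp ℂ _ (wrap A' B' (delta i f') ≫ q' ≫ delta h' f))
          (scal c' ∘ₗ Linear.rightComp ℂ _ (delta k c')))
        (p' ≫ wrap A' B' (delta e' c'' ≫ p'' ≫ wrap A'' B'' (delta e'' f'') ≫ q'' ≫ delta h'' i))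
      simpa using this
    simp only [h1]
    rw [Finset.sum_eq_single f']
    · simp
    · intro i _ hi
      simp [delta_ne hi]
    · simp

/-- Here the factor involving `z` contains the lower half of the wall, so the contraction is with a
morphism into the simple object `h'` instead of one out of `c'`. -/
theorem counit_mul_op' (x y z : Tube D) : counit (mul (mul x y) z) =
    tensorEval (counit ∘ₗ mul x) (counit ∘ₗ mul.flip z)
      (TensorProduct.comm ℂ _ _ (comul y)) := by
  induction x using tube_induction with
  | zero => simp [tensorEval, TensorProduct.map_zero_left]
  | add x y hx hy =>
    simp only [map_add, LinearMap.add_apply, hx, hy, tensorEval, TensorProduct.map_add_left,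
      LinearMap.comp_add]
  | h A B c e f h p q =>
  induction z using tube_induction with
  | zero => simp [tensorEval, TensorProduct.map_zero_right]
  | add x y hx hy =>
    simp only [map_add, LinearMap.add_apply, hx, hy, tensorEval, TensorProduct.map_add_right,
      LinearMap.comp_add]
  | h A'' B'' c'' e'' f'' h'' p'' q'' =>
  induction y using tube_induction with
  | zero => simp
  | add x y hx hy => simp only [map_add, LinearMap.add_apply, hx, hy]
  | h A' B' c' e' f' h' p' q' =>
    rw [counit_mul_mul_resolve, comul_resolve A' B' c' e' f' h' p' q' fun i => decomp _]
    simp only [map_sum, comulTerm_apply, TensorProduct.comm_tmul, tensorEval_tmul,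
      LinearMap.comp_apply, LinearMap.flip_apply, counit_mul_resolve]
    have h1 : ∀ i, ∑ r, scal c (p ≫ wrap A B (delta e c' ≫ p' ≫ wrap A' B' (delta e' i) ≫
          (decomp ((A' ⊗ obj i) ⊗ B')).proj r ≫ delta ((decomp ((A' ⊗ obj i) ⊗ B')).label r) f) ≫
          q ≫ delta h c) * scal _ ((decomp ((A' ⊗ obj i) ⊗ B')).inj r ≫
            wrap A' B' (delta i c'' ≫ p'' ≫ wrap A'' B'' (delta e'' f'') ≫ q'' ≫ delta h'' f') ≫
            q' ≫ delta h' ((decomp ((A' ⊗ obj i) ⊗ B')).label r)) =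
        scal c (p ≫ wrap A B (delta e c' ≫ p' ≫ wrap A' B' (delta e' i) ≫
          (wrap A' B' (delta i c'' ≫ p'' ≫ wrap A'' B'' (delta e'' f'') ≫ q'' ≫ delta h'' f') ≫
            q') ≫ delta h' f) ≫ q ≫ delta h c) := by
      intro i
      refine (Finset.sum_congr rfl fun r _ => mul_comm _ _).trans ?_
      have := casimir_to (decomp ((A' ⊗ obj i) ⊗ B')) (fun k =>
        (LinearMap.mul ℂ ℂ).compl₁₂ (scal k ∘ₗ Linear.rightComp ℂ _ (delta h' k))
          (scal c ∘ₗ sandwich p (q ≫ delta h c) ∘ₗ Linear.leftComp ℂ _ (delta e c') ∘ₗ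
          Linear.leftComp ℂ _ p' ∘ₗ Linear.leftComp ℂ _ (wrap A' B' (delta e' i)) ∘ₗ
            Linear.rightComp ℂ _ (delta k f)))
        (wrap A' B' (delta i c'' ≫ p'' ≫ wrap A'' B'' (delta e'' f'') ≫ q'' ≫ delta h'' f') ≫ q')
      simpa using this
    simp only [h1]
    rw [Finset.sum_eq_single e']
    · simp
    · intro i _ hi
      simp [delta_ne hi.symm]
    · simp

theorem isWeakBialgebra : IsWeakBialgebra (mul (D := D)) one comul counit where
  mul_assoc := mul_assoc'
  one_mul := one_mul'
  mul_one := mul_one'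
  coassoc := comul_assoc'
  counit_comul := counit_comul'
  comul_counit := comul_counit'
  comul_mul := comul_mul'
  comul_one := by
    rw [comul_comul_one, middle_comul_one mul lines_mul_lines lines_mul_lines_ne]
  comul_one_op := by
    rw [comul_comul_one, middle_comul_one mul.flip lines_mul_lines
      fun x y x' y' h => lines_mul_lines_ne x' y' x y fun h' => h ⟨h'.1.symm, h'.2.symm⟩]
  counit_mul := counit_mul'
  counit_mul_op := counit_mul_op'

end Bialgebra

/-! ### Partial traces and mates -/

section Traces

variable {D : Type u} [Category.{v} D] [MonoidalCategory D]

/-- The partial trace over the left tensor factor. -/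
def traceL {A A' X Y : D} (s : 𝟙_ D ⟶ A' ⊗ A) (t : A' ⊗ A ⟶ 𝟙_ D) (T : A ⊗ X ⟶ A ⊗ Y) : X ⟶ Y :=
  (λ_ X).inv ≫ s ▷ X ≫ (α_ _ _ _).hom ≫ A' ◁ T ≫ (α_ _ _ _).inv ≫ t ▷ Y ≫ (λ_ Y).hom

/-- The partial trace over the right tensor factor. -/
def traceR {B B' X Y : D} (s : 𝟙_ D ⟶ B ⊗ B') (t : B ⊗ B' ⟶ 𝟙_ D) (T : X ⊗ B ⟶ Y ⊗ B) : X ⟶ Y :=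
  (ρ_ X).inv ≫ X ◁ s ≫ (α_ _ _ _).inv ≫ T ▷ B' ≫ (α_ _ _ _).hom ≫ Y ◁ t ≫ (ρ_ Y).hom

theorem traceR_natural {B B' X Y X₁ Y₁ : D} (s : 𝟙_ D ⟶ B ⊗ B') (t : B ⊗ B' ⟶ 𝟙_ D)
    (T : X ⊗ B ⟶ Y ⊗ B) (f : X₁ ⟶ X) (g : Y ⟶ Y₁) :
    traceR s t (f ▷ B ≫ T ≫ g ▷ B) = f ≫ traceR s t T ≫ g := by
  simp only [traceR, comp_whiskerRight, Category.assoc]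
  rw [← associator_inv_naturality_left_assoc, whisker_exchange_assoc, whiskerRight_id,
    associator_naturality_left_assoc, ← whisker_exchange_assoc, whiskerRight_id]
  simp

/-- Closing first the right and then the left strand, or conversely, gives the same endomorphism of
`𝟙`, by interchange of the two caps and of the two cups. -/
theorem close_left_right {A A' B B' : D} (s : 𝟙_ D ⟶ A' ⊗ A) (t : A' ⊗ A ⟶ 𝟙_ D)
    (s' : 𝟙_ D ⟶ B ⊗ B') (t' : B ⊗ B' ⟶ 𝟙_ D) (T : A ⊗ B ⟶ A ⊗ B) :
    s ≫ A' ◁ traceR s' t' T ≫ t = s' ≫ traceL s t T ▷ B' ≫ t' := by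
  calc s ≫ A' ◁ traceR s' t' T ≫ t
      = 𝟙 _ ⊗≫ (s ▷ 𝟙_ D ≫ (A' ⊗ A) ◁ s') ⊗≫ A' ◁ T ▷ B' ⊗≫
          ((A' ⊗ A) ◁ t' ≫ t ▷ 𝟙_ D) ⊗≫ 𝟙 _ := by
        simp only [traceR]; monoidal
    _ = 𝟙 _ ⊗≫ (𝟙_ D ◁ s' ≫ s ▷ (B ⊗ B')) ⊗≫ A' ◁ T ▷ B' ⊗≫
          (t ▷ (B ⊗ B') ≫ 𝟙_ D ◁ t') ⊗≫ 𝟙 _ := by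
        rw [whisker_exchange, whisker_exchange]
    _ = s' ≫ traceL s t T ▷ B' ≫ t' := by
        simp only [traceL]; monoidal

theorem traceL_traceR {A A' B B' X : D} (s : 𝟙_ D ⟶ A' ⊗ A) (t : A' ⊗ A ⟶ 𝟙_ D)
    (s' : 𝟙_ D ⟶ B ⊗ B') (t' : B ⊗ B' ⟶ 𝟙_ D) (T : (A ⊗ X) ⊗ B ⟶ (A ⊗ X) ⊗ B) :
    arcUnit s s' X ≫ wrap A' B' T ≫ arcCounit t t' X = traceL s t (traceR s' t' T) := by
  simp only [arcUnit, arcCounit, arc, traceL, traceR, wrap, nest_hom, nest_inv, trivialArcs,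
    Iso.trans_hom, Iso.trans_inv]
  rw [MonoidalCategory.tensorHom_def (s ▷ X), MonoidalCategory.tensorHom_def' (t ▷ X)]
  monoidal

/-- The duality maps of a tensor product are nested, so closing with them performs the inner partial
trace first. -/
theorem close_pairing_left {A A' B B' : D} [ExactPairing A A'] [ExactPairing B B']
    [ExactPairing A' A] [ExactPairing B' B] (T : A ⊗ B ⟶ A ⊗ B) :
    η_ (B' ⊗ A') (A ⊗ B) ≫ (B' ⊗ A') ◁ T ≫ ε_ (A ⊗ B) (B' ⊗ A') =
      η_ B' B ≫ B' ◁ traceL (η_ A' A) (ε_ A A') T ≫ ε_ B B' := by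
  rw [ExactPairing.tensor_coevaluation, ExactPairing.tensor_evaluation]
  simp only [traceL]
  monoidal

theorem close_pairing_right {A A' B B' : D} [ExactPairing A A'] [ExactPairing B B']
    [ExactPairing A' A] [ExactPairing B' B] (T : A ⊗ B ⟶ A ⊗ B) :
    η_ (A ⊗ B) (B' ⊗ A') ≫ T ▷ (B' ⊗ A') ≫ ε_ (B' ⊗ A') (A ⊗ B) =
      η_ A A' ≫ traceR (η_ B B') (ε_ B' B) T ▷ A' ≫ ε_ A' A := by
  rw [ExactPairing.tensor_coevaluation, ExactPairing.tensor_evaluation]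
  simp only [traceR]
  monoidal

/-- The mate of `f` with respect to two exact pairings. -/
def mate {X X' Z Z' : D} [ExactPairing X X'] [ExactPairing Z Z'] (f : Z ⟶ X) : X' ⟶ Z' :=
  @rightAdjointMate D _ _ Z X ⟨Z'⟩ ⟨X'⟩ f

theorem eq_of_whiskerRight_evaluation {X X' Y : D} [ExactPairing X X'] {m n : Y ⟶ X'}
    (h : m ▷ X ≫ ε_ X X' = n ▷ X ≫ ε_ X X') : m = n := by
  have key : ∀ m : Y ⟶ X', m = (ρ_ Y).inv ≫ Y ◁ η_ X X' ≫ (α_ _ _ _).inv ≫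
      (m ▷ X ≫ ε_ X X') ▷ X' ≫ (λ_ X').hom := by
    intro m
    rw [comp_whiskerRight_assoc, ← associator_inv_naturality_left_assoc, whisker_exchange_assoc]
    rw [ExactPairing.coevaluation_evaluation_assoc]
    simp
  rw [key m, key n, h]

/-- The mate of `f` with respect to two exact pairings on the other side. -/
def mate' {X X' Z Z' : D} [ExactPairing X' X] [ExactPairing Z' Z] (f : Z ⟶ X) : X' ⟶ Z' :=
  @leftAdjointMate D _ _ Z X ⟨Z'⟩ ⟨X'⟩ f

section Mate

variable {X X' Z Z' : D}

theorem mate_evaluation [ExactPairing X X'] [ExactPairing Z Z'] (f : Z ⟶ X) :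
    (mate f : X' ⟶ Z') ▷ Z ≫ ε_ Z Z' = X' ◁ f ≫ ε_ X X' :=
  @rightAdjointMate_comp_evaluation D _ _ Z X ⟨Z'⟩ ⟨X'⟩ f

theorem coevaluation_mate [ExactPairing X X'] [ExactPairing Z Z'] (f : Z ⟶ X) :
    η_ X X' ≫ X ◁ (mate f : X' ⟶ Z') = η_ Z Z' ≫ f ▷ Z' :=
  @coevaluation_comp_rightAdjointMate D _ _ Z X ⟨Z'⟩ ⟨X'⟩ f

theorem mate'_evaluation [ExactPairing X' X] [ExactPairing Z' Z] (f : Z ⟶ X) :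
    Z ◁ (mate' f : X' ⟶ Z') ≫ ε_ Z' Z = f ▷ X' ≫ ε_ X' X :=
  @leftAdjointMate_comp_evaluation D _ _ Z X ⟨Z'⟩ ⟨X'⟩ f

theorem coevaluation_mate' [ExactPairing X' X] [ExactPairing Z' Z] (f : Z ⟶ X) :
    η_ X' X ≫ (mate' f : X' ⟶ Z') ▷ X = η_ Z' Z ≫ Z' ◁ f :=
  @coevaluation_comp_leftAdjointMate D _ _ Z X ⟨Z'⟩ ⟨X'⟩ f

theorem mate_comp_mate [ExactPairing X X'] [ExactPairing Z Z'] (f : Z ⟶ X) (g : X ⟶ Z) :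
    (mate g : Z' ⟶ X') ≫ (mate f : X' ⟶ Z') = mate (f ≫ g) :=
  (@comp_rightAdjointMate D _ _ Z X Z ⟨Z'⟩ ⟨X'⟩ ⟨Z'⟩ f g).symm

theorem mate'_comp_mate' [ExactPairing X' X] [ExactPairing Z' Z] (f : Z ⟶ X) (g : X ⟶ Z) :
    (mate' g : Z' ⟶ X') ≫ (mate' f : X' ⟶ Z') = mate' (f ≫ g) :=
  (@comp_leftAdjointMate D _ _ Z X Z ⟨Z'⟩ ⟨X'⟩ ⟨Z'⟩ f g).symm

/-- The mate in the opposite direction is a preimage, since a morphism into a dual is determined by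
its pairing with the evaluation. -/
theorem mate_surjective [ExactPairing X X'] [ExactPairing Z Z'] (m : X' ⟶ Z') :
    ∃ f : Z ⟶ X, mate f = m := by
  refine ⟨@leftAdjointMate D _ _ X' Z' ⟨X⟩ ⟨Z⟩ m, ?_⟩
  apply eq_of_whiskerRight_evaluation (X := Z)
  rw [mate_evaluation]
  exact @leftAdjointMate_comp_evaluation D _ _ X' Z' ⟨X⟩ ⟨Z⟩ m

end Mate

end Traces

section TracesLinear

variable {D : Type u} [Category.{v} D] [Preadditive D] [MonoidalCategory D] [MonoidalPreadditive D]

theorem traceL_sum {ι : Type*} (S : Finset ι) {A A' X Y : D} (s : 𝟙_ D ⟶ A' ⊗ A)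
    (t : A' ⊗ A ⟶ 𝟙_ D) (T : ι → (A ⊗ X ⟶ A ⊗ Y)) :
    traceL s t (∑ i ∈ S, T i) = ∑ i ∈ S, traceL s t (T i) := by
  simp [traceL, Preadditive.comp_sum, Preadditive.sum_comp, whiskerLeft_sum]

variable {X X' Z Z' : D}

theorem mate_sub [ExactPairing X X'] [ExactPairing Z Z'] (f g : Z ⟶ X) :
    (mate (f - g) : X' ⟶ Z') = mate f - mate g := by
  refine eq_sub_of_add_eq ?_
  conv_rhs => rw [← sub_add_cancel f g]
  simp only [mate, rightAdjointMate, MonoidalPreadditive.add_whiskerRight,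
    MonoidalPreadditive.whiskerLeft_add, Preadditive.add_comp,
    Preadditive.comp_add]

theorem mate'_sub [ExactPairing X' X] [ExactPairing Z' Z] (f g : Z ⟶ X) :
    (mate' (f - g) : X' ⟶ Z') = mate' f - mate' g := by
  refine eq_sub_of_add_eq ?_
  conv_rhs => rw [← sub_add_cancel f g]
  simp only [mate', leftAdjointMate, MonoidalPreadditive.add_whiskerRight,
    MonoidalPreadditive.whiskerLeft_add, Preadditive.add_comp,
    Preadditive.comp_add]

variable [Linear ℂ D] [MonoidalLinear ℂ D]

theorem mate_smul_id [ExactPairing Z Z'] (z : ℂ) : (mate (z • 𝟙 Z) : Z' ⟶ Z') = z • 𝟙 Z' := by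
  have : (mate (𝟙 Z) : Z' ⟶ Z') = 𝟙 Z' := @rightAdjointMate_id D _ _ Z ⟨Z'⟩
  conv_rhs => rw [← this]
  simp [mate, rightAdjointMate]

theorem mate'_smul_id [ExactPairing Z' Z] (z : ℂ) : (mate' (z • 𝟙 Z) : Z' ⟶ Z') = z • 𝟙 Z' := by
  have : (mate' (𝟙 Z) : Z' ⟶ Z') = 𝟙 Z' := @leftAdjointMate_id D _ _ Z ⟨Z'⟩
  conv_rhs => rw [← this]
  simp [mate', leftAdjointMate]

end TracesLinear

/-! ### Endomorphisms of the unit object -/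

section UnitAction

variable {D : Type u} [Category.{v} D] [Preadditive D] [Linear ℂ D] [MonoidalCategory D]

/-- The scalar by which an endomorphism of the unit acts on `x` from the right. -/
def actR (x : Irr D) (e : 𝟙_ D ⟶ 𝟙_ D) : ℂ :=
  scal x ((ρ_ (obj x)).inv ≫ obj x ◁ e ≫ (ρ_ (obj x)).hom)

/-- The scalar by which an endomorphism of the unit acts on `x` from the left. -/
def actL (x : Irr D) (e : 𝟙_ D ⟶ 𝟙_ D) : ℂ :=
  scal x ((λ_ (obj x)).inv ≫ e ▷ obj x ≫ (λ_ (obj x)).hom)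

theorem whiskerLeft_unit (x : Irr D) (e : 𝟙_ D ⟶ 𝟙_ D) : obj x ◁ e = actR x e • 𝟙 _ := by
  have h := scal_spec x ((ρ_ (obj x)).inv ≫ obj x ◁ e ≫ (ρ_ (obj x)).hom)
  rw [Iso.inv_comp_eq, Linear.comp_smul, Category.comp_id] at h
  rw [← cancel_mono (ρ_ (obj x)).hom, h, Linear.smul_comp, Category.id_comp, actR]

theorem whiskerRight_unit (x : Irr D) (e : 𝟙_ D ⟶ 𝟙_ D) : e ▷ obj x = actL x e • 𝟙 _ := by
  have h := scal_spec x ((λ_ (obj x)).inv ≫ e ▷ obj x ≫ (λ_ (obj x)).hom)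
  rw [Iso.inv_comp_eq, Linear.comp_smul, Category.comp_id] at h
  rw [← cancel_mono (λ_ (obj x)).hom, h, Linear.smul_comp, Category.id_comp, actL]

variable [MonoidalPreadditive D] [MonoidalLinear ℂ D]

theorem actR_smul (x : Irr D) (z : ℂ) (e : 𝟙_ D ⟶ 𝟙_ D) : actR x (z • e) = z * actR x e := by
  simp [actR]

theorem actL_smul (x : Irr D) (z : ℂ) (e : 𝟙_ D ⟶ 𝟙_ D) : actL x (z • e) = z * actL x e := by
  simp [actL]

/-- In `x ⊗ 𝟙 ⊗ y` the endomorphism of `𝟙` can be absorbed on either side; if `x ⊗ y` is nonzero,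
the two scalars coincide. This replaces simplicity of the unit. -/
theorem actR_eq_actL_of_id_ne_zero {x y : Irr D} (hne : 𝟙 (obj x ⊗ obj y) ≠ 0)
    (e : 𝟙_ D ⟶ 𝟙_ D) : actR x e = actL y e := by
  have h1 : (obj x ◁ e) ▷ obj y ≫ (α_ _ _ _).hom = (α_ _ _ _).hom ≫ obj x ◁ (e ▷ obj y) := by simp
  rw [whiskerLeft_unit, whiskerRight_unit] at h1
  simp only [MonoidalLinear.smul_whiskerRight, MonoidalLinear.whiskerLeft_smul, Linear.smul_comp,
    Linear.comp_smul, id_whiskerRight, whiskerLeft_id, Category.id_comp, Category.comp_id] at h1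
  by_contra hxy
  apply hne
  have h2 : (actR x e - actL y e) • (α_ (obj x) (𝟙_ D) (obj y)).hom = 0 := by
    rw [sub_smul, h1, sub_self]
  have h3 := (smul_eq_zero.mp h2).resolve_left (sub_ne_zero.mpr hxy)
  have : 𝟙 (obj x ⊗ obj y) = (ρ_ (obj x)).inv ▷ obj y ≫ (α_ (obj x) (𝟙_ D) (obj y)).hom ≫
    obj x ◁ (λ_ (obj y)).hom := by simp
  rw [this, h3]
  simp

theorem actR_eq_actL {x y z : Irr D} {f : obj z ⟶ obj x ⊗ obj y} (hf : f ≠ 0) (e : 𝟙_ D ⟶ 𝟙_ D) :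
    actR x e = actL y e :=
  actR_eq_actL_of_id_ne_zero (fun h => hf (by rw [← Category.comp_id f, h, comp_zero])) e

/-- The endomorphism, placed to the right, commutes with `f`; it acts on the source through `z` and
on the target through `y`. -/
theorem actR_of_ne_zero {x y z : Irr D} {f : obj z ⟶ obj x ⊗ obj y} (hf : f ≠ 0)
    (e : 𝟙_ D ⟶ 𝟙_ D) : actR z e = actR y e := by
  have h1 : f ▷ 𝟙_ D ≫ (obj x ⊗ obj y) ◁ e = obj z ◁ e ≫ f ▷ 𝟙_ D := (whisker_exchange f e).symm
  rw [tensor_whiskerLeft, whiskerLeft_unit, whiskerLeft_unit] at h1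
  simp only [MonoidalLinear.whiskerLeft_smul, Linear.smul_comp,
    Linear.comp_smul, whiskerLeft_id, Category.id_comp, Iso.hom_inv_id, Category.comp_id] at h1
  by_contra hne
  have h2 : (actR y e - actR z e) • f ▷ 𝟙_ D = 0 := by rw [sub_smul, h1, sub_self]
  have h3 := (smul_eq_zero.mp h2).resolve_left (sub_ne_zero.mpr (Ne.symm hne))
  rw [whiskerRight_id] at h3
  apply hf
  rw [← cancel_epi (ρ_ (obj z)).hom, ← cancel_mono (ρ_ (obj x ⊗ obj y)).inv]
  simpa using h3

theorem actL_of_ne_zero {x y z : Irr D} {f : obj z ⟶ obj x ⊗ obj y} (hf : f ≠ 0)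
    (e : 𝟙_ D ⟶ 𝟙_ D) : actL z e = actL x e := by
  have h1 : 𝟙_ D ◁ f ≫ e ▷ (obj x ⊗ obj y) = e ▷ obj z ≫ 𝟙_ D ◁ f := whisker_exchange e f
  rw [whiskerRight_tensor, whiskerRight_unit, whiskerRight_unit] at h1
  simp only [MonoidalLinear.smul_whiskerRight, Linear.smul_comp,
    Linear.comp_smul, id_whiskerRight, Category.id_comp, Iso.inv_hom_id, Category.comp_id] at h1
  by_contra hne
  have h2 : (actL x e - actL z e) • 𝟙_ D ◁ f = 0 := by rw [sub_smul, h1, sub_self]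
  have h3 := (smul_eq_zero.mp h2).resolve_left (sub_ne_zero.mpr (Ne.symm hne))
  rw [id_whiskerLeft] at h3
  apply hf
  rw [← cancel_epi (λ_ (obj z)).hom, ← cancel_mono (λ_ (obj x ⊗ obj y)).inv]
  simpa using h3

end UnitAction

/-! ### Positivity of the quantum dimensions -/

section Dagger

variable {D : Type u} [Category.{v} D] [Preadditive D] [Linear ℂ D]
variable [HasFiniteBiproducts D] [MonoidalCategory D] [MonoidalPreadditive D]
  [MonoidalLinear ℂ D] [RigidCategory D] [UMFC D]

open TubeAlg.UMFC (dag dag_dag dag_add dag_smul dag_id dag_comp dag_tensor)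

theorem dag_whiskerLeft (A : D) {X Y : D} (f : X ⟶ Y) : dag (A ◁ f) = A ◁ dag f := by
  rw [← id_tensorHom, dag_tensor, dag_id, id_tensorHom]

theorem dag_whiskerRight {X Y : D} (f : X ⟶ Y) (A : D) : dag (f ▷ A) = dag f ▷ A := by
  rw [← tensorHom_id, dag_tensor, dag_id, tensorHom_id]

theorem dag_injective {X Y : D} {f g : X ⟶ Y} (h : dag f = dag g) : f = g := by
  rw [← dag_dag f, h, dag_dag]

theorem dag_zero {X Y : D} : dag (0 : X ⟶ Y) = 0 := by
  have := dag_smul (0 : ℂ) (0 : X ⟶ Y)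
  simpa using this

theorem dag_associator_inv (X Y Z : D) : dag (α_ X Y Z).inv = (α_ X Y Z).hom := by
  rw [← UMFC.dag_associator, dag_dag]

theorem dag_leftUnitor_inv (X : D) : dag (λ_ X).inv = (λ_ X).hom := by
  rw [← UMFC.dag_leftUnitor, dag_dag]

theorem dag_rightUnitor_inv (X : D) : dag (ρ_ X).inv = (ρ_ X).hom := by
  rw [← UMFC.dag_rightUnitor, dag_dag]

theorem scal_dag (x : Irr D) (f : obj x ⟶ obj x) : scal x (dag f) = conj (scal x f) := by
  conv_lhs => rw [scal_spec x f]
  rw [dag_smul, dag_id, scal_smul_id]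

/-- The value of the hermitian form `f ↦ f† ∘ f` on morphisms out of a simple object. -/
def hermSq {x : Irr D} {Y : D} (f : obj x ⟶ Y) : ℝ := (scal x (f ≫ dag f)).re

theorem scal_comp_dag {x : Irr D} {Y : D} (f : obj x ⟶ Y) :
    scal x (f ≫ dag f) = (hermSq f : ℂ) := by
  have h : conj (scal x (f ≫ dag f)) = scal x (f ≫ dag f) := by
    rw [← scal_dag, dag_comp, dag_dag]
  exact (Complex.conj_eq_iff_re.mp h).symm

theorem eq_zero_of_hermSq {x : Irr D} {Y : D} {f : obj x ⟶ Y} (h : hermSq f = 0) : f = 0 := by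
  apply UMFC.eq_zero_of_comp_dag
  rw [scal_spec x (f ≫ dag f), scal_comp_dag, h, Complex.ofReal_zero, zero_smul]

theorem hermSq_real_smul {x : Irr D} {Y : D} (t : ℝ) (f : obj x ⟶ Y) :
    hermSq ((t : ℂ) • f) = t ^ 2 * hermSq f := by
  rw [hermSq, dag_smul, Linear.smul_comp, Linear.comp_smul, map_smul, map_smul, scal_comp_dag]
  simp
  ring

theorem hermSq_add_real_smul {x : Irr D} {Y : D} (t : ℝ) (f g : obj x ⟶ Y) :
    hermSq (f + (t : ℂ) • g) =
      hermSq f + 2 * t * (scal x (f ≫ dag g)).re + t ^ 2 * hermSq g := by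
  have h : scal x (g ≫ dag f) = conj (scal x (f ≫ dag g)) := by
    rw [← scal_dag, dag_comp, dag_dag]
  rw [hermSq, dag_add, dag_smul]
  simp only [Preadditive.add_comp, Preadditive.comp_add, Linear.smul_comp, Linear.comp_smul,
    map_add, map_smul, scal_comp_dag, h]
  simp
  ring

/-- The form `f ↦ f† ∘ f` is definite (of either sign) on morphisms out of a simple object. -/
theorem hermSq_mul_nonneg {x : Irr D} {Y : D} (f g : obj x ⟶ Y) : 0 ≤ hermSq f * hermSq g := by
  by_contra! hlt
  set c := (scal x (f ≫ dag g)).re with hc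
  set n := hermSq f with hn
  set m := hermSq g with hm
  have hm0 : m ≠ 0 := by rintro h; rw [h, mul_zero] at hlt; exact lt_irrefl _ hlt
  have hd : 0 ≤ c ^ 2 - n * m := by nlinarith [sq_nonneg c]
  -- A root of `t ↦ hermSq (f + t g)`: the discriminant is nonnegative because the outer
  -- coefficients have opposite signs. The resulting isotropic vector vanishes, making `f` a real
  -- multiple of `g`, which contradicts the signs.
  set t := (-c + Real.sqrt (c ^ 2 - n * m)) / m with ht
  have hroot : n + 2 * t * c + t ^ 2 * m = 0 := by
    have h1 : t * m + c = Real.sqrt (c ^ 2 - n * m) := by rw [ht]; field_simp; ring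
    have h2 := Real.sq_sqrt hd
    rw [← h1] at h2
    have h3 : m * (n + 2 * t * c + t ^ 2 * m) = 0 := by linarith [h2]
    exact (mul_eq_zero.mp h3).resolve_left hm0
  have hz : f + (t : ℂ) • g = 0 := eq_zero_of_hermSq (by rw [hermSq_add_real_smul, hroot])
  have hf : f = ((-t : ℝ) : ℂ) • g := by
    rw [eq_neg_of_add_eq_zero_left hz]; simp
  have : n = t ^ 2 * m := by rw [hn, hf, hermSq_real_smul]; ring
  rw [this] at hlt
  nlinarith [mul_nonneg (sq_nonneg t) (sq_nonneg m)]

/-! ### Closed loops -/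

theorem loopL_eq (x : Irr D) : loopL x = actR x (dag (ev (obj x)) ≫ ev (obj x)) := rfl

theorem loopR_eq (x : Irr D) : loopR x = actL x (coev (obj x) ≫ dag (coev (obj x))) := rfl

/-- Creation of a dual pair to the left of `x`. -/
def cupLeft (x : Irr D) : obj x ⟶ (obj x ⊗ (obj x)ᘁ) ⊗ obj x :=
  (λ_ (obj x)).inv ≫ coev (obj x) ▷ obj x

/-- Creation of a dual pair to the right of `x`. -/
def cupRight (x : Irr D) : obj x ⟶ (obj x ⊗ (obj x)ᘁ) ⊗ obj x :=
  (ρ_ (obj x)).inv ≫ obj x ◁ dag (ev (obj x)) ≫ (α_ _ _ _).inv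

/-- Both loop values are values of one hermitian form on `Hom(x, (x ⊗ xᘁ) ⊗ x)`, here at `cupLeft`
and below at `cupRight`. Definiteness of the form then gives them the same sign. -/
theorem hermSq_cupLeft (x : Irr D) : ((hermSq (cupLeft x) : ℝ) : ℂ) = loopR x := by
  rw [← scal_comp_dag, loopR_eq, actL, cupLeft]
  simp only [dag_comp, dag_leftUnitor_inv, dag_whiskerRight, Category.assoc, comp_whiskerRight]

theorem hermSq_cupRight (x : Irr D) : ((hermSq (cupRight x) : ℝ) : ℂ) = loopL x := by
  rw [← scal_comp_dag, loopL_eq, actR, cupRight]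
  simp only [dag_comp, dag_rightUnitor_inv, dag_whiskerLeft, dag_associator_inv, Category.assoc,
    Iso.inv_hom_id_assoc, MonoidalCategory.whiskerLeft_comp, dag_dag]

/-- This is a zigzag identity; it shows that neither vector is zero. -/
theorem cupLeft_comp_dag_cupRight (x : Irr D) : cupLeft x ≫ dag (cupRight x) = 𝟙 _ := by
  rw [cupLeft, cupRight]
  simp only [dag_comp, dag_rightUnitor_inv, dag_whiskerLeft, dag_associator_inv, Category.assoc,
    dag_dag, coev, ev]
  rw [ExactPairing.evaluation_coevaluation_assoc]
  simp

theorem hermSq_cupLeft_ne_zero (x : Irr D) : hermSq (cupLeft x) ≠ 0 := by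
  intro h
  have h1 := cupLeft_comp_dag_cupRight x
  rw [eq_zero_of_hermSq h, zero_comp] at h1
  exact (obj_simple x).1 h1.symm

theorem hermSq_cupRight_ne_zero (x : Irr D) : hermSq (cupRight x) ≠ 0 := by
  intro h
  have h1 := cupLeft_comp_dag_cupRight x
  rw [eq_zero_of_hermSq h, dag_zero, comp_zero] at h1
  exact (obj_simple x).1 h1.symm

theorem loopL_ne_zero (x : Irr D) : loopL x ≠ 0 := by
  rw [← hermSq_cupRight]
  exact_mod_cast hermSq_cupRight_ne_zero x

theorem loopR_ne_zero (x : Irr D) : loopR x ≠ 0 := by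
  rw [← hermSq_cupLeft]
  exact_mod_cast hermSq_cupLeft_ne_zero x

theorem hermSq_cup_mul_pos (x : Irr D) : 0 < hermSq (cupRight x) * hermSq (cupLeft x) :=
  lt_of_le_of_ne (hermSq_mul_nonneg _ _)
    (mul_ne_zero (hermSq_cupRight_ne_zero x) (hermSq_cupLeft_ne_zero x)).symm

theorem qdim_eq (x : Irr D) : qdim x = Real.sqrt (hermSq (cupRight x) * hermSq (cupLeft x)) := by
  rw [qdim, ← hermSq_cupLeft, ← hermSq_cupRight, ← Complex.ofReal_mul, Complex.ofReal_re]

theorem qdim_pos (x : Irr D) : 0 < qdim x := by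
  rw [qdim_eq]
  exact Real.sqrt_pos.mpr (hermSq_cup_mul_pos x)

theorem qdim_ne_zero (x : Irr D) : (qdim x : ℂ) ≠ 0 := by
  exact_mod_cast (qdim_pos x).ne'

theorem qdim_mul_self (x : Irr D) : (qdim x : ℂ) * qdim x = loopL x * loopR x := by
  rw [← Complex.ofReal_mul, qdim_eq, Real.mul_self_sqrt (hermSq_cup_mul_pos x).le,
    Complex.ofReal_mul, hermSq_cupLeft, hermSq_cupRight]

theorem actR_cup_ev (x : Irr D) : actR x (cup x ≫ ev (obj x)) = qdim x := by
  rw [cup, Linear.smul_comp, actR_smul, ← loopL_eq, div_mul_cancel₀ _ (loopL_ne_zero x)]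

theorem actL_coev_cap (x : Irr D) : actL x (coev (obj x) ≫ cap x) = qdim x := by
  rw [cap, Linear.comp_smul, actL_smul, ← loopR_eq, div_mul_cancel₀ _ (loopR_ne_zero x)]

/-- This is why `d_x` is the square root of the product of the loops: exactly then the rescaled
daggers satisfy the zigzag identities. -/
theorem cup_cap_scalar (x : Irr D) :
    (qdim x : ℂ) / loopL x * ((qdim x : ℂ) / loopR x) = 1 := by
  rw [div_mul_div_comm, qdim_mul_self, div_self (mul_ne_zero (loopL_ne_zero x) (loopR_ne_zero x))]

/-- The simple object `x` as a right dual of its right dual. -/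
abbrev cupPairing (x : Irr D) : ExactPairing (obj x)ᘁ (obj x) where
  coevaluation' := cup x
  evaluation' := cap x
  coevaluation_evaluation' := by
    have h := congrArg dag (ExactPairing.evaluation_coevaluation (obj x) (obj x)ᘁ)
    simp only [dag_comp, dag_whiskerLeft, dag_whiskerRight, UMFC.dag_associator,
      UMFC.dag_leftUnitor, dag_rightUnitor_inv, Category.assoc] at h
    rw [cup, cap, MonoidalLinear.whiskerLeft_smul, MonoidalLinear.smul_whiskerRight,
      Linear.smul_comp, Linear.comp_smul, Linear.comp_smul, smul_smul, cup_cap_scalar, one_smul]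
    exact h
  evaluation_coevaluation' := by
    have h := congrArg dag (ExactPairing.coevaluation_evaluation (obj x) (obj x)ᘁ)
    simp only [dag_comp, dag_whiskerLeft, dag_whiskerRight, dag_associator_inv,
      UMFC.dag_rightUnitor, dag_leftUnitor_inv, Category.assoc] at h
    rw [cup, cap, MonoidalLinear.whiskerLeft_smul, MonoidalLinear.smul_whiskerRight,
      Linear.smul_comp, Linear.comp_smul, Linear.comp_smul, smul_smul, cup_cap_scalar, one_smul]
    exact h

end Dagger

/-! ### Simplicity of duals, and mates of vertices -/

section RightDual

variable {D : Type u} [Category.{v} D] [Preadditive D] [Linear ℂ D] [MonoidalCategory D]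
  [MonoidalPreadditive D] [MonoidalLinear ℂ D] [RigidCategory D]

theorem isSimpleObj_rightDual (x : Irr D) : IsSimpleObj (obj x)ᘁ := by
  constructor
  · intro h
    apply (obj_simple x).1
    have h1 := ExactPairing.evaluation_coevaluation (obj x) (obj x)ᘁ
    have h2 : ε_ (obj x) (obj x)ᘁ = 0 := by
      rw [← Category.id_comp (ε_ (obj x) (obj x)ᘁ), ← id_whiskerRight, h]
      simp
    rw [h2] at h1
    have h3 : 𝟙 (obj x) = (λ_ (obj x)).inv ≫ ((λ_ (obj x)).hom ≫ (ρ_ (obj x)).inv) ≫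
      (ρ_ (obj x)).hom := by simp
    rw [h3, ← h1]
    simp
  · intro m
    obtain ⟨f, hf⟩ := mate_surjective (X := obj x) (Z := obj x) m
    obtain ⟨z, hz⟩ := (obj_simple x).2 f
    exact ⟨z, by rw [← hf, hz, mate_smul_id]⟩

/-- The mate of a splitting vertex with respect to `ev` and `coev`. -/
def mateR {a y z : Irr D} (f : obj z ⟶ obj a ⊗ obj y) : (obj y)ᘁ ⊗ (obj a)ᘁ ⟶ (obj z)ᘁ :=
  mate f

/-- The mate of a fusion vertex with respect to `ev` and `coev`. -/
def mateR' {a y z : Irr D} (g : obj a ⊗ obj y ⟶ obj z) : (obj z)ᘁ ⟶ (obj y)ᘁ ⊗ (obj a)ᘁ :=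
  mate g

theorem mateR_comp {a y z : Irr D} (f : obj z ⟶ obj a ⊗ obj y) (g : obj a ⊗ obj y ⟶ obj z) :
    mateR' g ≫ mateR f = scal z (f ≫ g) • 𝟙 _ := by
  refine (mate_comp_mate f g).trans ?_
  rw [scal_spec z (f ≫ g), mate_smul_id, scal_smul_id]

end RightDual

/-! ### Sphericality -/

section Spherical

variable {D : Type u} [Category.{v} D] [Preadditive D] [Linear ℂ D]
variable [HasFiniteBiproducts D] [MonoidalCategory D] [MonoidalPreadditive D]
  [MonoidalLinear ℂ D] [RigidCategory D] [UMFC D]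

open TubeAlg.UMFC (dag dag_dag dag_add dag_smul dag_id dag_comp dag_tensor)

/-- The label of the dual of a simple object. -/
def bar (x : Irr D) : Irr D :=
  Quotient.mk (simpleSetoid D) ⟨(obj x)ᘁ, isSimpleObj_rightDual x⟩

/-- The dual of a simple object is isomorphic to the chosen representative. -/
def barIso (x : Irr D) : obj (bar x) ≅ (obj x)ᘁ :=
  (Quotient.mk_out (s := simpleSetoid D) ⟨(obj x)ᘁ, isSimpleObj_rightDual x⟩).some

/-- The left partial trace over a simple object. -/
abbrev ptrL (a : Irr D) {X Y : D} (T : obj a ⊗ X ⟶ obj a ⊗ Y) : X ⟶ Y :=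
  traceL (cup a) (ev (obj a)) T

/-- The right partial trace over a simple object. -/
abbrev ptrR (b : Irr D) {X Y : D} (T : X ⊗ obj b ⟶ Y ⊗ obj b) : X ⟶ Y :=
  traceR (coev (obj b)) (cap b) T

/-- Both sides are the scalar by which the fully closed diagram acts. The vertex `f ≠ 0` ensures
that the right action on `a` and the left action on `y` agree. -/
theorem qdim_scal_ptr {a y z : Irr D} {f : obj z ⟶ obj a ⊗ obj y} (hf : f ≠ 0)
    (T : obj a ⊗ obj y ⟶ obj a ⊗ obj y) :
    qdim a * scal a (ptrR y T) = qdim y * scal y (ptrL a T) := by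
  have h := close_left_right (cup a) (ev (obj a)) (coev (obj y)) (cap y) T
  have h1 : traceR (coev (obj y)) (cap y) T = _ := scal_spec a (ptrR y T)
  have h2 : traceL (cup a) (ev (obj a)) T = _ := scal_spec y (ptrL a T)
  rw [h1, h2] at h
  simp only [MonoidalLinear.whiskerLeft_smul, MonoidalLinear.smul_whiskerRight, Linear.smul_comp,
    Linear.comp_smul, whiskerLeft_id, id_whiskerRight, Category.id_comp] at h
  have h3 := congrArg (actR a) h
  rw [actR_smul, actR_smul, actR_cup_ev, actR_eq_actL hf (coev (obj y) ≫ cap y),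
    actL_coev_cap] at h3
  linear_combination h3

/-- The mate of a splitting vertex with respect to `cup` and `cap`. -/
def mateL {a y z : Irr D} (f : obj z ⟶ obj a ⊗ obj y) : (obj y)ᘁ ⊗ (obj a)ᘁ ⟶ (obj z)ᘁ :=
  letI := cupPairing a; letI := cupPairing y; letI := cupPairing z
  mate' f

/-- The mate of a fusion vertex with respect to `cup` and `cap`. -/
def mateL' {a y z : Irr D} (g : obj a ⊗ obj y ⟶ obj z) : (obj z)ᘁ ⟶ (obj y)ᘁ ⊗ (obj a)ᘁ :=
  letI := cupPairing a; letI := cupPairing y; letI := cupPairing z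
  mate' g

section

variable {a y z : Irr D} (f : obj z ⟶ obj a ⊗ obj y) (g : obj a ⊗ obj y ⟶ obj z)

theorem mateL_comp : mateL' g ≫ mateL f = scal z (f ≫ g) • 𝟙 _ := by
  let := cupPairing a; let := cupPairing y; let := cupPairing z
  refine (mate'_comp_mate' f g).trans ?_
  rw [scal_spec z (f ≫ g), mate'_smul_id, scal_smul_id]

/-- The mates are moved around the closed strand `z`, where they become `g` and `f`; what remains is
the left closure of `g ≫ f` on `a ⊗ y`. -/
theorem close_left_eq : cup z ≫ (mateL' g ≫ mateR f) ▷ obj z ≫ ev (obj z) =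
    scal y (ptrL a (g ≫ f)) • (cup y ≫ ev (obj y)) := by
  let := cupPairing a; let := cupPairing y; let := cupPairing z
  have h1 : cup z ≫ mateL' g ▷ obj z = _ :=
    coevaluation_mate' (X' := (obj z)ᘁ) (Z' := (obj y)ᘁ ⊗ (obj a)ᘁ) g
  have h2 : mateR f ▷ obj z ≫ ev (obj z) = _ :=
    mate_evaluation (X' := (obj y)ᘁ ⊗ (obj a)ᘁ) (Z' := (obj z)ᘁ) f
  have h3 := close_pairing_left (A' := (obj a)ᘁ) (B' := (obj y)ᘁ) (g ≫ f)
  rw [comp_whiskerRight, Category.assoc, reassoc_of% h1, h2]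
  rw [MonoidalCategory.whiskerLeft_comp, Category.assoc] at h3
  refine h3.trans ?_
  change cup y ≫ (obj y)ᘁ ◁ ptrL a (g ≫ f) ≫ ev (obj y) = _
  conv_lhs => rw [scal_spec y (ptrL a (g ≫ f))]
  simp

theorem close_right_eq : coev (obj z) ≫ obj z ◁ (mateR' g ≫ mateL f) ≫ cap z =
    scal a (ptrR y (g ≫ f)) • (coev (obj a) ≫ cap a) := by
  let := cupPairing a; let := cupPairing y; let := cupPairing z
  have h1 : coev (obj z) ≫ obj z ◁ mateR' g = _ :=
    coevaluation_mate (X' := (obj z)ᘁ) (Z' := (obj y)ᘁ ⊗ (obj a)ᘁ) g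
  have h2 : obj z ◁ mateL f ≫ cap z = _ :=
    mate'_evaluation (X' := (obj y)ᘁ ⊗ (obj a)ᘁ) (Z' := (obj z)ᘁ) f
  have h3 := close_pairing_right (A' := (obj a)ᘁ) (B' := (obj y)ᘁ) (g ≫ f)
  rw [MonoidalCategory.whiskerLeft_comp, Category.assoc, reassoc_of% h1, h2]
  rw [comp_whiskerRight, Category.assoc] at h3
  refine h3.trans ?_
  change coev (obj a) ≫ ptrR y (g ≫ f) ▷ (obj a)ᘁ ≫ cap a = _
  conv_lhs => rw [scal_spec a (ptrR y (g ≫ f))]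
  simp

/-- The composite is a scalar because the dual of `z` is simple; the scalar is found by closing the
strand and letting both sides of `close_left_eq` act. -/
theorem mateL'_mateR (hf : f ≠ 0) : (qdim z : ℂ) • (mateL' g ≫ mateR f) =
    ((qdim y : ℂ) * scal y (ptrL a (g ≫ f))) • 𝟙 _ := by
  obtain ⟨w, hw⟩ := (isSimpleObj_rightDual z).2 (mateL' g ≫ mateR f)
  have h := close_left_eq f g
  rw [hw] at h ⊢
  simp only [MonoidalLinear.smul_whiskerRight, Linear.smul_comp,
    Linear.comp_smul, id_whiskerRight, Category.id_comp] at h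
  have h3 := congrArg (actR z) h
  rw [actR_smul, actR_smul, actR_cup_ev, actR_of_ne_zero hf, actR_cup_ev] at h3
  rw [smul_smul]
  congr 1
  linear_combination h3

theorem mateR'_mateL (hf : f ≠ 0) : (qdim z : ℂ) • (mateR' g ≫ mateL f) =
    ((qdim a : ℂ) * scal a (ptrR y (g ≫ f))) • 𝟙 _ := by
  obtain ⟨w, hw⟩ := (isSimpleObj_rightDual z).2 (mateR' g ≫ mateL f)
  have h := close_right_eq f g
  rw [hw] at h ⊢
  simp only [MonoidalLinear.whiskerLeft_smul, Linear.smul_comp,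
    Linear.comp_smul, whiskerLeft_id, Category.id_comp] at h
  have h3 := congrArg (actL z) h
  rw [actL_smul, actL_smul, actL_coev_cap, actL_of_ne_zero hf, actL_coev_cap] at h3
  rw [smul_smul]
  congr 1
  linear_combination h3

/-- The two scalars are the left and the right closure of the same endomorphism `g ≫ f`. -/
theorem mate_exchange : mateL' g ≫ mateR f = mateR' g ≫ mateL f := by
  by_cases hf : f = 0
  · subst hf
    simp [mateR, mateL, mate, mate', rightAdjointMate, leftAdjointMate]
  · apply smul_right_injective _ (qdim_ne_zero z)
    simp only
    rw [mateL'_mateR f g hf, mateR'_mateL f g hf, qdim_scal_ptr hf]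

/-- The partial trace of `f† f` has the sign of `f† ∘ f`. -/
theorem scal_ptrL_dag (hf : f ≠ 0) :
    ∃ t : ℝ, scal y (ptrL a (dag f ≫ f)) = t ∧ 0 ≤ t * hermSq f := by
  set v : obj y ⟶ (obj a)ᘁ ⊗ (obj a ⊗ obj y) :=
    (λ_ (obj y)).inv ≫ dag (ev (obj a)) ▷ obj y ≫ (α_ _ _ _).hom with hv
  have hdv : dag v = (α_ _ _ _).inv ≫ ev (obj a) ▷ obj y ≫ (λ_ (obj y)).hom := by
    simp only [hv, dag_comp, dag_leftUnitor_inv, dag_whiskerRight, UMFC.dag_associator, dag_dag,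
      Category.assoc]
  set w := v ≫ (obj a)ᘁ ◁ dag f with hw
  have hdw : dag w = (obj a)ᘁ ◁ f ≫ dag v := by
    rw [hw, dag_comp, dag_whiskerLeft, dag_dag]
  have h1 : ptrL a (dag f ≫ f) = ((qdim a : ℂ) / loopL a) • (w ≫ dag w) := by
    rw [hdw, hdv, hw, hv, ptrL, traceL, cup]
    simp
  have h2 : ((hermSq v : ℝ) : ℂ) = loopL a := by
    rw [← scal_comp_dag, hdv, hv, loopL_eq, actR_eq_actL hf, actL]
    simp
  -- Composing with `f` brings `w` into the Hom space of `v`, where signs can be compared. The form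
  -- at `v` is the loop value of `a`, which also occurs in the denominator of `cup`.
  have h3 : hermSq (w ≫ (obj a)ᘁ ◁ f) = hermSq f * hermSq w := by
    have : (w ≫ (obj a)ᘁ ◁ f) ≫ dag (w ≫ (obj a)ᘁ ◁ f) = (hermSq f : ℂ) • (w ≫ dag w) := by
      rw [dag_comp, dag_whiskerLeft, Category.assoc, ← MonoidalCategory.whiskerLeft_comp_assoc,
        scal_spec z (f ≫ dag f), scal_comp_dag, MonoidalLinear.whiskerLeft_smul, whiskerLeft_id,
        Linear.smul_comp, Category.id_comp, Linear.comp_smul]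
    have h4 := scal_comp_dag (w ≫ (obj a)ᘁ ◁ f)
    rw [this, map_smul, scal_comp_dag, smul_eq_mul] at h4
    exact_mod_cast h4.symm
  have h5 := hermSq_mul_nonneg v (w ≫ (obj a)ᘁ ◁ f)
  refine ⟨qdim a / hermSq v * hermSq w, ?_, ?_⟩
  · rw [h1, map_smul, scal_comp_dag, smul_eq_mul, ← h2]
    push_cast
    rfl
  · rw [h3] at h5
    have hl : hermSq v ≠ 0 := by
      intro h0
      rw [h0] at h2
      exact loopL_ne_zero a (by rw [← h2]; simp)
    have : qdim a / hermSq v * hermSq w * hermSq f =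
        qdim a / hermSq v ^ 2 * (hermSq v * (hermSq f * hermSq w)) := by
      field_simp
    rw [this]
    exact mul_nonneg (div_nonneg (qdim_pos a).le (sq_nonneg _)) h5

/-- This is the sphericality statement. The map `f ↦ f₂` with `mateR f₂ = mateL f` is an involution
by `mate_exchange`, and positivity excludes the eigenvalue `-1`. -/
theorem mateL_eq_mateR : mateL f = mateR f := by
  have hz := (isSimpleObj_rightDual z).1
  obtain ⟨f₂, hf₂⟩ : ∃ f₂ : obj z ⟶ obj a ⊗ obj y, mateR f₂ = mateL f := mate_surjective (mateL f)
  -- Test the difference against a `g` whose mate is its dagger; `mate_exchange` makes the composite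
  -- vanish.
  have hback : mateL f₂ = mateR f := by
    rw [← sub_eq_zero]
    apply dag_injective
    rw [dag_zero]
    apply UMFC.eq_zero_of_comp_dag
    rw [dag_dag]
    obtain ⟨g, hg⟩ : ∃ g : obj a ⊗ obj y ⟶ obj z, mateR' g = dag (mateL f₂ - mateR f) :=
      mate_surjective _
    rw [← hg, Preadditive.comp_sub, mateR_comp, ← mate_exchange, hf₂, mateL_comp, sub_self]
  have hR : mateR (f - f₂) = mateR f - mateL f := by
    rw [← hf₂]; exact mate_sub f f₂
  have hL : mateL (f - f₂) = mateL f - mateR f := by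
    rw [← hback]
    let := cupPairing a; let := cupPairing y; let := cupPairing z
    exact mate'_sub f f₂
  by_cases h0 : f - f₂ = 0
  · rw [h0] at hR
    have : (mateR (0 : obj z ⟶ obj a ⊗ obj y)) = 0 := by
      simp [mateR, mate, rightAdjointMate]
    rw [this] at hR
    exact (sub_eq_zero.mp hR.symm).symm
  · exfalso
    -- A nonzero difference is an eigenvector for `-1`. Pairing its mates with those of its dagger
    -- gives `-d_z * hermSq f' = d_y * t`, where `t` does not have the sign opposite to `hermSq f'`.
    set f' := f - f₂ with hf'
    have hneg : mateL f' = - mateR f' := by rw [hL, hR, neg_sub]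
    have h1 := mateL'_mateR f' (dag f') h0
    rw [mate_exchange, hneg, Preadditive.comp_neg, mateR_comp, scal_comp_dag, ← neg_smul,
      smul_smul] at h1
    have h2 := smul_left_injective ℂ hz h1
    obtain ⟨t, ht, hpos⟩ := scal_ptrL_dag f' h0
    rw [ht] at h2
    have h3 : qdim z * - hermSq f' = qdim y * t := by exact_mod_cast h2
    have h4 : hermSq f' ≠ 0 := fun h => h0 (eq_zero_of_hermSq h)
    have h5 : 0 < hermSq f' ^ 2 := by positivity
    have h6 : -(qdim z * hermSq f' ^ 2) = qdim y * (t * hermSq f') := by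
      linear_combination hermSq f' * h3
    linarith [mul_nonneg (qdim_pos y).le hpos, mul_pos (qdim_pos z) h5]

/-- With equal mates, the composite evaluated by closing in `mateL'_mateR` is also the mate of the
scalar `f ≫ g`. -/
theorem qdim_mul_scal_ptrL :
    (qdim y : ℂ) * scal y (ptrL a (g ≫ f)) = qdim z * scal z (f ≫ g) := by
  by_cases hf : f = 0
  · subst hf
    simp [traceL]
  · have h := mateL'_mateR f g hf
    rw [mate_exchange, mateL_eq_mateR, mateR_comp, smul_smul] at h
    exact (smul_left_injective ℂ (isSimpleObj_rightDual z).1 h).symm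

theorem qdim_mul_scal_ptrR :
    (qdim a : ℂ) * scal a (ptrR y (g ≫ f)) = qdim z * scal z (f ≫ g) := by
  by_cases hf : f = 0
  · subst hf
    simp [traceR]
  · rw [← qdim_mul_scal_ptrL, qdim_scal_ptr hf]

end

/-- Each summand contributes `d_y` times the left partial trace of its projector, and the projectors
add up to the identity, whose trace is the loop `d_x`. Nonvanishing of `x ⊗ y` lets that loop act on
`y` by the same scalar as on `x`. -/
theorem fusion_rule_of_decomp (x y : Irr D) (h : ¬ IsZero (obj x ⊗ obj y))
    (d : Decomp (obj x ⊗ obj y)) : ∑ r, (qdim (d.label r) : ℂ) = qdim x * qdim y := by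
  have h0 : 𝟙 (obj x ⊗ obj y) ≠ 0 := fun h0 => h ((IsZero.iff_id_eq_zero _).mpr h0)
  obtain ⟨r₀, hr₀⟩ : ∃ r, d.inj r ≠ 0 := by
    by_contra! hall
    apply h0
    rw [← d.total]
    simp [hall]
  have h1 : ∀ r, (qdim (d.label r) : ℂ) = qdim y * scal y (ptrL x (d.proj r ≫ d.inj r)) := by
    intro r
    rw [qdim_mul_scal_ptrL, d.inj_proj_self, scal_id, mul_one]
  simp only [h1]
  rw [← Finset.mul_sum, ← map_sum, ← traceL_sum, d.total]
  have h2 : ptrL x (𝟙 (obj x ⊗ obj y)) = (λ_ (obj y)).inv ≫ (cup x ≫ ev (obj x)) ▷ obj y ≫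
      (λ_ (obj y)).hom := by
    simp [traceL]
  have h3 : scal y (ptrL x (𝟙 (obj x ⊗ obj y))) = qdim x := by
    rw [h2, ← actR_cup_ev, actR_eq_actL hr₀, actL]
  rw [h3, mul_comm]

open Classical in
/-- Coordinates of the morphisms out of a simple object with respect to a decomposition. -/
def Decomp.homEquiv {X : D} (d : Decomp X) (z : Irr D) :
    (obj z ⟶ X) ≃ₗ[ℂ] ({r // d.label r = z} → ℂ) where
  toFun f r := scal z (f ≫ d.proj r ≫ delta (d.label r) z)
  map_add' f g := by ext; simp
  map_smul' w f := by ext; simp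
  invFun c := ∑ r, if h : d.label r = z then c ⟨r, h⟩ • (delta z (d.label r) ≫ d.inj r) else 0
  left_inv f := by
    conv_rhs => rw [← d.comp_sum f]
    refine Finset.sum_congr rfl fun r _ => ?_
    split_ifs with h
    · subst h
      simp only [delta_self, Category.comp_id, Category.id_comp]
      rw [← scal_comp]
    · rw [hom_eq_zero (Ne.symm h) (f ≫ d.proj r), zero_comp]
  right_inv c := by
    funext ⟨r, hr⟩
    subst hr
    simp only [Preadditive.sum_comp]
    rw [Finset.sum_eq_single r]
    · simp [d.inj_proj_self]
    · intro s _ hs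
      split_ifs with h
      · rw [Linear.smul_comp, Category.assoc, reassoc_of% d.inj_proj_ne s r hs]
        simp
      · simp
    · simp

theorem fusion_rule (x y : Irr D) (h : ¬ IsZero (obj x ⊗ obj y)) :
    ∑ z, (mult x y z : ℝ) * qdim z = qdim x * qdim y := by
  classical
  have h1 := fusion_rule_of_decomp x y h (decomp _)
  have h2 : ∀ z, mult x y z = Fintype.card {r // (decomp (obj x ⊗ obj y)).label r = z} := by
    intro z
    rw [mult, LinearEquiv.finrank_eq ((decomp (obj x ⊗ obj y)).homEquiv z),
      Module.finrank_fintype_fun_eq_card]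
  have h3 : ∑ r, qdim ((decomp (obj x ⊗ obj y)).label r) = qdim x * qdim y := by exact_mod_cast h1
  rw [← h3, ← Finset.sum_fiberwise' Finset.univ (decomp (obj x ⊗ obj y)).label qdim]
  refine Finset.sum_congr rfl fun z _ => ?_
  rw [Finset.sum_const, h2, Fintype.card_subtype, nsmul_eq_mul]

end Spherical

/-! ### Bending -/

section Bending

variable {D : Type u} [Category.{v} D] [Preadditive D] [Linear ℂ D]
variable [HasFiniteBiproducts D] [MonoidalCategory D] [MonoidalPreadditive D]
  [MonoidalLinear ℂ D] [RigidCategory D] [UMFC D]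

theorem bendUpper_eq (a b f h : Irr D) (q : Upper (obj a) (obj b) f h) :
    bendUpper a b f h q =
      arcUnit (cup a) (coev (obj b)) (obj f) ≫ wrap (obj a)ᘁ (obj b)ᘁ q := by
  simp only [arcUnit, trivialArcs, Iso.trans_inv, Category.assoc]
  rfl

theorem bendLower_eq (a b c e : Irr D) (p : Lower (obj a) (obj b) c e) :
    bendLower a b c e p =
      wrap (obj a)ᘁ (obj b)ᘁ p ≫ arcCounit (ev (obj a)) (cap b) (obj e) :=
  rfl

/-- The inverse of `bendLower`. -/
def unbend (a b c e : Irr D) (w : Upper (obj a)ᘁ (obj b)ᘁ c e) : Lower (obj a) (obj b) c e :=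
  arcUnit (coev (obj a)) (cup b) (obj c) ≫ wrap (obj a) (obj b) w

theorem unbend_bendLower (a b c e : Irr D) (p : Lower (obj a) (obj b) c e) :
    unbend a b c e (bendLower a b c e p) = p := by
  rw [unbend, bendLower_eq, wrap_comp, reassoc_of% @arcUnit_natural, arcUnit_wrap_arcCounit,
    Category.comp_id]
  · exact ExactPairing.evaluation_coevaluation (obj a) (obj a)ᘁ
  · exact (cupPairing b).coevaluation_evaluation'

theorem bendLower_unbend (a b c e : Irr D) (w : Upper (obj a)ᘁ (obj b)ᘁ c e) :
    bendLower a b c e (unbend a b c e w) = w := by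
  rw [unbend, bendLower_eq, wrap_comp, Category.assoc, arcCounit_natural,
    reassoc_of% @wrap_arcUnit_arcCounit]
  · exact ExactPairing.coevaluation_evaluation (obj a) (obj a)ᘁ
  · exact (cupPairing b).evaluation_coevaluation'

theorem wrap_bendUpper_arcCounit (a b f h : Irr D) (q : Upper (obj a) (obj b) f h) :
    wrap (obj a) (obj b) (bendUpper a b f h q) ≫ arcCounit (cap a) (ev (obj b)) (obj h) = q := by
  rw [bendUpper_eq, wrap_comp, Category.assoc, arcCounit_natural,
    reassoc_of% @wrap_arcUnit_arcCounit]
  · exact (cupPairing a).coevaluation_evaluation'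
  · exact ExactPairing.evaluation_coevaluation (obj b) (obj b)ᘁ

/-- Gluing the bent halves surrounds `g ≫ f` with closed arcs, which is the iterated partial trace.
-/
theorem bendUpper_comp_bendLower (a b i k : Irr D) (f : Lower (obj a) (obj b) k i)
    (g : Upper (obj a) (obj b) i k) :
    bendUpper a b i k g ≫ bendLower a b k i f = ptrL a (ptrR b (g ≫ f)) := by
  rw [bendUpper_eq, bendLower_eq]
  refine Eq.trans ?_ (traceL_traceR ..)
  simp only [wrap_comp, Category.assoc]

/-- The two ways of closing `f` with `g` agree. -/
theorem qdim_mul_scal_bend (a b i k : Irr D) (f : Lower (obj a) (obj b) k i)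
    (g : Upper (obj a) (obj b) i k) :
    (qdim i : ℂ) * scal i (bendUpper a b i k g ≫ bendLower a b k i f) =
      qdim k * scal k (f ≫ g) := by
  rw [bendUpper_comp_bendLower]
  set T := ptrR b (g ≫ f) with hT
  set d := decomp (obj a ⊗ obj i) with hd
  -- The trace over `a` applies to vertices through a simple object, so `a ⊗ i` is decomposed; the
  -- right trace formula is then used on each summand.
  have h1 : ∀ r, (qdim i : ℂ) * scal i (ptrL a ((T ≫ d.proj r) ≫ d.inj r)) =
      qdim k * scal k (f ≫ (d.proj r ≫ d.inj r) ▷ obj b ≫ g) := by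
    intro r
    rw [qdim_mul_scal_ptrL, hT, ← traceR_natural]
    have := qdim_mul_scal_ptrR (f ≫ d.proj r ▷ obj b) (d.inj r ▷ obj b ≫ g)
    simp only [Category.assoc] at this ⊢
    rw [this]
    simp
  calc (qdim i : ℂ) * scal i (ptrL a T)
      = ∑ r, (qdim i : ℂ) * scal i (ptrL a ((T ≫ d.proj r) ≫ d.inj r)) := by
        rw [← Finset.mul_sum, ← map_sum, ← traceL_sum, d.comp_sum]
    _ = qdim k * scal k (f ≫ g) := by
        simp only [h1]
        rw [← Finset.mul_sum, ← map_sum, ← Preadditive.comp_sum, ← Preadditive.sum_comp,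
          ← sum_whiskerRight, d.total, id_whiskerRight, Category.id_comp]

theorem sum_delta_comp_delta (x : Irr D) : ∑ i, delta x i ≫ delta i x = 𝟙 (obj x) := by
  rw [Finset.sum_eq_single x]
  · simp
  · intro i _ hi
    rw [delta_ne hi, comp_zero]
  · simp

theorem comp_delta_comp_delta {i x : Irr D} (f : obj i ⟶ obj x) :
    (f ≫ delta x i) ≫ delta i x = f := by
  by_cases h : i = x
  · subst h; simp
  · rw [hom_eq_zero h f]; simp

/-- Expand `bendUpper g` in the decomposition of `aᘁ ⊗ k ⊗ bᘁ`. Its coefficients are pairings with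
unbent projections, computed in `Hom(k, k)` up to the factor `d_i / d_k` of `qdim_mul_scal_bend`;
terms with `k' ≠ k` vanish by Schur's lemma. -/
theorem sum_scal_smul_wrap (a b i k : Irr D) (g : Upper (obj a) (obj b) i k)
    (d : ∀ k : Irr D, Decomp (((obj a)ᘁ ⊗ obj k) ⊗ (obj b)ᘁ)) :
    ∑ k', ∑ s, (delta i ((d k').label s) ≫ (d k').inj s) ≫ wrap (obj a)ᘁ (obj b)ᘁ
      (unbend a b k' i ((d k').proj s ≫ delta ((d k').label s) i) ≫ g) =
      ((qdim i : ℂ) / qdim k) • bendUpper a b i k g := by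
  rw [Finset.sum_eq_single k]
  · have h1 : ∀ s, (delta i ((d k).label s) ≫ (d k).inj s) ≫ wrap (obj a)ᘁ (obj b)ᘁ
        (unbend a b k i ((d k).proj s ≫ delta ((d k).label s) i) ≫ g) =
        ((qdim i : ℂ) / qdim k) • ((bendUpper a b i k g ≫ (d k).proj s) ≫ (d k).inj s) := by
      intro s
      set θ := unbend a b k i ((d k).proj s ≫ delta ((d k).label s) i) ≫ g with hθ
      have h2 := qdim_mul_scal_bend a b i k
        (unbend a b k i ((d k).proj s ≫ delta ((d k).label s) i)) g
      rw [bendLower_unbend, ← hθ] at h2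
      have h3 : scal k θ = (qdim i : ℂ) / qdim k * scal i (bendUpper a b i k g ≫ (d k).proj s ≫
          delta ((d k).label s) i) := by
        rw [div_mul_eq_mul_div, eq_div_iff (qdim_ne_zero k), h2, mul_comm]
      rw [scal_spec k θ, wrap_smul, wrap_id, Linear.comp_smul, Category.comp_id, h3, mul_smul,
        ← scal_comp, ← Category.assoc _ _ (delta _ i), ← Category.assoc (_ ≫ delta _ i) (delta i _),
        comp_delta_comp_delta]
    simp only [h1]
    rw [← Finset.smul_sum, (d k).comp_sum]
  · intro k' _ hk'
    refine Finset.sum_eq_zero fun s _ => ?_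
    rw [hom_eq_zero hk' (_ ≫ g), wrap_zero, comp_zero]
  · simp

/-- By Schur's lemma a morphism of the strand `k` may be moved around from one end of it to the
other. -/
theorem end_slide {M : Type*} [AddCommMonoid M] [Module ℂ M] {A B A' B' : D}
    (Y : ∀ k : Irr D, (obj k ⟶ (A ⊗ ((A' ⊗ obj k) ⊗ B')) ⊗ B) →ₗ[ℂ] M) {k k' : Irr D}
    (θ : obj k ⟶ obj k') (w : obj k' ⟶ (A ⊗ ((A' ⊗ obj k) ⊗ B')) ⊗ B) :
    Y k (θ ≫ w) = Y k' (w ≫ wrap A B (wrap A' B' θ)) := by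
  by_cases h : k = k'
  · subst h
    rw [scal_comp, scal_spec k θ]
    simp [wrap_smul]
  · simp [hom_eq_zero h θ]

/-- Bending carries the canonical element of `a ⊗ i ⊗ b` to that of `aᘁ ⊗ k ⊗ bᘁ`, up to the ratio
of dimensions; summing the latter over `i` recreates the arcs around `k`. The proof expands the
right side through both decompositions and slides the coefficient along `k`. -/
theorem sum_bend {M : Type*} [AddCommMonoid M] [Module ℂ M] (a b : Irr D)
    (Y : ∀ k : Irr D, (obj k ⟶ (obj a ⊗ (((obj a)ᘁ ⊗ obj k) ⊗ (obj b)ᘁ)) ⊗ obj b) →ₗ[ℂ] M)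
    (d : ∀ i : Irr D, Decomp ((obj a ⊗ obj i) ⊗ obj b)) :
    ∑ i, ∑ r, ((qdim i : ℂ) / qdim ((d i).label r)) • Y ((d i).label r)
      ((d i).inj r ≫ wrap (obj a) (obj b) (bendUpper a b i _ ((d i).proj r))) =
    ∑ k, Y k (arcUnit (coev (obj a)) (cup b) (obj k)) := by
  let d' : ∀ k : Irr D, Decomp (((obj a)ᘁ ⊗ obj k) ⊗ (obj b)ᘁ) := fun k => decomp _
  have h1 : ∀ k, arcUnit (coev (obj a)) (cup b) (obj k) = ∑ i, ∑ s,
      unbend a b k i ((d' k).proj s ≫ delta ((d' k).label s) i) ≫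
        wrap (obj a) (obj b) (delta i ((d' k).label s) ≫ (d' k).inj s) := by
    intro k
    simp only [unbend, Category.assoc, ← wrap_comp, ← Preadditive.comp_sum, ← wrap_sum]
    rw [Finset.sum_comm]
    have : ∀ s, ∑ i, (d' k).proj s ≫ delta ((d' k).label s) i ≫ delta i ((d' k).label s) ≫
        (d' k).inj s = (d' k).proj s ≫ (d' k).inj s := by
      intro s
      simp only [← Category.assoc (delta _ _) (delta _ _)]
      rw [← Preadditive.comp_sum, ← Preadditive.sum_comp, sum_delta_comp_delta, Category.id_comp]
    simp only [this, (d' k).total, wrap_id, Category.comp_id]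
  have h2 : ∀ k i s, Y k (unbend a b k i ((d' k).proj s ≫ delta ((d' k).label s) i) ≫
        wrap (obj a) (obj b) (delta i ((d' k).label s) ≫ (d' k).inj s)) =
      ∑ r, Y ((d i).label r) ((d i).inj r ≫ wrap (obj a) (obj b)
        ((delta i ((d' k).label s) ≫ (d' k).inj s) ≫ wrap (obj a)ᘁ (obj b)ᘁ
      (unbend a b k i ((d' k).proj s ≫ delta ((d' k).label s) i) ≫ (d i).proj r))) := by
    intro k i s
    conv_lhs => rw [← (d i).comp_sum (unbend a b k i ((d' k).proj s ≫ delta ((d' k).label s) i))]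
    rw [Preadditive.sum_comp, map_sum]
    refine Finset.sum_congr rfl fun r _ => ?_
    rw [Category.assoc, end_slide Y, wrap_comp _ _ (delta i _ ≫ _), Category.assoc]
  simp only [h1, map_sum, h2]
  rw [Finset.sum_comm]
  refine Finset.sum_congr rfl fun i _ => ?_
  rw [Finset.sum_congr rfl fun k _ => Finset.sum_comm, Finset.sum_comm]
  refine Finset.sum_congr rfl fun r _ => ?_
  rw [← map_smul, ← Linear.comp_smul, ← wrap_smul, ← sum_scal_smul_wrap a b i _ _ d']
  simp only [← map_sum, ← Preadditive.comp_sum, ← wrap_sum]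

end Bending

/-! ### The antipode -/

section Antipode

variable {D : Type u} [Category.{v} D] [Preadditive D] [Linear ℂ D]
variable [HasFiniteBiproducts D] [MonoidalCategory D] [MonoidalPreadditive D]
  [MonoidalLinear ℂ D] [RigidCategory D] [UMFC D]

theorem tube_induction_simple {P : Tube D → Prop} (zero : P 0)
    (add : ∀ x y, P x → P y → P (x + y))
    (h : ∀ (a b c e f h : Irr D) (p : Lower (obj a) (obj b) c e) (q : Upper (obj a) (obj b) f h),
      P (resolve (obj a) (obj b) c e f h p q)) (x : Tube D) : P x := by
  induction x using tube_induction with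
  | zero => exact zero
  | add x y hx hy => exact add x y hx hy
  | h A B c e f h' p q =>
    rw [resolve_apply]
    refine Finset.sum_induction _ P add zero fun r _ =>
      Finset.sum_induction _ P add zero fun s _ => ?_
    rw [← resolve_obj]
    exact h ..

theorem antipode_resolve (a b c e f h : Irr D)
    (p : Lower (obj a) (obj b) c e) (q : Upper (obj a) (obj b) f h) :
    antipode (resolve (obj a) (obj b) c e f h p q) = ((qdim f : ℂ) / (qdim h : ℂ)) •
      resolve (obj a)ᘁ (obj b)ᘁ f h c e (bendUpper a b f h q) (bendLower a b c e p) := by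
  rw [resolve_obj, antipode_dbl]

/-- Of the terms of `Δ(1)` only those with first leg `lines h c` act nontrivially, so the counital
map sees the diagram only through its counit and outer labels. -/
theorem counitalL_resolve (A B : D) (c e f h : Irr D) (p : Lower A B c e) (q : Upper A B f h) :
    counitalL mul one comul counit (resolve A B c e f h p q) =
      ∑ y, counit (resolve A B c e f h p q) • lines c y := by
  rw [counitalL, comul_one_eq]
  simp only [map_sum, TensorProduct.map_tmul, TensorProduct.lid_tmul, LinearMap.id_apply,
    LinearMap.comp_apply, LinearMap.flip_apply]
  rw [Finset.sum_eq_single h]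
  · refine Finset.sum_congr rfl fun y _ => ?_
    rw [Finset.sum_eq_single c, lines_mul]
    · intro i _ hi
      rw [lines_mul_ne _ _ _ _ _ _ _ _ _ _ fun h => hi h.2, map_zero, zero_smul]
    · simp
  · intro x _ hx
    refine Finset.sum_eq_zero fun y _ => Finset.sum_eq_zero fun i _ => ?_
    rw [lines_mul_ne _ _ _ _ _ _ _ _ _ _ fun h => hx h.1, map_zero, zero_smul]
  · simp

theorem counitalR_resolve (A B : D) (c e f h : Irr D) (p : Lower A B c e) (q : Upper A B f h) :
    counitalR mul one comul counit (resolve A B c e f h p q) =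
      ∑ x, counit (resolve A B c e f h p q) • lines x f := by
  rw [counitalR, comul_one_eq]
  simp only [map_sum, TensorProduct.map_tmul, TensorProduct.rid_tmul, LinearMap.id_apply,
    LinearMap.comp_apply]
  refine Finset.sum_congr rfl fun x _ => ?_
  rw [Finset.sum_eq_single e]
  · rw [Finset.sum_eq_single f, mul_lines]
    · intro i _ hi
      rw [mul_lines_ne _ _ _ _ _ _ _ _ _ _ fun h => hi h.1, map_zero, zero_smul]
    · simp
  · intro y _ hy
    refine Finset.sum_eq_zero fun i _ => ?_
    rw [mul_lines_ne _ _ _ _ _ _ _ _ _ _ fun h => hy h.2, map_zero, zero_smul]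
  · simp

/-- The factor `d_i / d_k` of the antipode varies with the wall and is the one absorbed by
`sum_bend`. The created arcs slide to the upper half, where they straighten the bent `p`; the
resulting endomorphism of `c` is the counit. -/
theorem mul_antipode' (x : Tube D) :
    TensorProduct.lift mul (TensorProduct.map LinearMap.id antipode (comul x)) =
      counitalL mul one comul counit x := by
  induction x using tube_induction_simple with
  | zero => simp [counitalL]
  | add x y hx hy =>
    rw [map_add, map_add, map_add, hx, hy]
    simp [counitalL, TensorProduct.map_add_left, LinearMap.comp_add]
  | h a b c e f h p q =>
    rw [counitalL_resolve, comul_resolve _ _ _ _ _ _ _ _ fun i => decomp _]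
    simp only [map_sum, comulTerm_apply, TensorProduct.map_tmul, LinearMap.id_apply,
      TensorProduct.lift.tmul, antipode_resolve, map_smul, mul_resolve, delta_self,
      Category.id_comp]
    set Q := (nest (obj a) (obj a)ᘁ (obj c) (obj b)ᘁ (obj b)).inv ≫
      wrap (obj a) (obj b) (bendLower a b c e p ≫ delta e f) ≫ q with hQ
    have h1 := sum_bend a b (fun k => (resolve _ _ k k c h).flip Q ∘ₗ
      Linear.rightComp ℂ (obj k) (nest (obj a) (obj a)ᘁ (obj k) (obj b)ᘁ (obj b)).hom)
      (fun i => decomp _)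
    simp only [LinearMap.comp_apply, LinearMap.flip_apply, Linear.rightComp_apply,
      Category.assoc] at h1
    refine h1.trans ?_
    refine Finset.sum_congr rfl fun k _ => ?_
    have h2 : arcUnit (coev (obj a)) (cup b) (obj k) ≫
        (nest (obj a) (obj a)ᘁ (obj k) (obj b)ᘁ (obj b)).hom =
        (trivialArcs (obj k)).inv ≫ arc (coev (obj a)) (cup b) _ := by
      simp [arcUnit]
    -- Unbending undoes the bend inside `Q`, leaving the counit diagram with a trivial pair of arcs.
    have h3 : arc (coev (obj a)) (cup b) _ ≫ Q =
        (trivialArcs (obj c)).hom ≫ p ≫ wrap (obj a) (obj b) (delta e f) ≫ q := by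
      have := unbend_bendLower a b c e p
      rw [unbend, arcUnit, Category.assoc, Category.assoc, Iso.inv_comp_eq] at this
      rw [hQ, wrap_comp, Category.assoc, reassoc_of% this]
    rw [h2, resolve_slide, h3, counit_resolve]
    by_cases hc : c = h
    · subst hc
      rw [delta_self, Category.comp_id, comp_scal c (p ≫ _), map_smul, lines_eq]
    · rw [hom_eq_zero hc (p ≫ _), delta_ne (Ne.symm hc)]
      simp

/-- In contrast to the other side, the factor `d_f / d_h` is the same for every wall, so the wall
sums directly to the identity. It is needed at the end, to turn the closed diagram around `f` into
the one around `h`. -/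
theorem antipode_mul' (x : Tube D) :
    TensorProduct.lift mul (TensorProduct.map antipode LinearMap.id (comul x)) =
      counitalR mul one comul counit x := by
  induction x using tube_induction_simple with
  | zero => simp [counitalR, TensorProduct.map_zero_right]
  | add x y hx hy =>
    rw [map_add, map_add, map_add, hx, hy]
    simp [counitalR, TensorProduct.map_add_right, LinearMap.comp_add]
  | h a b c e f h p q =>
    rw [counitalR_resolve, comul_resolve _ _ _ _ _ _ _ _ fun i => decomp _]
    simp only [map_sum, comulTerm_apply, TensorProduct.map_tmul, LinearMap.id_apply,
      TensorProduct.lift.tmul, antipode_resolve, map_smul, LinearMap.smul_apply, mul_resolve,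
      delta_self, Category.comp_id]
    refine Finset.sum_congr rfl fun i _ => ?_
    set P := bendUpper a b f h q ≫ wrap (obj a)ᘁ (obj b)ᘁ (delta h c ≫ p) ≫
      (nest (obj a)ᘁ (obj a) (obj e) (obj b) (obj b)ᘁ).hom with hP
    set d := decomp ((obj a ⊗ obj i) ⊗ obj b) with hd
    -- The two halves of the wall meet and leave a cap on each side.
    have h1 : ∑ r, (nest (obj a)ᘁ (obj a) (obj i) (obj b) (obj b)ᘁ).inv ≫
        wrap (obj a)ᘁ (obj b)ᘁ (d.proj r) ≫ bendLower a b _ i (d.inj r) =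
        arc (ev (obj a)) (cap b) _ ≫ (trivialArcs (obj i)).hom := by
      simp only [bendLower_eq, ← reassoc_of% @wrap_comp, ← Preadditive.comp_sum,
        ← Preadditive.sum_comp, ← wrap_sum, d.total, wrap_id, Category.id_comp]
      simp [arcCounit]
    rw [← Finset.smul_sum, ← map_sum, h1, ← resolve_slide]
    have h2 : P ≫ arc (ev (obj a)) (cap b) _ =
        (bendUpper a b f h q ≫ bendLower a b h e (delta h c ≫ p)) ≫ (trivialArcs (obj e)).inv := by
      rw [bendLower_eq, hP, arcCounit]
      simp
    rw [h2, counit_resolve]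
    by_cases hf : f = e
    · subst hf
      by_cases hc : h = c
      · subst hc
        have h3 := qdim_mul_scal_bend a b f h p q
        rw [scal_comp f (bendUpper a b f h q ≫ _)]
        simp only [delta_self, Category.id_comp, wrap_id, Category.comp_id, map_smul,
          LinearMap.smul_apply, smul_smul]
        rw [lines_eq, div_mul_eq_mul_div, h3, mul_div_cancel_left₀ _ (qdim_ne_zero h)]
      · simp [delta_ne hc]
    · rw [hom_eq_zero hf (bendUpper a b f h q ≫ _), delta_ne (Ne.symm hf)]
      simp

/-- Replacing `S(x₍₁₎) x₍₂₎` by the right counital map leaves `lines`, which act as units on the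
remaining factor; what is left is the antipode of the counit law. -/
theorem antipode_mul_antipode' (x : Tube D) :
    TensorProduct.lift mul (TensorProduct.map (TensorProduct.lift mul) LinearMap.id
      (TensorProduct.map (TensorProduct.map antipode LinearMap.id) antipode
        (TensorProduct.map comul LinearMap.id (comul x)))) = antipode x := by
  induction x using tube_induction_simple with
  | zero => simp only [map_zero]
  | add x y hx hy => simp only [map_add, hx, hy]
  | h a b c e f h p q =>
    conv_rhs => rw [← counit_comul' (resolve (obj a) (obj b) c e f h p q)]
    rw [comul_resolve _ _ _ _ _ _ _ _ fun i => decomp _]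
    simp only [map_sum, comulTerm_apply, TensorProduct.map_tmul, LinearMap.id_apply,
      TensorProduct.lift.tmul, TensorProduct.lid_tmul, map_smul, antipode_mul', counitalR_resolve,
      LinearMap.sum_apply, LinearMap.smul_apply]
    refine Finset.sum_congr rfl fun i _ => Finset.sum_congr rfl fun r _ => ?_
    rw [← Finset.smul_sum]
    by_cases hi : i = f
    · subst hi
      congr 1
      rw [antipode_resolve]
      simp only [map_smul, ← Finset.smul_sum]
      congr 1
      rw [Finset.sum_eq_single e, lines_mul]
      · intro x _ hx
        exact lines_mul_ne _ _ _ _ _ _ _ _ _ _ fun h => hx h.1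
      · simp
    · rw [counit_resolve, delta_ne hi]
      simp

theorem isWeakHopfAlgebra : IsWeakHopfAlgebra (mul (D := D)) one comul counit antipode where
  toIsWeakBialgebra := isWeakBialgebra
  mul_antipode := mul_antipode'
  antipode_mul := antipode_mul'
  antipode_mul_antipode := antipode_mul_antipode'

end Antipode

/-! ### The square of the antipode -/

section ArcUnitArc

variable {D : Type u} [Category.{v} D] [MonoidalCategory D]

theorem arcUnit_wrap_arc {A A₁ A' B B₁ B' : D} (s : 𝟙_ D ⟶ A' ⊗ A) (t : 𝟙_ D ⟶ B ⊗ B')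
    (u : A ⟶ A₁) (w : B ⟶ B₁) (X : D) :
    arcUnit s t X ≫ wrap A' B' (arc u w X) = arcUnit (s ≫ A' ◁ u) (t ≫ w ▷ B') X := by
  simp only [arcUnit, Category.assoc, nest_inv_wrap_arc, arc_comp]

theorem arcUnit_arc {A A' A₁ B B' B₁ : D} (s : 𝟙_ D ⟶ A' ⊗ A) (t : 𝟙_ D ⟶ B ⊗ B')
    (u : A' ⟶ A₁) (w : B' ⟶ B₁) (X : D) :
    arcUnit s t X ≫ arc u w _ = arcUnit (s ≫ u ▷ A) (t ≫ B ◁ w) X := by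
  simp only [arcUnit, Category.assoc, nest_inv_arc, arc_comp]

theorem wrap_arc_arcCounit {A A₁ A' B B₁ B' : D} (s : A' ⊗ A ⟶ 𝟙_ D) (t : B ⊗ B' ⟶ 𝟙_ D)
    (u : A₁ ⟶ A) (w : B₁ ⟶ B) (X : D) :
    wrap A' B' (arc u w X) ≫ arcCounit s t X = arcCounit (A' ◁ u ≫ s) (w ▷ B' ≫ t) X := by
  simp only [arcCounit, reassoc_of% @wrap_arc_nest, arc_comp, Category.assoc]

theorem arc_arcCounit {A A' A₁ B B' B₁ : D} (s : A' ⊗ A ⟶ 𝟙_ D) (t : B ⊗ B' ⟶ 𝟙_ D)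
    (u : A₁ ⟶ A') (w : B₁ ⟶ B') (X : D) :
    arc u w _ ≫ arcCounit s t X = arcCounit (u ▷ A ≫ s) (B ◁ w ≫ t) X := by
  simp only [arcCounit, reassoc_of% @arc_nest, arc_comp, Category.assoc]

end ArcUnitArc

/-! ### The action of `End(𝟙)` on dual labels -/

section TensorDual

variable {D : Type u} [Category.{v} D] [Preadditive D] [Linear ℂ D] [MonoidalCategory D]
  [MonoidalPreadditive D] [RigidCategory D]

theorem id_rightDual_tensor_ne_zero (x : Irr D) : 𝟙 ((obj x)ᘁ ⊗ obj x) ≠ 0 := by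
  intro h
  have h1 := ExactPairing.evaluation_coevaluation (obj x) (obj x)ᘁ
  have h2 : ε_ (obj x) (obj x)ᘁ = 0 := by
    rw [← Category.id_comp (ε_ (obj x) (obj x)ᘁ), h, zero_comp]
  rw [h2] at h1
  apply (obj_simple x).1
  have h3 : 𝟙 (obj x) = (λ_ (obj x)).inv ≫ ((λ_ (obj x)).hom ≫ (ρ_ (obj x)).inv) ≫
    (ρ_ (obj x)).hom := by simp
  rw [h3, ← h1]
  simp

theorem id_tensor_rightDual_ne_zero (x : Irr D) : 𝟙 (obj x ⊗ (obj x)ᘁ) ≠ 0 := by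
  intro h
  have h1 := ExactPairing.evaluation_coevaluation (obj x) (obj x)ᘁ
  have h2 : η_ (obj x) (obj x)ᘁ = 0 := by
    rw [← Category.comp_id (η_ (obj x) (obj x)ᘁ), h, comp_zero]
  rw [h2] at h1
  apply (obj_simple x).1
  have h3 : 𝟙 (obj x) = (λ_ (obj x)).inv ≫ ((λ_ (obj x)).hom ≫ (ρ_ (obj x)).inv) ≫
    (ρ_ (obj x)).hom := by simp
  rw [h3, ← h1]
  simp

variable [MonoidalLinear ℂ D]

/-- The product `xᘁ ⊗ x` is nonzero since its evaluation is, so an endomorphism of `𝟙` acts on both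
factors by one scalar. -/
theorem actR_bar (x : Irr D) (e : 𝟙_ D ⟶ 𝟙_ D) : actR (bar x) e = actL x e := by
  refine actR_eq_actL_of_id_ne_zero (fun h => id_rightDual_tensor_ne_zero x ?_) e
  have : 𝟙 ((obj x)ᘁ ⊗ obj x) = (barIso x).inv ▷ obj x ≫ 𝟙 _ ≫ (barIso x).hom ▷ obj x := by
    simp [← comp_whiskerRight]
  rw [this, h]
  simp

theorem actL_bar (x : Irr D) (e : 𝟙_ D ⟶ 𝟙_ D) : actL (bar x) e = actR x e := by
  refine (actR_eq_actL_of_id_ne_zero (fun h => id_tensor_rightDual_ne_zero x ?_) e).symm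
  have : 𝟙 (obj x ⊗ (obj x)ᘁ) = obj x ◁ (barIso x).inv ≫ 𝟙 _ ≫ obj x ◁ (barIso x).hom := by
    simp [← MonoidalCategory.whiskerLeft_comp]
  rw [this, h]
  simp

end TensorDual

section SquareAntipode

variable {D : Type u} [Category.{v} D] [Preadditive D] [Linear ℂ D]
variable [HasFiniteBiproducts D] [MonoidalCategory D] [MonoidalPreadditive D]
  [MonoidalLinear ℂ D] [RigidCategory D] [UMFC D]

/-- The dual of `bar x` is `x`, compatibly with the four duality maps. -/
theorem exists_iso_rightDual_bar (x : Irr D) : ∃ ψ : (obj (bar x))ᘁ ≅ obj x,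
    cup (bar x) ≫ (obj (bar x))ᘁ ◁ (barIso x).hom = coev (obj x) ≫ ψ.inv ▷ (obj x)ᘁ ∧
    coev (obj (bar x)) ≫ (barIso x).hom ▷ (obj (bar x))ᘁ = cup x ≫ (obj x)ᘁ ◁ ψ.inv ∧
    (obj (bar x))ᘁ ◁ (barIso x).inv ≫ ev (obj (bar x)) = ψ.hom ▷ (obj x)ᘁ ≫ cap x ∧
    (barIso x).inv ▷ (obj (bar x))ᘁ ≫ cap (bar x) = (obj x)ᘁ ◁ ψ.hom ≫ ev (obj x) := by
  let := cupPairing x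
  let := cupPairing (bar x)
  set i := barIso x
  let ψ : (obj (bar x))ᘁ ⟶ obj x := mate i.inv
  let ψ' : obj x ⟶ (obj (bar x))ᘁ := mate i.hom
  let χ : (obj (bar x))ᘁ ⟶ obj x := mate' i.inv
  let χ' : obj x ⟶ (obj (bar x))ᘁ := mate' i.hom
  have h1 : coev (obj x) ≫ χ' ▷ (obj x)ᘁ = cup (bar x) ≫ (obj (bar x))ᘁ ◁ i.hom :=
    coevaluation_mate' (X := (obj x)ᘁ) i.hom
  have h2 : cup x ≫ (obj x)ᘁ ◁ ψ' = coev (obj (bar x)) ≫ i.hom ▷ (obj (bar x))ᘁ :=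
    coevaluation_mate (X := (obj x)ᘁ) (X' := obj x) (Z' := (obj (bar x))ᘁ) i.hom
  have h3 : ψ ▷ (obj x)ᘁ ≫ cap x = (obj (bar x))ᘁ ◁ i.inv ≫ ev (obj (bar x)) :=
    mate_evaluation (Z := (obj x)ᘁ) (Z' := obj x) (X' := (obj (bar x))ᘁ) i.inv
  have h4 : (obj x)ᘁ ◁ χ ≫ ev (obj x) = i.inv ▷ (obj (bar x))ᘁ ≫ cap (bar x) :=
    mate'_evaluation (Z := (obj x)ᘁ) i.inv
  have hψψ' : ψ ≫ ψ' = 𝟙 _ := by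
    refine (mate_comp_mate i.hom i.inv).trans ?_
    rw [i.hom_inv_id]
    exact @rightAdjointMate_id D _ _ (obj (bar x)) ⟨(obj (bar x))ᘁ⟩
  have hψ'ψ : ψ' ≫ ψ = 𝟙 _ := by
    refine (mate_comp_mate i.inv i.hom).trans ?_
    rw [i.inv_hom_id]
    exact @rightAdjointMate_id D _ _ (obj x)ᘁ ⟨obj x⟩
  have hχ'χ : χ' ≫ χ = 𝟙 _ := by
    refine (mate'_comp_mate' i.inv i.hom).trans ?_
    rw [i.inv_hom_id]
    exact @leftAdjointMate_id D _ _ (obj x)ᘁ ⟨obj x⟩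
  -- The two candidates for the identification differ by a scalar, which is the ratio of the loop of
  -- `bar x` to that of `x`; the loop on the other side gives the same ratio for the inverse scalar.
  have hk : scal x (χ' ≫ ψ) * qdim x = qdim (bar x) := by
    rw [← actR_cup_ev (bar x), actR_bar, ← actL_coev_cap x, ← actL_smul]
    congr 1
    calc scal x (χ' ≫ ψ) • (coev (obj x) ≫ cap x)
        = coev (obj x) ≫ (χ' ≫ ψ) ▷ (obj x)ᘁ ≫ cap x := by
          conv_rhs => rw [scal_spec x (χ' ≫ ψ)]
          simp
      _ = cup (bar x) ≫ ev (obj (bar x)) := by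
          rw [comp_whiskerRight, Category.assoc, reassoc_of% h1, h3]
          simp [← MonoidalCategory.whiskerLeft_comp_assoc]
  have hk' : scal x (ψ' ≫ χ) * qdim x = qdim (bar x) := by
    rw [← actL_coev_cap (bar x), actL_bar, ← actR_cup_ev x, ← actR_smul]
    congr 1
    calc scal x (ψ' ≫ χ) • (cup x ≫ ev (obj x))
        = cup x ≫ (obj x)ᘁ ◁ (ψ' ≫ χ) ≫ ev (obj x) := by
          conv_rhs => rw [scal_spec x (ψ' ≫ χ)]
          simp
      _ = coev (obj (bar x)) ≫ cap (bar x) := by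
          rw [MonoidalCategory.whiskerLeft_comp, Category.assoc, reassoc_of% h2, h4]
          simp [← comp_whiskerRight_assoc]
  have hkk' : scal x (χ' ≫ ψ) * scal x (ψ' ≫ χ) = 1 := by
    rw [← scal_mul, Category.assoc, reassoc_of% hψψ', hχ'χ, scal_id]
  -- Multiplying the two relations gives equality of the squares; positivity of the dimensions then
  -- forces the scalar to be one.
  have hd : qdim (bar x) = qdim x := by
    have : (qdim (bar x) : ℂ) * qdim (bar x) = qdim x * qdim x := by
      rw [← hk]
      nth_rewrite 2 [hk]
      rw [← hk']
      linear_combination (qdim x : ℂ) * qdim x * hkk'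
    exact_mod_cast (mul_self_inj (qdim_pos _).le (qdim_pos _).le).mp (by exact_mod_cast this)
  have hone : scal x (χ' ≫ ψ) = 1 := by
    rw [hd] at hk
    exact mul_right_cancel₀ (qdim_ne_zero x) (hk.trans (one_mul _).symm)
  have hχψ : χ' = ψ' := by
    have h := scal_spec x (χ' ≫ ψ)
    rw [hone, one_smul] at h
    rw [← Category.comp_id χ', ← hψψ', reassoc_of% h]
  have hχψ' : χ = ψ := by
    rw [← Category.id_comp χ, ← hψψ', Category.assoc, ← hχψ, hχ'χ, Category.comp_id]
  exact ⟨⟨ψ, ψ', hψψ', hψ'ψ⟩, by rw [← h1, hχψ], h2.symm, h3.symm, by rw [← h4, hχψ']⟩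

/-- The dual arcs are first transported to their representatives `bar a`, `bar b`, so that the
antipode applies again. Bending twice returns each half up to the isomorphisms of the double duals,
which cancel by sliding; the two ratios of dimensions remain. -/
theorem antipode_antipode_dbl (a b c e f h : Irr D) (p : Lower (obj a) (obj b) c e)
    (q : Upper (obj a) (obj b) f h) :
    antipode (antipode (dbl a b c e f h p q)) =
      ((qdim f * qdim c / (qdim h * qdim e) : ℝ) : ℂ) • dbl a b c e f h p q := by
  obtain ⟨ψ, ha1, -, ha3, -⟩ := exists_iso_rightDual_bar a
  obtain ⟨φ, -, hb2, -, hb4⟩ := exists_iso_rightDual_bar b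
  have h1 : bendUpper a b f h q = (bendUpper a b f h q ≫ arc (barIso a).inv (barIso b).inv _) ≫
      arc (barIso a).hom (barIso b).hom _ := by
    simp [← arc_comp]
  have h2 : bendUpper (bar a) (bar b) c e
      (arc (barIso a).hom (barIso b).hom _ ≫ bendLower a b c e p) = p ≫ arc ψ.inv φ.inv _ := by
    conv_rhs => rw [← unbend_bendLower a b c e p]
    rw [bendUpper_eq, unbend, wrap_comp, ← Category.assoc, arcUnit_wrap_arc, ha1, hb2,
      ← arcUnit_arc, Category.assoc, Category.assoc, arc_wrap]
  have h3 : bendLower (bar a) (bar b) f h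
      (bendUpper a b f h q ≫ arc (barIso a).inv (barIso b).inv _) = arc ψ.hom φ.hom _ ≫ q := by
    conv_rhs => rw [← wrap_bendUpper_arcCounit a b f h q]
    rw [bendLower_eq, wrap_comp, Category.assoc, wrap_arc_arcCounit, ha3, hb4, ← arc_arcCounit,
      arc_wrap_assoc]
  rw [antipode_dbl, map_smul, h1, resolve_slide, antipode_resolve, h2, h3, resolve_slide,
    ← arc_comp_assoc, smul_smul]
  simp only [Iso.inv_hom_id, arc_id, Category.id_comp, resolve_obj]
  congr 1
  push_cast
  rw [div_mul_div_comm]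

theorem antipode_antipode (X : Tube D) : antipode (antipode X) = mul (mul xi X) xiInv := by
  induction X using tube_induction_simple with
  | zero => simp
  | add x y hx hy => simp only [map_add, LinearMap.add_apply, hx, hy]
  | h a b c e f h p q =>
    rw [xi, xiInv, sum_smul_lines_mul, map_smul, LinearMap.smul_apply, mul_sum_smul_lines,
      resolve_obj, antipode_antipode_dbl, smul_smul]
    congr 1
    push_cast
    rw [div_mul_div_comm, mul_comm (qdim f : ℂ)]

theorem sum_smul_lines_mul_sum_smul_lines (w w' : Irr D → Irr D → ℂ) :
    mul (∑ x, ∑ y, w x y • lines x y) (∑ x, ∑ y, w' x y • lines x y : Tube D) =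
      ∑ x, ∑ y, (w x y * w' x y) • lines x y := by
  rw [map_sum]
  refine Finset.sum_congr rfl fun x _ => ?_
  rw [map_sum]
  refine Finset.sum_congr rfl fun y _ => ?_
  rw [map_smul, lines_eq x y, sum_smul_lines_mul, smul_smul, mul_comm]

theorem comul_sum_smul_lines (w : Irr D → Irr D → ℂ) :
    comul (∑ x, ∑ y, w x y • lines x y : Tube D) =
      ∑ x, ∑ y, ∑ i, w x y • (lines x i ⊗ₜ[ℂ] lines i y) := by
  simp only [map_sum, map_smul, comul_lines, Finset.smul_sum]

theorem isGrouplike_xi : IsGrouplike (mul (D := D)) one comul xi xiInv where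
  mul_inv := by
    rw [xi, xiInv, sum_smul_lines_mul_sum_smul_lines, one_eq]
    refine Finset.sum_congr rfl fun x _ => Finset.sum_congr rfl fun y _ => ?_
    rw [div_mul_div_comm, mul_comm, div_self (mul_ne_zero (qdim_ne_zero x) (qdim_ne_zero y))]
  inv_mul := by
    rw [xi, xiInv, sum_smul_lines_mul_sum_smul_lines, one_eq]
    refine Finset.sum_congr rfl fun x _ => Finset.sum_congr rfl fun y _ => ?_
    rw [div_mul_div_comm, mul_comm, div_self (mul_ne_zero (qdim_ne_zero y) (qdim_ne_zero x))]
  comul_left := by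
    rw [comul_one_eq]
    conv_lhs => rw [xi, comul_sum_smul_lines]
    simp only [map_sum, tensorMul, TensorProduct.map₂_apply_tmul]
    refine Finset.sum_congr rfl fun x _ => Finset.sum_congr rfl fun y _ =>
      Finset.sum_congr rfl fun i _ => ?_
    rw [lines_eq x i, lines_eq i y, xi, TensorProduct.map_tmul, sum_smul_lines_mul,
      sum_smul_lines_mul, TensorProduct.smul_tmul_smul, div_mul_div_cancel₀' (qdim_ne_zero i)]
  comul_right := by
    rw [comul_one_eq]
    conv_lhs => rw [xi, comul_sum_smul_lines]
    simp only [map_sum, tensorMul, TensorProduct.map₂_apply_tmul, LinearMap.sum_apply]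
    refine Finset.sum_congr rfl fun x _ => Finset.sum_congr rfl fun y _ =>
      Finset.sum_congr rfl fun i _ => ?_
    rw [lines_eq x i, lines_eq i y, xi, TensorProduct.map_tmul, mul_sum_smul_lines,
      mul_sum_smul_lines, TensorProduct.smul_tmul_smul, div_mul_div_cancel₀' (qdim_ne_zero i)]

end SquareAntipode

/-! ### Bases of vertices -/

section Vertices

variable {D : Type u} [Category.{v} D] [Preadditive D] [Linear ℂ D]
variable [HasFiniteBiproducts D] [MonoidalCategory D] [MonoidalPreadditive D]
  [MonoidalLinear ℂ D] [RigidCategory D] [UMFC D]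

theorem vnorm_ne_zero (a b c : Irr D) : vnorm a b c ≠ 0 := by
  have ha := qdim_pos a
  have hb := qdim_pos b
  have hc := qdim_pos c
  rw [vnorm, Complex.ofReal_ne_zero]
  positivity

theorem vnorm_mul_vnorm (a e d b c : Irr D) : vnorm a e d * vnorm d b c =
    ((Real.sqrt (qdim a * qdim e * qdim b / qdim c) : ℝ) : ℂ) := by
  have ha := qdim_pos a
  have he := qdim_pos e
  have hd := qdim_pos d
  rw [vnorm, vnorm, ← Complex.ofReal_mul, ← Real.sqrt_mul (by positivity)]
  congr 2
  field_simp

theorem inv_vnorm (a b c : Irr D) :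
    (vnorm a b c)⁻¹ = ((Real.sqrt (qdim c / (qdim a * qdim b)) : ℝ) : ℂ) := by
  rw [vnorm, ← Complex.ofReal_inv, ← Real.sqrt_inv, inv_div]

theorem vnorm_comm (a b c : Irr D) : vnorm a b c = vnorm b a c := by
  rw [vnorm, vnorm, mul_comm (qdim a)]

variable (V : VertexBasis D)

/-- The tree `c → (a e) b` made of two splitting vertices. -/
def splitTree {a b c d e : Irr D} (μ : Fin (mult d b c)) (ν : Fin (mult a e d)) :
    Lower (obj a) (obj b) c e :=
  V.split μ ≫ V.split ν ▷ obj b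

/-- The tree `(a f) b → h` made of two fusion vertices. -/
def fuseTree {a b f g h : Irr D} (ζ : Fin (mult a f g)) (γ : Fin (mult g b h)) :
    Upper (obj a) (obj b) f h :=
  V.fuse ζ ▷ obj b ≫ V.fuse γ

theorem diagram_eq {a b c d e f g h : Irr D} (μ : Fin (mult d b c)) (ν : Fin (mult a e d))
    (ζ : Fin (mult a f g)) (γ : Fin (mult g b h)) :
    diagram V μ ν ζ γ = dbl a b c e f h (splitTree V μ ν) (fuseTree V ζ γ) :=
  rfl

theorem split_fuse_ne {a b c c' : Irr D} (h : c ≠ c') (μ : Fin (mult a b c))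
    (ν : Fin (mult a b c')) : V.split μ ≫ V.fuse ν = 0 := by
  rw [V.loop, delta_ne h, smul_zero, ite_self]

theorem split_fuse {a b c : Irr D} (μ ν : Fin (mult a b c)) :
    V.split μ ≫ V.fuse ν = if μ = ν then vnorm a b c • 𝟙 _ else 0 := by
  simp only [V.loop, delta_self, Fin.ext_iff]

theorem splitTree_fuseTree {a b c d e g h : Irr D} (μ : Fin (mult d b c)) (ν : Fin (mult a e d))
    (ζ : Fin (mult a e g)) (γ : Fin (mult g b h)) :
    splitTree V μ ν ≫ fuseTree V ζ γ =
      open Classical in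
      if d = g ∧ ν.val = ζ.val ∧ μ.val = γ.val then (vnorm a e d * vnorm d b c) • delta c h
      else 0 := by
  rw [splitTree, fuseTree, Category.assoc, ← comp_whiskerRight_assoc]
  by_cases hd : d = g
  · subst hd
    rw [V.loop]
    by_cases hν : ν.val = ζ.val
    · rw [if_pos hν, delta_self, MonoidalLinear.smul_whiskerRight, id_whiskerRight,
        Linear.smul_comp, Category.id_comp, Linear.comp_smul, V.loop]
      by_cases hμ : μ.val = γ.val
      · simp [hν, hμ, smul_smul]
      · simp [hμ]
    · simp [hν]
  · rw [split_fuse_ne V hd, if_neg fun h => hd h.1]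
    simp

theorem sum_fuseTree_splitTree (a b e : Irr D) :
    ∑ d, ∑ c, ∑ μ : Fin (mult d b c), ∑ ν : Fin (mult a e d),
      ((vnorm a e d)⁻¹ * (vnorm d b c)⁻¹) • (fuseTree V ν μ ≫ splitTree V μ ν) =
      𝟙 ((obj a ⊗ obj e) ⊗ obj b) := by
  rw [← id_whiskerRight, ← V.parallel a e, sum_whiskerRight]
  refine Finset.sum_congr rfl fun d _ => ?_
  rw [Finset.sum_congr rfl fun c _ => Finset.sum_comm, Finset.sum_comm, sum_whiskerRight]
  refine Finset.sum_congr rfl fun ν _ => ?_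
  have h : V.fuse ν ▷ obj b ≫ 𝟙 _ ≫ V.split ν ▷ obj b = (V.fuse ν ≫ V.split ν) ▷ obj b := by simp
  rw [MonoidalLinear.smul_whiskerRight, ← h, ← V.parallel d b]
  simp only [Preadditive.sum_comp, Preadditive.comp_sum, Finset.smul_sum, Linear.smul_comp,
    Linear.comp_smul, smul_smul, splitTree, fuseTree, Category.assoc]

theorem eq_sum_splitTree {a b c e : Irr D} (p : Lower (obj a) (obj b) c e) :
    p = ∑ d, ∑ μ : Fin (mult d b c), ∑ ν : Fin (mult a e d),
      ((vnorm a e d)⁻¹ * (vnorm d b c)⁻¹ * scal c (p ≫ fuseTree V ν μ)) • splitTree V μ ν := by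
  conv_lhs => rw [← Category.comp_id p, ← sum_fuseTree_splitTree V]
  rw [Preadditive.comp_sum]
  refine Finset.sum_congr rfl fun d _ => ?_
  rw [Preadditive.comp_sum, Finset.sum_eq_single c]
  · simp only [Preadditive.comp_sum, Linear.comp_smul]
    simp only [← Category.assoc, scal_comp, smul_smul]
  · intro c' _ hc'
    simp only [Preadditive.comp_sum, Linear.comp_smul]
    refine Finset.sum_eq_zero fun μ _ => Finset.sum_eq_zero fun ν _ => ?_
    rw [← Category.assoc, hom_eq_zero hc'.symm (p ≫ _), zero_comp, smul_zero]
  · simp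

theorem eq_sum_fuseTree {a b f h : Irr D} (q : Upper (obj a) (obj b) f h) :
    q = ∑ g, ∑ γ : Fin (mult g b h), ∑ ζ : Fin (mult a f g),
      ((vnorm a f g)⁻¹ * (vnorm g b h)⁻¹ * scal h (splitTree V γ ζ ≫ q)) • fuseTree V ζ γ := by
  conv_lhs => rw [← Category.id_comp q, ← sum_fuseTree_splitTree V]
  rw [Preadditive.sum_comp]
  refine Finset.sum_congr rfl fun g _ => ?_
  rw [Preadditive.sum_comp, Finset.sum_eq_single h]
  · simp only [Preadditive.sum_comp, Linear.smul_comp, Category.assoc, comp_scal, smul_smul]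
  · intro h' _ hh'
    simp only [Preadditive.sum_comp, Linear.smul_comp]
    refine Finset.sum_eq_zero fun μ _ => Finset.sum_eq_zero fun ν _ => ?_
    rw [Category.assoc, hom_eq_zero hh' (_ ≫ q), comp_zero, smul_zero]
  · simp

/-- The labels of the trees `c → (a e) b`. -/
abbrev TreeIndex (a b c e : Irr D) := Σ d, Fin (mult d b c) × Fin (mult a e d)

theorem splitTree_fuseTree_self {a b c e : Irr D} (i : TreeIndex a b c e) :
    splitTree V i.2.1 i.2.2 ≫ fuseTree V i.2.2 i.2.1 =
      (vnorm a e i.1 * vnorm i.1 b c) • 𝟙 _ := by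
  rw [splitTree_fuseTree]
  simp

theorem splitTree_fuseTree_ne {a b c e : Irr D} {i j : TreeIndex a b c e} (h : i ≠ j) :
    splitTree V i.2.1 i.2.2 ≫ fuseTree V j.2.2 j.2.1 = 0 := by
  obtain ⟨d, μ, ν⟩ := i
  obtain ⟨d', μ', ν'⟩ := j
  rw [splitTree_fuseTree, if_neg]
  rintro ⟨hd, hν, hμ⟩
  dsimp only at hd hν hμ
  subst hd
  exact h (by rw [Fin.ext hν, Fin.ext hμ])

/-- The coordinate functionals are pairings with the fusion trees: the loop move gives
orthogonality, and the parallel move used twice gives completeness. -/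
theorem dualBases_splitTree (a b c e : Irr D) :
    Module.DualBases (R := ℂ) (fun i : TreeIndex a b c e => splitTree V i.2.1 i.2.2)
      (fun i => ((vnorm a e i.1)⁻¹ * (vnorm i.1 b c)⁻¹) •
        (scal c ∘ₗ Linear.rightComp ℂ (obj c) (fuseTree V i.2.2 i.2.1))) where
  eval_same i := by
    simp only [LinearMap.smul_apply, LinearMap.comp_apply, Linear.rightComp_apply,
      splitTree_fuseTree_self, scal_smul_id, smul_eq_mul]
    rw [← mul_inv, inv_mul_cancel₀ (mul_ne_zero (vnorm_ne_zero _ _ _) (vnorm_ne_zero _ _ _))]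
  eval_of_ne i j h := by
    simp only [LinearMap.smul_apply, LinearMap.comp_apply, Linear.rightComp_apply,
      splitTree_fuseTree_ne V h.symm, map_zero, smul_zero]
  total {p p'} h := by
    rw [eq_sum_splitTree V p, eq_sum_splitTree V p']
    refine Finset.sum_congr rfl fun d _ => Finset.sum_congr rfl fun μ _ =>
      Finset.sum_congr rfl fun ν _ => ?_
    congr 1
    exact h ⟨d, μ, ν⟩

theorem dualBases_fuseTree (a b f h : Irr D) :
    Module.DualBases (R := ℂ) (fun i : TreeIndex a b h f => fuseTree V i.2.2 i.2.1)
      (fun i => ((vnorm a f i.1)⁻¹ * (vnorm i.1 b h)⁻¹) •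
        (scal h ∘ₗ Linear.leftComp ℂ (obj h) (splitTree V i.2.1 i.2.2))) where
  eval_same i := by
    simp only [LinearMap.smul_apply, LinearMap.comp_apply, Linear.leftComp_apply,
      splitTree_fuseTree_self, scal_smul_id, smul_eq_mul]
    rw [← mul_inv, inv_mul_cancel₀ (mul_ne_zero (vnorm_ne_zero _ _ _) (vnorm_ne_zero _ _ _))]
  eval_of_ne i j h := by
    simp only [LinearMap.smul_apply, LinearMap.comp_apply, Linear.leftComp_apply,
      splitTree_fuseTree_ne V h, map_zero, smul_zero]
  total {q q'} h := by
    rw [eq_sum_fuseTree V q, eq_sum_fuseTree V q']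
    refine Finset.sum_congr rfl fun d _ => Finset.sum_congr rfl fun μ _ =>
      Finset.sum_congr rfl fun ν _ => ?_
    congr 1
    exact h ⟨d, μ, ν⟩

/-- The basis of diagrams with fixed outer labels. -/
def tubeCompBasis (L : TubeLabel D) :
    Module.Basis (TreeIndex L.a L.b L.c L.e × TreeIndex L.a L.b L.h L.f) ℂ (TubeComp L) :=
  (dualBases_splitTree V L.a L.b L.c L.e).basis.tensorProduct
    (dualBases_fuseTree V L.a L.b L.f L.h).basis

open Classical in
/-- The basis of the tube algebra. -/
def tubeBasis : Module.Basis
    (Σ L : TubeLabel D, TreeIndex L.a L.b L.c L.e × TreeIndex L.a L.b L.h L.f) ℂ (Tube D) :=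
  DFinsupp.basis fun L => tubeCompBasis V L

theorem tubeBasis_apply (L : TubeLabel D)
    (i : TreeIndex L.a L.b L.c L.e × TreeIndex L.a L.b L.h L.f) :
    tubeBasis V ⟨L, i⟩ = dbl L.a L.b L.c L.e L.f L.h (splitTree V i.1.2.1 i.1.2.2)
      (fuseTree V i.2.2.2 i.2.2.1) := by
  classical
  have h : tubeCompBasis V L i = splitTree V i.1.2.1 i.1.2.2 ⊗ₜ[ℂ] fuseTree V i.2.2.2 i.2.2.1 := by
    rw [tubeCompBasis, Module.Basis.tensorProduct_apply', Module.DualBases.coe_basis,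
      Module.DualBases.coe_basis]
  rw [dbl, ← h, Module.Basis.apply_eq_iff]
  change sigmaFinsuppEquivDFinsupp.symm (DFinsupp.mapRange
    (fun i => (tubeCompBasis V i).repr) (fun _ => map_zero _) (inc L _)) = _
  rw [Equiv.symm_apply_eq, sigmaFinsuppEquivDFinsupp_single]
  refine (DFinsupp.mapRange_single ..).trans ?_
  congr 1
  exact Module.Basis.repr_self ..

/-- The labels of basis diagrams, grouped by outer labels. -/
def diagramIndexEquiv : (Σ L : TubeLabel D,
    TreeIndex L.a L.b L.c L.e × TreeIndex L.a L.b L.h L.f) ≃ DiagramIndex D where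
  toFun i := ⟨i.1.a, i.1.b, i.1.c, i.2.1.1, i.1.e, i.1.f, i.2.2.1, i.1.h, i.2.1.2.1, i.2.1.2.2,
    i.2.2.2.2, i.2.2.2.1⟩
  invFun x := ⟨⟨x.a, x.b, x.c, x.e, x.f, x.h⟩, ⟨x.d, x.μ, x.ν⟩, ⟨x.g, x.γ, x.ζ⟩⟩
  left_inv _ := rfl
  right_inv _ := rfl

/-- The basis of the tube algebra made of diagrams. -/
def diagramBasis : Module.Basis (DiagramIndex D) ℂ (Tube D) :=
  (tubeBasis V).reindex diagramIndexEquiv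

theorem coe_diagramBasis :
    ⇑(diagramBasis V) = fun x : DiagramIndex D => diagram V x.μ x.ν x.ζ x.γ := by
  ext1 x
  rw [diagramBasis, Module.Basis.reindex_apply]
  exact tubeBasis_apply V ..

theorem finite_tubeLabel : Finite (TubeLabel D) :=
  Finite.of_injective
    (fun L : TubeLabel D => (L.a, L.b, L.c, L.e, L.f, L.h)) fun L L' h => by
      cases L; cases L'; simpa using h

theorem finiteDimensional_tube : FiniteDimensional ℂ (Tube D) := by
  have := finite_tubeLabel (D := D)
  have : ∀ X Y : D, FiniteDimensional ℂ (X ⟶ Y) := UMFC.finiteDimensional_hom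
  have := Fintype.ofFinite (TubeLabel D)
  exact inferInstance

/-! ### The structure maps on basis diagrams -/

theorem mul_diagram_eq_zero (x y : DiagramIndex D) (h : ¬ (x.f = y.h ∧ x.e = y.c)) :
    mul (diagram V x.μ x.ν x.ζ x.γ) (diagram V y.μ y.ν y.ζ y.γ) = 0 := by
  rw [diagram_eq, diagram_eq, mul_dbl]
  by_cases hf : x.f = y.h
  · rw [delta_ne fun he => h ⟨hf, he⟩]
    simp
  · rw [delta_ne (Ne.symm hf)]
    simp

theorem counit_diagram (x : DiagramIndex D) : counit (diagram V x.μ x.ν x.ζ x.γ) =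
    open Classical in
    if x.e = x.f ∧ x.c = x.h ∧ x.d = x.g ∧ x.ν.val = x.ζ.val ∧ x.μ.val = x.γ.val then
      ((Real.sqrt (qdim x.a * qdim x.f * qdim x.b / qdim x.h) : ℝ) : ℂ) else 0 := by
  obtain ⟨a, b, c, d, e, f, g, h, μ, ν, ζ, γ⟩ := x
  dsimp only
  rw [diagram_eq, counit_dbl]
  by_cases he : e = f
  · subst he
    rw [delta_self, wrap_id, Category.id_comp, ← Category.assoc, splitTree_fuseTree]
    by_cases hc : c = h
    · subst hc
      by_cases hd : d = g ∧ ν.val = ζ.val ∧ μ.val = γ.val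
      · rw [if_pos hd, if_pos ⟨rfl, rfl, hd⟩, vnorm_mul_vnorm]
        simp
      · rw [if_neg hd, if_neg fun h => hd h.2.2]
        simp
    · rw [delta_ne (Ne.symm hc), comp_zero, map_zero, if_neg fun h => hc h.2.1]
  · rw [delta_ne he, if_neg fun h => he h.1]
    simp

/-- The trees resolve the identity of the wall. Inserting this resolution and contracting the
canonical element replaces the chosen decomposition by trees, with the inverse loop normalizations
as coefficients. -/
theorem comul_diagram (a b c d e f g h : Irr D) (μ : Fin (mult d b c)) (ν : Fin (mult a e d))
    (ζ : Fin (mult a f g)) (γ : Fin (mult g b h)) :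
    comul (diagram V μ ν ζ γ) =
      ∑ i, ∑ j, ∑ k, ∑ ρ : Fin (mult j b k), ∑ σ : Fin (mult a i j),
        ((Real.sqrt (qdim j / (qdim a * qdim i)) *
          Real.sqrt (qdim k / (qdim j * qdim b)) : ℝ) : ℂ) •
          (diagram V ρ σ ζ γ ⊗ₜ[ℂ] diagram V μ ν σ ρ) := by
  rw [diagram_eq, comul_dbl]
  refine Finset.sum_congr rfl fun i _ => ?_
  set δ := decomp ((obj a ⊗ obj i) ⊗ obj b)
  set G := comulTerm (obj a) (obj b) c e f h (splitTree V μ ν) (fuseTree V ζ γ) i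
  have h1 : ∀ r, G _ (δ.inj r) (δ.proj r) = ∑ j, ∑ k, ∑ ρ : Fin (mult j b k),
      ∑ σ : Fin (mult a i j), ((vnorm a i j)⁻¹ * (vnorm j b k)⁻¹) •
        G _ (δ.inj r) (fuseTree V σ ρ ≫ splitTree V ρ σ ≫ δ.proj r) := by
    intro r
    conv_lhs => rw [← Category.id_comp (δ.proj r), ← sum_fuseTree_splitTree V]
    simp only [Preadditive.sum_comp, map_sum, Linear.smul_comp, map_smul, Category.assoc]
  simp only [h1]
  rw [Finset.sum_comm]
  refine Finset.sum_congr rfl fun j _ => ?_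
  rw [Finset.sum_comm]
  refine Finset.sum_congr rfl fun k _ => ?_
  rw [Finset.sum_comm]
  refine Finset.sum_congr rfl fun ρ _ => ?_
  rw [Finset.sum_comm]
  refine Finset.sum_congr rfl fun σ _ => ?_
  rw [← Finset.smul_sum, casimir_through, Complex.ofReal_mul, ← inv_vnorm, ← inv_vnorm]
  congr 1
  rw [comulTerm_apply, resolve_obj, resolve_obj, diagram_eq, diagram_eq]

/-- Sliding the arc vertices together forms a bubble, which kills the terms with different labels or
vertices and leaves the loop normalization in the others. -/
theorem resolve_sum_left_vertices (a a' : Irr D) (B : D) (c e f h : Irr D)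
    (P : ∀ k, Fin (mult a a' k) → Lower (obj k) B c e)
    (Q : ∀ k, Fin (mult a a' k) → Upper (obj k) B f h) :
    resolve (obj a ⊗ obj a') B c e f h
      (∑ k, ∑ α, P k α ≫ arc (V.split α) (𝟙 B) _) (∑ k, ∑ α, arc (V.fuse α) (𝟙 B) _ ≫ Q k α) =
      ∑ k, ∑ α, vnorm a a' k • resolve (obj k) B c e f h (P k α) (Q k α) := by
  simp only [map_sum, LinearMap.sum_apply]
  refine Finset.sum_congr rfl fun k _ => Finset.sum_congr rfl fun α _ => ?_
  rw [Finset.sum_eq_single k, Finset.sum_eq_single α]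
  · rw [resolve_slide, ← arc_comp_assoc, split_fuse, if_pos rfl, arc_smul_left]
    simp
  · intro α' _ hα
    rw [resolve_slide, ← arc_comp_assoc, split_fuse, if_neg hα]
    simp
  · simp
  · intro k' _ hk
    refine Finset.sum_eq_zero fun α' _ => ?_
    rw [resolve_slide, ← arc_comp_assoc, split_fuse_ne V hk]
    simp
  · simp

theorem resolve_sum_right_vertices (A : D) (b' b : Irr D) (c e f h : Irr D)
    (P : ∀ s, Fin (mult b' b s) → Lower A (obj s) c e)
    (Q : ∀ s, Fin (mult b' b s) → Upper A (obj s) f h) :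
    resolve A (obj b' ⊗ obj b) c e f h
      (∑ s, ∑ ξ, P s ξ ≫ arc (𝟙 A) (V.split ξ) _) (∑ s, ∑ ξ, arc (𝟙 A) (V.fuse ξ) _ ≫ Q s ξ) =
      ∑ s, ∑ ξ, vnorm b' b s • resolve A (obj s) c e f h (P s ξ) (Q s ξ) := by
  simp only [map_sum, LinearMap.sum_apply]
  refine Finset.sum_congr rfl fun s _ => Finset.sum_congr rfl fun ξ _ => ?_
  rw [Finset.sum_eq_single s, Finset.sum_eq_single ξ]
  · rw [resolve_slide, ← arc_comp_assoc, split_fuse, if_pos rfl, arc_smul_right]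
    simp
  · intro ξ' _ hξ
    rw [resolve_slide, ← arc_comp_assoc, split_fuse, if_neg hξ]
    simp
  · simp
  · intro s' _ hs
    refine Finset.sum_eq_zero fun ξ' _ => ?_
    rw [resolve_slide, ← arc_comp_assoc, split_fuse_ne V hs]
    simp
  · simp

/-- Two inverse F-moves bring `a` next to `d'` and then next to `a'`; one F-move collects `b'` and
`b`. The vertices on the arcs are kept outermost so that they can be cancelled against those of the
upper half. -/
theorem stack_splitTree (F : FSymbols V) {a b c d e a' b' d' e' : Irr D}
    (μ : Fin (mult d b c)) (ν : Fin (mult a e d))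
    (μ' : Fin (mult d' b' e)) (ν' : Fin (mult a' e' d')) :
    splitTree V μ ν ≫ wrap (obj a) (obj b) (splitTree V μ' ν') ≫
        (nest (obj a) (obj a') (obj e') (obj b') (obj b)).hom =
      ∑ j, ∑ ω : Fin (mult a d' j), ∑ τ : Fin (mult j b' d), F.splitInv a d' b' d j e ω τ μ' ν •
        ∑ k, ∑ α : Fin (mult a a' k), (∑ β' : Fin (mult k e' j),
          F.splitInv a a' e' j k d' α β' ν' ω •
          ∑ s, ∑ ξ : Fin (mult b' b s), (∑ lam' : Fin (mult j s c),
            F.split j b' b c d s τ μ ξ lam' • splitTree V lam' β') ≫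
              arc (𝟙 (obj k)) (V.split ξ) _) ≫ arc (V.split α) (𝟙 _) _ := by
  -- Rebracket so that the first inverse F-move applies to the part over the strand `d`.
  have h1 : splitTree V μ ν ≫ wrap (obj a) (obj b) (splitTree V μ' ν') ≫
        (nest (obj a) (obj a') (obj e') (obj b') (obj b)).hom =
      V.split μ ≫ (V.split ν ≫ obj a ◁ V.split μ' ≫ (α_ (obj a) (obj d') (obj b')).inv) ▷ obj b ≫
        ((obj a ◁ V.split ν' ≫ (α_ _ _ _).inv) ▷ obj b') ▷ obj b ≫ (α_ _ _ _).hom := by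
    simp only [splitTree, wrap, nest_hom]
    monoidal
  have h2 : ∀ j (ω : Fin (mult a d' j)) (τ : Fin (mult j b' d)),
      V.split μ ≫ (V.split τ ≫ V.split ω ▷ obj b') ▷ obj b ≫
        ((obj a ◁ V.split ν' ≫ (α_ (obj a) (obj a') (obj e')).inv) ▷ obj b') ▷ obj b ≫
          (α_ _ _ _).hom =
      (V.split μ ≫ V.split τ ▷ obj b ≫ (α_ _ _ _).hom) ≫
        (V.split ω ≫ obj a ◁ V.split ν' ≫ (α_ _ _ _).inv) ▷ (obj b' ⊗ obj b) := by
    intro j ω τ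
    monoidal
  have h3 : ∀ j k s (α : Fin (mult a a' k)) (β' : Fin (mult k e' j)) (ξ : Fin (mult b' b s))
      (lam' : Fin (mult j s c)),
      (V.split lam' ≫ obj j ◁ V.split ξ) ≫ (V.split β' ≫ V.split α ▷ obj e') ▷ (obj b' ⊗ obj b) =
      splitTree V lam' β' ≫ arc (𝟙 (obj k)) (V.split ξ) _ ≫ arc (V.split α) (𝟙 _) _ := by
    intro j k s α β' ξ lam'
    simp only [splitTree, arc, id_whiskerRight, id_tensorHom, tensorHom_id, Category.assoc,
      comp_whiskerRight, whisker_exchange_assoc]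
  rw [h1, F.splitInv_move]
  simp only [sum_whiskerRight, Preadditive.sum_comp, Preadditive.comp_sum,
    MonoidalLinear.smul_whiskerRight, Linear.smul_comp, Linear.comp_smul, h2, F.splitInv_move,
    F.split_move, h3, Category.assoc]

theorem stack_fuseTree (F : FSymbols V) {a b f g h a' b' f' g' : Irr D}
    (ζ : Fin (mult a f g)) (γ : Fin (mult g b h))
    (ζ' : Fin (mult a' f' g')) (γ' : Fin (mult g' b' f)) :
    (nest (obj a) (obj a') (obj f') (obj b') (obj b)).inv ≫
      wrap (obj a) (obj b) (fuseTree V ζ' γ') ≫ fuseTree V ζ γ =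
      ∑ i, ∑ ρ : Fin (mult a g' i), ∑ σ : Fin (mult i b' g), F.fuseInv a g' b' g i f ρ σ γ' ζ •
        ∑ k, ∑ α : Fin (mult a a' k), arc (V.fuse α) (𝟙 _) _ ≫ (∑ β : Fin (mult k f' i),
          F.fuseInv a a' f' i k g' α β ζ' ρ •
          ∑ s, ∑ ξ : Fin (mult b' b s), arc (𝟙 (obj k)) (V.fuse ξ) _ ≫
            (∑ lam : Fin (mult i s h), F.fuse i b' b h g s σ γ ξ lam • fuseTree V β lam)) := by
  have h1 : (nest (obj a) (obj a') (obj f') (obj b') (obj b)).inv ≫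
      wrap (obj a) (obj b) (fuseTree V ζ' γ') ≫ fuseTree V ζ γ =
      (α_ _ _ _).inv ≫ (((α_ _ _ _).hom ≫ obj a ◁ V.fuse ζ') ▷ obj b') ▷ obj b ≫
        ((α_ (obj a) (obj g') (obj b')).hom ≫ obj a ◁ V.fuse γ' ≫ V.fuse ζ) ▷ obj b ≫
          V.fuse γ := by
    simp only [fuseTree, wrap, nest_inv]
    monoidal
  have h2 : ∀ i (ρ : Fin (mult a g' i)) (σ : Fin (mult i b' g)),
      (α_ _ _ _).inv ≫
        (((α_ (obj a) (obj a') (obj f')).hom ≫ obj a ◁ V.fuse ζ') ▷ obj b') ▷ obj b ≫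
        (V.fuse ρ ▷ obj b' ≫ V.fuse σ) ▷ obj b ≫ V.fuse γ =
      ((α_ _ _ _).hom ≫ obj a ◁ V.fuse ζ' ≫ V.fuse ρ) ▷ (obj b' ⊗ obj b) ≫
        ((α_ _ _ _).inv ≫ V.fuse σ ▷ obj b ≫ V.fuse γ) := by
    intro i ρ σ
    monoidal
  have h3 : ∀ i k s (α : Fin (mult a a' k)) (β : Fin (mult k f' i)) (ξ : Fin (mult b' b s))
      (lam : Fin (mult i s h)),
      (V.fuse α ▷ obj f' ≫ V.fuse β) ▷ (obj b' ⊗ obj b) ≫ (obj i ◁ V.fuse ξ ≫ V.fuse lam) =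
      arc (V.fuse α) (𝟙 _) _ ≫ arc (𝟙 (obj k)) (V.fuse ξ) _ ≫ fuseTree V β lam := by
    intro i k s α β ξ lam
    simp only [fuseTree, arc, id_whiskerRight, id_tensorHom, tensorHom_id, Category.assoc,
      comp_whiskerRight, whisker_exchange_assoc]
  rw [h1, F.fuseInv_move]
  simp only [sum_whiskerRight, Preadditive.sum_comp, Preadditive.comp_sum,
    MonoidalLinear.smul_whiskerRight, Linear.smul_comp, Linear.comp_smul, h2, F.fuseInv_move]
  simp only [Preadditive.comp_sum, Linear.comp_smul, F.fuse_move, h3]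

theorem mul_diagram (F : FSymbols V) (a b c d e f g h a' b' d' e' f' g' : Irr D)
    (μ : Fin (mult d b c)) (ν : Fin (mult a e d))
    (ζ : Fin (mult a f g)) (γ : Fin (mult g b h))
    (μ' : Fin (mult d' b' e)) (ν' : Fin (mult a' e' d'))
    (ζ' : Fin (mult a' f' g')) (γ' : Fin (mult g' b' f)) :
    mul (diagram V μ ν ζ γ) (diagram V μ' ν' ζ' γ') =
      ∑ i, ∑ ρ : Fin (mult a g' i), ∑ σ : Fin (mult i b' g),
      ∑ j, ∑ ω : Fin (mult a d' j), ∑ τ : Fin (mult j b' d),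
      ∑ k, ∑ α : Fin (mult a a' k), ∑ β : Fin (mult k f' i), ∑ β' : Fin (mult k e' j),
      ∑ s, ∑ ξ : Fin (mult b' b s), ∑ lam : Fin (mult i s h), ∑ lam' : Fin (mult j s c),
        (F.fuseInv a g' b' g i f ρ σ γ' ζ * F.splitInv a d' b' d j e ω τ μ' ν *
          F.fuseInv a a' f' i k g' α β ζ' ρ * F.splitInv a a' e' j k d' α β' ν' ω *
          F.fuse i b' b h g s σ γ ξ lam * F.split j b' b c d s τ μ ξ lam' *
          ((Real.sqrt (qdim a * qdim a' / qdim k) *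
            Real.sqrt (qdim b * qdim b' / qdim s) : ℝ) : ℂ)) •
          diagram V lam' β' β lam := by
  rw [diagram_eq, diagram_eq, mul_dbl, delta_self, delta_self, Category.id_comp, Category.comp_id]
  change resolve _ _ _ _ _ _ (_ ≫ wrap _ _ _ ≫ _) (_ ≫ wrap _ _ _ ≫ _) = _
  -- The sums over the intermediate labels `i` and `j` are independent; those over the new arcs `k`
  -- and `s` are shared by both halves because of the bubbles.
  rw [stack_splitTree V F, stack_fuseTree V F, map_sum]
  refine Finset.sum_congr rfl fun i _ => ?_
  rw [map_sum]
  refine Finset.sum_congr rfl fun ρ _ => ?_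
  rw [map_sum]
  refine Finset.sum_congr rfl fun σ _ => ?_
  rw [map_sum, LinearMap.sum_apply]
  refine Finset.sum_congr rfl fun j _ => ?_
  rw [map_sum, LinearMap.sum_apply]
  refine Finset.sum_congr rfl fun ω _ => ?_
  rw [map_sum, LinearMap.sum_apply]
  refine Finset.sum_congr rfl fun τ _ => ?_
  rw [map_smul, map_smul, LinearMap.smul_apply, resolve_sum_left_vertices, Finset.smul_sum,
    Finset.smul_sum]
  refine Finset.sum_congr rfl fun k _ => ?_
  rw [Finset.smul_sum, Finset.smul_sum]
  refine Finset.sum_congr rfl fun α _ => ?_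
  rw [map_sum, Finset.smul_sum, Finset.smul_sum, Finset.smul_sum]
  refine Finset.sum_congr rfl fun β _ => ?_
  rw [map_sum, LinearMap.sum_apply, Finset.smul_sum, Finset.smul_sum, Finset.smul_sum]
  refine Finset.sum_congr rfl fun β' _ => ?_
  rw [map_smul, map_smul, LinearMap.smul_apply, resolve_sum_right_vertices]
  simp only [Finset.smul_sum]
  refine Finset.sum_congr rfl fun s _ => Finset.sum_congr rfl fun ξ _ => ?_
  rw [map_sum]
  simp only [Finset.smul_sum]
  refine Finset.sum_congr rfl fun lam _ => ?_
  rw [map_sum, LinearMap.sum_apply]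
  simp only [Finset.smul_sum]
  refine Finset.sum_congr rfl fun lam' _ => ?_
  rw [map_smul, map_smul, LinearMap.smul_apply, resolve_obj]
  simp only [smul_smul]
  congr 1
  rw [vnorm_comm b' b, vnorm, vnorm]
  push_cast
  ring

end Vertices

end

end TubeAlg

theorem mainTheorem1 (D : Type u) [Category.{v} D] [Preadditive D] [Linear ℂ D]
    [HasFiniteBiproducts D] [MonoidalCategory D] [MonoidalPreadditive D] [MonoidalLinear ℂ D]
    [RigidCategory D] [UMFC D] :
    -- weak Hopf algebra
    FiniteDimensional ℂ (Tube D) ∧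
    IsWeakHopfAlgebra (mul (D := D)) one comul counit antipode ∧
    -- the grouplike element implementing the square of the antipode
    IsGrouplike (mul (D := D)) one comul xi xiInv ∧
    (∀ X : Tube D, antipode (antipode X) = mul (mul xi X) xiInv) ∧
    (∀ (a b c e f h : Irr D) (p : Lower (obj a) (obj b) c e) (q : Upper (obj a) (obj b) f h),
      antipode (antipode (dbl a b c e f h p q)) =
        ((qdim f * qdim c / (qdim h * qdim e) : ℝ) : ℂ) • dbl a b c e f h p q) ∧
    -- the numbers `d_x` are the positive dimensions determined by the fusion rule
    (∀ x : Irr D, 0 < qdim x) ∧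
    (∀ x y : Irr D, ¬ IsZero (obj x ⊗ obj y) →
      ∑ z, (mult x y z : ℝ) * qdim z = qdim x * qdim y) ∧
    -- for each choice of vertices: the double-arc diagrams form a basis, and the structure maps
    -- take the following form on them
    ∀ V : VertexBasis D,
      LinearIndependent ℂ (fun x : DiagramIndex D => diagram V x.μ x.ν x.ζ x.γ) ∧
      Submodule.span ℂ (Set.range fun x : DiagramIndex D => diagram V x.μ x.ν x.ζ x.γ) = ⊤ ∧
      (∀ x y : DiagramIndex D, ¬ (x.f = y.h ∧ x.e = y.c) →
        mul (diagram V x.μ x.ν x.ζ x.γ) (diagram V y.μ y.ν y.ζ y.γ) = 0) ∧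
      (∀ (F : FSymbols V) (a b c d e f g h a' b' d' e' f' g' : Irr D)
        (μ : Fin (mult d b c)) (ν : Fin (mult a e d))
        (ζ : Fin (mult a f g)) (γ : Fin (mult g b h))
        (μ' : Fin (mult d' b' e)) (ν' : Fin (mult a' e' d'))
        (ζ' : Fin (mult a' f' g')) (γ' : Fin (mult g' b' f)),
        mul (diagram V μ ν ζ γ) (diagram V μ' ν' ζ' γ') =
          ∑ i, ∑ ρ : Fin (mult a g' i), ∑ σ : Fin (mult i b' g),
          ∑ j, ∑ ω : Fin (mult a d' j), ∑ τ : Fin (mult j b' d),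
          ∑ k, ∑ α : Fin (mult a a' k), ∑ β : Fin (mult k f' i), ∑ β' : Fin (mult k e' j),
          ∑ s, ∑ ξ : Fin (mult b' b s), ∑ lam : Fin (mult i s h), ∑ lam' : Fin (mult j s c),
            (F.fuseInv a g' b' g i f ρ σ γ' ζ * F.splitInv a d' b' d j e ω τ μ' ν *
              F.fuseInv a a' f' i k g' α β ζ' ρ * F.splitInv a a' e' j k d' α β' ν' ω *
              F.fuse i b' b h g s σ γ ξ lam * F.split j b' b c d s τ μ ξ lam' *
              ((Real.sqrt (qdim a * qdim a' / qdim k) *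
                Real.sqrt (qdim b * qdim b' / qdim s) : ℝ) : ℂ)) •
              diagram V lam' β' β lam) ∧
      (∀ x : DiagramIndex D, counit (diagram V x.μ x.ν x.ζ x.γ) =
        open Classical in
        if x.e = x.f ∧ x.c = x.h ∧ x.d = x.g ∧ x.ν.val = x.ζ.val ∧ x.μ.val = x.γ.val then
          ((Real.sqrt (qdim x.a * qdim x.f * qdim x.b / qdim x.h) : ℝ) : ℂ) else 0) ∧
      (∀ (a b c d e f g h : Irr D) (μ : Fin (mult d b c)) (ν : Fin (mult a e d))
        (ζ : Fin (mult a f g)) (γ : Fin (mult g b h)),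
        comul (diagram V μ ν ζ γ) =
          ∑ i, ∑ j, ∑ k, ∑ ρ : Fin (mult j b k), ∑ σ : Fin (mult a i j),
            ((Real.sqrt (qdim j / (qdim a * qdim i)) *
              Real.sqrt (qdim k / (qdim j * qdim b)) : ℝ) : ℂ) •
              (diagram V ρ σ ζ γ ⊗ₜ[ℂ] diagram V μ ν σ ρ)) :=
  ⟨finiteDimensional_tube, isWeakHopfAlgebra, isGrouplike_xi, antipode_antipode,
    antipode_antipode_dbl, qdim_pos, fusion_rule, fun V =>
      ⟨coe_diagramBasis V ▸ (diagramBasis V).linearIndependent,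
        coe_diagramBasis V ▸ (diagramBasis V).span_eq, mul_diagram_eq_zero V, mul_diagram V,
        counit_diagram V, comul_diagram V⟩⟩
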